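/- Let $F$ be a non-archimedean local field of characteristic different from $2$, let $E=F(\sqrt d)$ be a quadratic extension field of $F$ ($d\in F^\times$) with nontrivial $F$-automorphism $x\mapsto\bar x$, let $\psi:F\to\mathbb{C}^\times$ be a nontrivial continuous additive character, and put $\psi_d(e)=\psi(\sqrt d\,e)$ for $e\in E$ with $\bar e=-e$. For $n\ge 1$ let $W_n$ be the symplectic $F$-space with ordered basis $e_n,\dots,e_1,f_1,\dots,f_n$, where $\langle e_j,f_k\rangle=\delta_{jk}=-\langle f_k,e_j\rangle$ and all other products vanish, and let $\mathrm{Sp}(W_n)\subset \mathrm{U}(W_n\otimes E)=\mathrm{U}(n,n)(F)$ be its symplectic group and the unitary group of the skew-hermitian space $W_n\otimes E$; matrices are taken with respect to this ordered basis. Let $Q_n^1\subset \mathrm{Sp}(W_n)$ and $P_n^1\subset \mathrm{U}(W_n\otimes E)$ be the Klingen mirabolic subgroups, i.e. the stabilizers of the vector $e_n$, and let $N_n$ be the unipotent radical of $P_n^1$, i.e. the group of matrices in $P_n^1$ that agree with the identity outside the first row and the last column. Representations are on complex vector spaces; a representation of a group is smooth if all stabilizers of vectors are open, and is distinguished by a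 subgroup $H$ if it has a nonzero $H$-invariant linear form. For a character $\chi$ of a subgroup $H$, $\pi_{H,\chi}$ denotes the maximal quotient of $\pi$ on which $H$ acts by $\chi$ (the twisted Jacquet module). (a) Let $n\ge 2$ and let $\psi_n$ be the character of $N_n$ which sends $X=(X_{ij})\in N_n$ to $\psi_d(X_{1,2}+X_{2n-1,2n})$. Let $\pi$ be a smooth representation of $P_n^1$ distinguished by $Q_n^1$. Then there is a character $\mu$ of $N_n$, which is either $\psi_n$ or trivial, such that the action of $P_{n-1}^1\subset P_n^1$ (acting on $W_{n-1}\otimes E$ and fixing $e_n,f_n$) descends to $\pi_{N_n,\mu}$, and $\pi_{N_n,\mu}$ is a smooth representation of $P_{n-1}^1$ distinguished by $Q_{n-1}^1$. (b) Let $n\ge 1$ and let $\pi$ be a smooth representation of $P_n^1$ distinguished by $Q_n^1$. Then there are $\epsilon_1,\dots,\epsilon_{n-1}\in\{0,1\}$ such that $$\mu_n(X)=\psi_d\bigl(\epsilon_1[x_1+x_{2n-1}]+\epsilon_2[x_2+x_{2n-2}]+\cdots+\epsilon_{n-1}[x_{n-1}+x_{n+1}]\bigr),\qquad x_i=X_{i,i+1},$$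 is a character of the group of upper triangular unipotent matrices $X$ in $\mathrm{U}(W_n\otimes E)$ (the middle entry $x_n$ does not occur), and there is a nonzero linear form $\ell$ on $\pi$ with $\ell(\pi(X)v)=\mu_n(X)\ell(v)$ for all such $X$ and all $v\in\pi$. (c) Let $n\ge 1$ and let $\pi$ be a smooth representation of $\mathrm{U}(n,n)(F)=\mathrm{U}(W_n\otimes E)$ distinguished by $\mathrm{Sp}_{2n}(F)=\mathrm{Sp}(W_n)$. Then for the unipotent radical $U$ of any minimal parabolic subgroup of $\mathrm{U}(n,n)(F)$ there is a continuous character $\theta:U\to\mathbb{C}^\times$ with $\pi_{U,\theta}\ne 0$. -/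

import Mathlib

open Matrix

section Groups

/-- Index set of the ordered basis `e_n, …, e_1, f_1, …, f_n` of the symplectic space `W_n`:
`Sum.inl i` stands for `e_{i+1}` and `Sum.inr i` stands for `f_{i+1}`. -/
abbrev WIdx (n : ℕ) : Type := Fin n ⊕ Fin n

/-- Position of a basis vector in the ordering `e_n < ⋯ < e_1 < f_1 < ⋯ < f_n`. -/
def wPos {n : ℕ} : WIdx n → ℤ :=
  Sum.elim (fun i => -((i : ℤ) + 1)) (fun i => (i : ℤ) + 1)

/-- Gram matrix of the form with `⟨e_j, f_k⟩ = δ_{jk} = -⟨f_k, e_j⟩`, all other products zero. -/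
def wForm (n : ℕ) (R : Type*) [CommRing R] : Matrix (WIdx n) (WIdx n) R :=
  Matrix.fromBlocks 0 1 (-1) 0

/-- The isometry group of the form `x, y ↦ τ(x)ᵀ J y` on `R^{2n}`, where `J` is the Gram matrix
above.  For `τ = id` this is the symplectic group `Sp(W_n)`, and for `τ` the conjugation of a
quadratic extension `E / F` it is the unitary group `U(W_n ⊗ E)` of the skew-hermitian space
`W_n ⊗ E`. -/
def isometryGroup {R : Type*} [CommRing R] (τ : R →+* R) (n : ℕ) :
    Subgroup (GL (WIdx n) R) where
  carrier := {g | (g.1.map τ)ᵀ * wForm n R * g.1 = wForm n R}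
  one_mem' := by simp [Matrix.map_one]
  mul_mem' := by
    intro a b ha hb
    simp only [Set.mem_ofPred_eq, Units.val_mul, Matrix.map_mul, Matrix.transpose_mul] at ha hb ⊢
    calc (b.1.map τ)ᵀ * (a.1.map τ)ᵀ * wForm n R * (a.1 * b.1)
        = (b.1.map τ)ᵀ * ((a.1.map τ)ᵀ * wForm n R * a.1) * b.1 := by
          simp only [Matrix.mul_assoc]
      _ = wForm n R := by rw [ha, hb]
  inv_mem' := by
    intro a ha
    simp only [Set.mem_ofPred_eq] at ha ⊢
    have h1 : a.1 * (a⁻¹).1 = 1 := by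
      rw [← Units.val_mul, mul_inv_cancel, Units.val_one]
    have h2 : ((a⁻¹).1.map τ)ᵀ * (a.1.map τ)ᵀ = 1 := by
      rw [← Matrix.transpose_mul, ← Matrix.map_mul, h1]
      simp [Matrix.map_one]
    calc ((a⁻¹).1.map τ)ᵀ * wForm n R * (a⁻¹).1
        = ((a⁻¹).1.map τ)ᵀ * ((a.1.map τ)ᵀ * wForm n R * a.1) * (a⁻¹).1 := by rw [ha]
      _ = (((a⁻¹).1.map τ)ᵀ * (a.1.map τ)ᵀ) * wForm n R * (a.1 * (a⁻¹).1) := by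
          simp only [Matrix.mul_assoc]
      _ = wForm n R := by rw [h1, h2, Matrix.one_mul, Matrix.mul_one]

theorem mem_isometryGroup {R : Type*} [CommRing R] {τ : R →+* R} {n : ℕ} {g : GL (WIdx n) R} :
    g ∈ isometryGroup τ n ↔ (g.1.map τ)ᵀ * wForm n R * g.1 = wForm n R := Iff.rfl

/-- For `τ = id` the group is Mathlib's symplectic group. -/
theorem mem_isometryGroup_id_iff {R : Type*} [CommRing R] {n : ℕ} {g : GL (WIdx n) R} :
    g ∈ isometryGroup (RingHom.id R) n ↔ g.1 ∈ Matrix.symplecticGroup (Fin n) R := by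
  have hJ : wForm n R = -Matrix.J (Fin n) R := by
    simp [wForm, Matrix.J, Matrix.fromBlocks_neg]
  rw [mem_isometryGroup, SymplecticGroup.mem_iff', hJ]
  have : g.1.map (RingHom.id R) = g.1 := by ext; simp
  rw [this]
  simp

/-- The Klingen mirabolic subgroup of the isometry group of `W_{n+1}` (or `W_{n+1} ⊗ E`): the
stabilizer of the isotropic vector `e_{n+1}`.  For `τ = id` this is `Q^1_{n+1}`, for `τ` the
conjugation of `E / F` it is `P^1_{n+1}`. -/
def klingenMirabolic {R : Type*} [CommRing R] (τ : R →+* R) (n : ℕ) :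
    Subgroup (GL (WIdx (n + 1)) R) where
  carrier := {g | g ∈ isometryGroup τ (n + 1) ∧
    g.1 *ᵥ Pi.single (Sum.inl (Fin.last n)) 1 = Pi.single (Sum.inl (Fin.last n)) 1}
  one_mem' := ⟨one_mem _, by rw [Units.val_one, Matrix.one_mulVec]⟩
  mul_mem' := by
    rintro a b ⟨ha, ha'⟩ ⟨hb, hb'⟩
    refine ⟨mul_mem ha hb, ?_⟩
    rw [Units.val_mul, ← Matrix.mulVec_mulVec, hb', ha']
  inv_mem' := by
    rintro a ⟨ha, ha'⟩
    refine ⟨inv_mem ha, ?_⟩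
    have h1 : (a⁻¹).1 * a.1 = 1 := by
      rw [← Units.val_mul, inv_mul_cancel, Units.val_one]
    conv_lhs => rw [← ha']
    rw [Matrix.mulVec_mulVec, h1, Matrix.one_mulVec]

theorem klingenMirabolic_le {R : Type*} [CommRing R] (τ : R →+* R) (n : ℕ) :
    klingenMirabolic τ n ≤ isometryGroup τ (n + 1) := fun _ h => h.1

theorem klingenMirabolic_col {R : Type*} [CommRing R] {τ : R →+* R} {n : ℕ}
    {g : GL (WIdx (n + 1)) R} (hg : g ∈ klingenMirabolic τ n) (a : WIdx (n + 1)) :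
    g.1 a (Sum.inl (Fin.last n)) =
      (1 : Matrix (WIdx (n + 1)) (WIdx (n + 1)) R) a (Sum.inl (Fin.last n)) := by
  have := congrFun hg.2 a
  rw [Matrix.mulVec_single_one] at this
  rw [Matrix.one_apply, ← Pi.single_apply]
  exact this

/-- The unipotent radical of the Klingen mirabolic subgroup (the Heisenberg group): the matrices in
it which agree with the identity outside the row of `e_{n+1}` and the column of `f_{n+1}`. -/
def klingenRadical {R : Type*} [CommRing R] (τ : R →+* R) (n : ℕ) :
    Subgroup (GL (WIdx (n + 1)) R) where
  carrier := {g | g ∈ klingenMirabolic τ n ∧ ∀ a b : WIdx (n + 1),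
    a ≠ Sum.inl (Fin.last n) → b ≠ Sum.inr (Fin.last n) → g.1 a b = (1 : Matrix (WIdx (n + 1)) (WIdx (n + 1)) R) a b}
  one_mem' := ⟨one_mem _, fun _ _ _ _ => rfl⟩
  mul_mem' := by
    rintro g h ⟨hg, hg'⟩ ⟨hh, hh'⟩
    refine ⟨mul_mem hg hh, fun a b ha hb => ?_⟩
    rw [Units.val_mul, Matrix.mul_apply, ← hh' a b ha hb, ← Matrix.one_mul h.1, Matrix.mul_apply]
    refine Finset.sum_congr rfl fun c _ => ?_
    rw [Matrix.one_mul]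
    by_cases hc : c = Sum.inr (Fin.last n)
    · subst hc
      rw [hh' _ b (by simp) hb, Matrix.one_apply_ne (Ne.symm hb)]
      simp
    · rw [hg' a c ha hc]
  inv_mem' := by
    rintro g ⟨hg, hg'⟩
    refine ⟨inv_mem hg, fun a b ha hb => ?_⟩
    have h1 : (g⁻¹).1 * g.1 = 1 := by
      rw [← Units.val_mul, inv_mul_cancel, Units.val_one]
    have h2 : ((g⁻¹).1 * g.1) a b = (g⁻¹).1 a b := by
      rw [Matrix.mul_apply]
      calc ∑ c, (g⁻¹).1 a c * g.1 c b
          = ∑ c, (g⁻¹).1 a c * (1 : Matrix _ _ R) c b := by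
            refine Finset.sum_congr rfl fun c _ => ?_
            by_cases hc : c = Sum.inl (Fin.last n)
            · subst hc
              rw [klingenMirabolic_col (inv_mem hg) a, Matrix.one_apply_ne ha]
              simp
            · rw [hg' c b hc hb]
        _ = (g⁻¹).1 a b := by rw [← Matrix.mul_apply, Matrix.mul_one]
    rw [← h2, h1]

/-- The group of upper triangular unipotent matrices, with respect to the ordered basis
`e_n, …, e_1, f_1, …, f_n`, in the isometry group. -/
def upperUnipotent {R : Type*} [CommRing R] (τ : R →+* R) (n : ℕ) :
    Subgroup (GL (WIdx n) R) where
  carrier := {g | g ∈ isometryGroup τ n ∧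
    ∀ a b : WIdx n, wPos b ≤ wPos a → g.1 a b = (1 : Matrix (WIdx n) (WIdx n) R) a b}
  one_mem' := ⟨one_mem _, fun _ _ _ => rfl⟩
  mul_mem' := by
    rintro g h ⟨hg, hg'⟩ ⟨hh, hh'⟩
    refine ⟨mul_mem hg hh, fun a b hab => ?_⟩
    have h11 : (1 : Matrix (WIdx n) (WIdx n) R) a b =
        ∑ c, (1 : Matrix (WIdx n) (WIdx n) R) a c * (1 : Matrix (WIdx n) (WIdx n) R) c b := by
      rw [← Matrix.mul_apply, Matrix.one_mul]
    rw [Units.val_mul, Matrix.mul_apply, h11]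
    refine Finset.sum_congr rfl fun c _ => ?_
    rcases le_or_gt (wPos c) (wPos a) with hc | hc
    · rcases le_or_gt (wPos b) (wPos c) with hb | hb
      · rw [hg' a c hc, hh' c b hb]
      · have hca : wPos c < wPos a := lt_of_lt_of_le hb hab
        have hne : a ≠ c := by rintro rfl; exact lt_irrefl _ hca
        rw [hg' a c hc, Matrix.one_apply_ne hne]
        simp
    · have hbc : wPos b < wPos c := lt_of_le_of_lt hab hc
      have hne : c ≠ b := by rintro rfl; exact lt_irrefl _ hbc
      rw [hh' c b hbc.le, Matrix.one_apply_ne hne]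
      simp
  inv_mem' := by
    rintro g ⟨hg, hg'⟩
    refine ⟨inv_mem hg, ?_⟩
    have h1 : (g⁻¹).1 * g.1 = 1 := by
      rw [← Units.val_mul, inv_mul_cancel, Units.val_one]
    have key : ∀ k : ℕ, ∀ a b : WIdx n, wPos b + n < k → wPos b ≤ wPos a →
        (g⁻¹).1 a b = (1 : Matrix _ _ R) a b := by
      intro k
      induction k with
      | zero =>
        intro a b hk
        exfalso
        rcases b with i | i <;> simp [wPos] at hk <;> omega
      | succ k ih =>
        intro a b hk hab
        have h2 : ((g⁻¹).1 * g.1) a b = (g⁻¹).1 a b := by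
          rw [Matrix.mul_apply]
          calc ∑ c, (g⁻¹).1 a c * g.1 c b
              = ∑ c, (g⁻¹).1 a c * (1 : Matrix _ _ R) c b := by
                refine Finset.sum_congr rfl fun c _ => ?_
                rcases le_or_gt (wPos b) (wPos c) with hc | hc
                · rw [hg' c b hc]
                · have hca : wPos c < wPos a := lt_of_lt_of_le hc hab
                  have hne : a ≠ c := by rintro rfl; exact lt_irrefl _ hca
                  rw [ih a c (by push_cast at hk; omega) hca.le, Matrix.one_apply_ne hne]
                  simp
            _ = (g⁻¹).1 a b := by rw [← Matrix.mul_apply, Matrix.mul_one]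
        rw [← h2, h1]
    intro a b hab
    exact key ((wPos b + n).toNat + 1) a b (by push_cast; omega) hab

theorem upperUnipotent_le_klingenMirabolic {R : Type*} [CommRing R] (τ : R →+* R) (n : ℕ) :
    upperUnipotent τ (n + 1) ≤ klingenMirabolic τ n := by
  rintro g ⟨hg, hg'⟩
  refine ⟨hg, ?_⟩
  ext a
  rw [Matrix.mulVec_single_one, Matrix.col_apply, hg' a (Sum.inl (Fin.last n)), Matrix.one_apply,
    Pi.single_apply]
  rcases a with i | i <;> simp [wPos] <;> omega

/-- The decomposition of the basis of `W_{n+1}` into the basis of `W_n` and `e_{n+1}, f_{n+1}`. -/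
def wSplit (n : ℕ) : WIdx (n + 1) ≃ WIdx n ⊕ (Unit ⊕ Unit) :=
  (Equiv.sumCongr (finSuccEquivLast.trans (Equiv.optionEquivSumPUnit (Fin n)))
    (finSuccEquivLast.trans (Equiv.optionEquivSumPUnit (Fin n)))).trans
    (Equiv.sumSumSumComm (Fin n) Unit (Fin n) Unit)

theorem wSplit_values (n : ℕ) (i : Fin n) :
    wSplit n (Sum.inl i.castSucc) = Sum.inl (Sum.inl i) ∧
    wSplit n (Sum.inr i.castSucc) = Sum.inl (Sum.inr i) ∧
    wSplit n (Sum.inl (Fin.last n)) = Sum.inr (Sum.inl ()) ∧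
    wSplit n (Sum.inr (Fin.last n)) = Sum.inr (Sum.inr ()) := by
  simp [wSplit]

/-- Extension of an endomorphism of `W_n` to `W_{n+1}` which fixes `e_{n+1}` and `f_{n+1}`. -/
def wExtend (n : ℕ) (R : Type*) [CommRing R] :
    Matrix (WIdx n) (WIdx n) R →* Matrix (WIdx (n + 1)) (WIdx (n + 1)) R where
  toFun M := (Matrix.fromBlocks M 0 0 1).submatrix (wSplit n) (wSplit n)
  map_one' := by
    rw [Matrix.fromBlocks_one, Matrix.submatrix_one_equiv]
  map_mul' M N := by
    rw [Matrix.submatrix_mul_equiv, Matrix.fromBlocks_multiply]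
    simp

theorem wForm_succ (n : ℕ) (R : Type*) [CommRing R] :
    wForm (n + 1) R =
      (Matrix.fromBlocks (wForm n R) 0 0
        (Matrix.fromBlocks 0 1 (-1) 0 : Matrix (Unit ⊕ Unit) (Unit ⊕ Unit) R)).submatrix
        (wSplit n) (wSplit n) := by
  ext a b
  rcases a with i | i <;> rcases b with j | j <;>
    refine Fin.lastCases ?_ (fun i' => ?_) i <;> refine Fin.lastCases ?_ (fun j' => ?_) j <;>
    simp [wForm, wSplit, Matrix.one_apply, Fin.ext_iff] <;> omega

/-- The embedding of the isometry group of `W_n` into the Klingen mirabolic subgroup for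
`W_{n+1}`, acting on `W_n ⊂ W_{n+1}` and fixing `e_{n+1}`, `f_{n+1}`. -/
def leviEmbedding {R : Type*} [CommRing R] (τ : R →+* R) (n : ℕ) :
    isometryGroup τ n →* klingenMirabolic τ n :=
  ((Units.map (wExtend n R)).comp (isometryGroup τ n).subtype).codRestrict _ (by
    rintro ⟨g, hg⟩
    refine ⟨?_, ?_⟩
    · rw [mem_isometryGroup] at hg ⊢
      simp only [MonoidHom.comp_apply, Subgroup.subtype_apply, Units.coe_map, wExtend,
        MonoidHom.coe_mk, OneHom.coe_mk]
      rw [wForm_succ, ← Matrix.submatrix_map, Matrix.transpose_submatrix,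
        Matrix.submatrix_mul_equiv, Matrix.submatrix_mul_equiv, Matrix.fromBlocks_map,
        Matrix.fromBlocks_transpose, Matrix.fromBlocks_multiply, Matrix.fromBlocks_multiply]
      simp [hg, Matrix.map_one]
    · ext a
      rw [Matrix.mulVec_single_one, Matrix.col_apply]
      rcases a with i | i <;> refine Fin.lastCases ?_ (fun i' => ?_) i <;>
        simp [wExtend, wSplit])

/-- The embedding of the Klingen mirabolic subgroup for `W_{n+1}` into that for `W_{n+2}`. -/
def mirabolicEmbedding {R : Type*} [CommRing R] (τ : R →+* R) (n : ℕ) :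
    klingenMirabolic τ n →* klingenMirabolic τ (n + 1) :=
  (leviEmbedding τ (n + 1)).comp (Subgroup.inclusion (klingenMirabolic_le τ n))

end Groups

section UnitaryGroups

variable {F E : Type*} [Field F] [Field E] [Algebra F E]

/-- `U(W_n ⊗ E)`, for `σ` the conjugation of `E / F`. -/
abbrev unitaryW (σ : E ≃ₐ[F] E) (n : ℕ) : Subgroup (GL (WIdx n) E) :=
  isometryGroup (σ : E →+* E) n

/-- `P^1_{n+1}`, the Klingen mirabolic subgroup of `U(W_{n+1} ⊗ E)`. -/
abbrev klingenP (σ : E ≃ₐ[F] E) (n : ℕ) : Subgroup (GL (WIdx (n + 1)) E) :=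
  klingenMirabolic (σ : E →+* E) n

/-- `Sp(W_n)` as a group of matrices over `E`. -/
def symplecticW (F E : Type*) [Field F] [Field E] [Algebra F E] (n : ℕ) :
    Subgroup (GL (WIdx n) E) :=
  (isometryGroup (RingHom.id F) n).map (Matrix.GeneralLinearGroup.map (algebraMap F E))

/-- `Q^1_{n+1}`, the Klingen mirabolic subgroup of `Sp(W_{n+1})`, as a group of matrices over
`E`. -/
def klingenQ (F E : Type*) [Field F] [Field E] [Algebra F E] (n : ℕ) :
    Subgroup (GL (WIdx (n + 1)) E) :=
  (klingenMirabolic (RingHom.id F) n).map (Matrix.GeneralLinearGroup.map (algebraMap F E))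

theorem symplecticW_le_unitaryW (σ : E ≃ₐ[F] E) (n : ℕ) :
    symplecticW F E n ≤ unitaryW σ n := by
  rintro _ ⟨g, hg, rfl⟩
  have hg : (g.1.map (RingHom.id F))ᵀ * wForm n F * g.1 = wForm n F := hg
  have hJ : (wForm n F).map (algebraMap F E) = wForm n E := by
    have h0 : (-1 : Matrix (Fin n) (Fin n) F).map (algebraMap F E) = -1 := by
      ext i j
      by_cases h : i = j <;> simp [h]
    simp [wForm, Matrix.fromBlocks_map, Matrix.map_one, h0]
  have h1 : (Matrix.GeneralLinearGroup.map (algebraMap F E) g).1 = g.1.map (algebraMap F E) := rfl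
  have h2 : (g.1.map (algebraMap F E)).map (σ : E →+* E)
      = (g.1.map (RingHom.id F)).map (algebraMap F E) := by
    ext; simp
  rw [mem_isometryGroup, h1, h2, ← hJ, ← Matrix.transpose_map, ← Matrix.map_mul, ← Matrix.map_mul,
    hg]

theorem klingenQ_le_klingenP (σ : E ≃ₐ[F] E) (n : ℕ) :
    klingenQ F E n ≤ klingenP σ n := by
  rintro _ ⟨g, hg, rfl⟩
  refine ⟨symplecticW_le_unitaryW σ _ ⟨g, hg.1, rfl⟩, ?_⟩
  ext a
  rw [Matrix.mulVec_single_one, Matrix.col_apply]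
  change algebraMap F E (g.1 a _) = _
  rw [klingenMirabolic_col hg, Matrix.one_apply, Pi.single_apply]
  split_ifs <;> simp

/-- The minimal parabolic subgroups of `U(W_n ⊗ E)` are the conjugates of the Borel subgroup of
upper triangular matrices; their unipotent radicals are the conjugates of the group of upper
triangular unipotent matrices. -/
def IsMinimalParabolicRadical (σ : E ≃ₐ[F] E) {n : ℕ} (H : Subgroup (unitaryW σ n)) : Prop :=
  ∃ g : unitaryW σ n, H =
    ((upperUnipotent (σ : E →+* E) n).subgroupOf (unitaryW σ n)).map (MulAut.conj g).toMonoidHom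

/-- The character `ψ_d(e) = ψ(√d e)` of the trace zero elements of `E`, where `δ = √d`.
For `e` of trace zero, `δ e` lies in the image of `F` (see `algebraMap_invFun_mul`), and `ψ` is
evaluated at the unique element of `F` mapping to it. -/
noncomputable def psiD (ψ : AddChar F ℂ) (δ e : E) : ℂ :=
  ψ (Function.invFun (algebraMap F E) (δ * e))

theorem eq_one_of_adjoin_eq_top {σ : E ≃ₐ[F] E} {y : E} (h : σ y = y)
    (hy : IntermediateField.adjoin F {y} = ⊤) : σ = 1 := by
  have hle : IntermediateField.adjoin F {y} ≤
      IntermediateField.fixedField (Subgroup.zpowers σ) := by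
    rw [IntermediateField.adjoin_le_iff, Set.singleton_subset_iff]
    rintro ⟨τ, hτ⟩
    obtain ⟨k, rfl⟩ := Subgroup.mem_zpowers_iff.mp hτ
    have : σ ∈ MulAction.stabilizer (E ≃ₐ[F] E) y := h
    exact (zpow_mem this k :)
  rw [hy, top_le_iff] at hle
  ext x
  have hx : x ∈ IntermediateField.fixedField (Subgroup.zpowers σ) := by rw [hle]; trivial
  exact hx ⟨σ, Subgroup.mem_zpowers σ⟩

theorem conj_sqrt {σ : E ≃ₐ[F] E} (hσ : σ ≠ 1) {d : F} {δ : E} (hd : δ ^ 2 = algebraMap F E d)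
    (hδ : IntermediateField.adjoin F {δ} = ⊤) : σ δ = -δ := by
  have h1 : (σ δ) ^ 2 = δ ^ 2 := by rw [← map_pow, hd, σ.commutes]
  exact (sq_eq_sq_iff_eq_or_eq_neg.mp h1).resolve_left
    fun h => hσ (eq_one_of_adjoin_eq_top h hδ)

theorem algebraMap_invFun_mul (h2 : Module.finrank F E = 2) {σ : E ≃ₐ[F] E} (hσ : σ ≠ 1) {d : F}
    {δ : E} (hd : δ ^ 2 = algebraMap F E d) (hδ : IntermediateField.adjoin F {δ} = ⊤) {e : E}
    (he : σ e = -e) : algebraMap F E (Function.invFun (algebraMap F E) (δ * e)) = δ * e := by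
  apply Function.invFun_eq
  have hfix : σ (δ * e) = δ * e := by rw [map_mul, conj_sqrt hσ hd hδ, he]; ring
  have hs := IntermediateField.isSimpleOrder_of_finrank_prime F E (h2 ▸ Nat.prime_two)
  rcases hs.eq_bot_or_eq_top (IntermediateField.adjoin F {δ * e}) with h | h
  · rw [IntermediateField.adjoin_simple_eq_bot_iff] at h
    exact IntermediateField.mem_bot.mp h
  · exact absurd (eq_one_of_adjoin_eq_top hfix h) hσ

/-- The element `∑ ε_i (x_i + x_{2n-i})` of `E` attached to a matrix with superdiagonal entries
`x_1, …, x_{2n-1}` in the ordered basis `e_n, …, e_1, f_1, …, f_n`, for `n = m + 1`; the middle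
entry `x_n` does not occur.  The term for `j` uses the entries in positions `(e_{j+2}, e_{j+1})` and
`(f_{j+1}, f_{j+2})`, that is, `i = n - 1 - j`. -/
def superdiagSum {m : ℕ} (ε : Fin m → E) (X : Matrix (WIdx (m + 1)) (WIdx (m + 1)) E) : E :=
  ∑ j : Fin m, ε j *
    (X (Sum.inl j.succ) (Sum.inl j.castSucc) + X (Sum.inr j.castSucc) (Sum.inr j.succ))

/-- The sum `x_{2n-1} + y_{2n-1}` for a matrix in the Klingen radical, for the rank `n = m + 2`: the
sum of the entries in positions `(e_n, e_{n-1})` and `(f_{n-1}, f_n)`. -/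
def klingenSum {m : ℕ} (X : Matrix (WIdx (m + 2)) (WIdx (m + 2)) E) : E :=
  X (Sum.inl (Fin.last (m + 1))) (Sum.inl (Fin.last m).castSucc) +
    X (Sum.inr (Fin.last m).castSucc) (Sum.inr (Fin.last (m + 1)))

theorem upperUnipotent_entry (σ : E ≃ₐ[F] E) {m : ℕ}
    {g : GL (WIdx (m + 1)) E} (hg : g ∈ upperUnipotent (σ : E →+* E) (m + 1)) (j : Fin m) :
    g.1 (Sum.inr j.castSucc) (Sum.inr j.succ) = -σ (g.1 (Sum.inl j.succ) (Sum.inl j.castSucc)) := by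
  obtain ⟨hU, hT⟩ := hg
  have h := congrFun (congrFun (mem_isometryGroup.mp hU) (Sum.inl j.castSucc)) (Sum.inr j.succ)
  have hR : wForm (m + 1) E (Sum.inl j.castSucc) (Sum.inr j.succ) = 0 := by
    simp [wForm, Fin.ext_iff]
  have hz : ∀ k : Fin (m + 1), g.1 (Sum.inr k) (Sum.inl j.castSucc) = 0 := fun k => by
    rw [hT _ _ (by simp [wPos]; omega)]; simp
  have hL : ((g.1.map (σ : E →+* E))ᵀ * wForm (m + 1) E * g.1) (Sum.inl j.castSucc)
      (Sum.inr j.succ) =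
      ∑ k : Fin (m + 1), σ (g.1 (Sum.inl k) (Sum.inl j.castSucc)) *
        g.1 (Sum.inr k) (Sum.inr j.succ) := by
    simp [Matrix.mul_apply, wForm, Matrix.one_apply, hz]
  rw [hL, hR, ← Finset.sum_subset (Finset.subset_univ {j.castSucc, j.succ}),
    Finset.sum_pair (by simp [Fin.ext_iff])] at h
  · rw [hT (Sum.inl j.castSucc) (Sum.inl j.castSucc) le_rfl,
      hT (Sum.inr j.succ) (Sum.inr j.succ) le_rfl] at h
    simp at h
    linear_combination h
  · intro k _ hk
    simp only [Finset.mem_insert, Finset.mem_singleton, not_or, Fin.ext_iff, Fin.val_castSucc,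
      Fin.val_succ] at hk
    rcases lt_or_ge (k : ℕ) j with hlt | hge
    · rw [hT (Sum.inl k) _ (by simp [wPos]; omega), Matrix.one_apply_ne
        (by simp [Fin.ext_iff]; omega)]
      simp
    · rw [hT (Sum.inr k) _ (by simp [wPos]; omega), Matrix.one_apply_ne
        (by simp [Fin.ext_iff]; omega)]
      simp

/-- On upper triangular unipotent matrices of the unitary group the argument `superdiagSum` of
`psiD` has trace zero. -/
theorem conj_superdiagSum {σ : E ≃ₐ[F] E} (hσ : σ ≠ 1) {d : F} {δ : E}
    (hd : δ ^ 2 = algebraMap F E d) (hδ : IntermediateField.adjoin F {δ} = ⊤) {m : ℕ}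
    {ε : Fin m → E} (hε : ∀ j, ε j = 0 ∨ ε j = 1) {g : GL (WIdx (m + 1)) E}
    (hg : g ∈ upperUnipotent (σ : E →+* E) (m + 1)) :
    σ (superdiagSum ε g.1) = -superdiagSum ε g.1 := by
  have hinv : ∀ x, σ (σ x) = x := fun x => by
    have : σ * σ = 1 := eq_one_of_adjoin_eq_top (y := δ)
      (by rw [AlgEquiv.mul_apply, conj_sqrt hσ hd hδ, map_neg, conj_sqrt hσ hd hδ, neg_neg]) hδ
    exact DFunLike.congr_fun this x
  rw [superdiagSum, map_sum, ← Finset.sum_neg_distrib]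
  refine Finset.sum_congr rfl fun j _ => ?_
  rw [upperUnipotent_entry σ hg j]
  rcases hε j with h | h <;> rw [h] <;> simp [hinv]

end UnitaryGroups

section Representations

variable {G V : Type*} [Group G] [AddCommGroup V] [Module ℂ V]

/-- A representation is smooth if all stabilizers of vectors are open. -/
def IsSmoothRep [TopologicalSpace G] (π : Representation ℂ G V) : Prop :=
  ∀ v : V, IsOpen {g : G | π g v = v}

/-- `π` is distinguished by `H` if there is a nonzero `H`-invariant linear form. -/
def IsDistinguishedBy (π : Representation ℂ G V) (H : Subgroup G) : Prop :=
  ∃ ℓ : V →ₗ[ℂ] ℂ, ℓ ≠ 0 ∧ ∀ h ∈ H, ∀ v : V, ℓ (π h v) = ℓ v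

/-- The span of the vectors `π(h) v - χ(h) v`. -/
def twistedSpan (π : Representation ℂ G V) (H : Subgroup G) (χ : H →* ℂˣ) : Submodule ℂ V :=
  Submodule.span ℂ {w | ∃ (h : H) (v : V), w = π h v - (χ h : ℂ) • v}

/-- The twisted Jacquet module `π_{H, χ}`: the maximal quotient of `π` on which `H` acts by `χ`. -/
abbrev TwistedJacquet (π : Representation ℂ G V) (H : Subgroup G) (χ : H →* ℂˣ) : Type _ :=
  V ⧸ twistedSpan π H χ

end Representations

/-! ### Valuation boxes: compact open subgroups of `F ^ ι` forming a neighbourhood basis of zero. -/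

section LocalFieldBoxes

open ValuativeRel MeasureTheory Filter Topology

variable {F : Type*} [Field F] [ValuativeRel F]

/-! Write the Heisenberg group `N` of `W_k ⊗ E` as the product of its `F`-rational part, contained
in the rational mirabolic, and the elements `skewHeis y` with `y` in `W_k`, attached to the vectors
`δ y`. The skew elements commute with the rational ones, and they multiply additively in `y` up to a
rational central element. If `ℓ` is an invariant form for the rational mirabolic, each vector `v`
therefore gives a function `y ↦ ℓ (π (skewHeis y) v)` on `W_k`. On these functions `N` acts by
translations and `Sp(W_k)` by linear substitution. Smoothness makes each function uniformly locally
constant and invariant under small symplectic transvections.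

The analytic core is `const_or_exists_equivariant_form`: either all these functions are constant, or
some form on `V` transforms under translations by the character `ψ ⟨a, ·⟩`, for a prescribed `a ≠
0`, and is fixed by the stabilizer of `a`. The form is the Fourier coefficient at `a`, which must be
regularized because the functions need not decay. The Fourier transform of a truncated function
inherits its invariance under small transvections. Two of these reach every point near `a`, so the
transform is constant on a neighbourhood of `a` that does not depend on the truncation. Averaging
over that neighbourhood kills contributions supported far from zero. Hence the truncated
coefficients stabilize, with the same limit for every symplectic image of the boxes
(`exists_eventually_wFourier_eq`), which gives the equivariance. If the coefficient vanishes at `a`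
for all `v`, transitivity of `Sp(W_k)` makes it vanish at every nonzero point, and Fourier inversion
forces the functions to be constant (`eq_zero_value_of_eventually_wFourier_eq_zero`).

If all functions are constant, `ℓ` is itself `N`-invariant and the trivial character occurs.
Otherwise take `a` to be `2d` times the first vector of the basis of `W_k`: the character becomes
`ψ_d` of the two outer superdiagonal entries, and the stabilizer of `a` is the next smaller rational
mirabolic (`exists_radical_equivariant_form`). The form descends to the twisted Jacquet module, and
induction on the rank yields the form for the upper unipotent group. For the unitary group one
restricts to the mirabolic and conjugates. -/

/-- The vectors all of whose coordinates have valuation at most `γ`. -/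
def valBox (F : Type*) [Field F] [ValuativeRel F] (ι : Type*) (γ : ValueGroupWithZero F) :
    AddSubgroup (ι → F) where
  carrier := {y | ∀ i, valuation F (y i) ≤ γ}
  zero_mem' := fun i => by simp
  add_mem' := fun ha hb i => ((valuation F).map_add _ _).trans (max_le (ha i) (hb i))
  neg_mem' := fun ha i => by simpa using ha i

variable {ι : Type*}

theorem mem_valBox {γ : ValueGroupWithZero F} {y : ι → F} :
    y ∈ valBox F ι γ ↔ ∀ i, valuation F (y i) ≤ γ := Iff.rfl

theorem valBox_mono {γ γ' : ValueGroupWithZero F} (h : γ ≤ γ') : valBox F ι γ ≤ valBox F ι γ' :=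
  fun _ hy i => (hy i).trans h

theorem exists_mem_valBox [Finite ι] (y : ι → F) : ∃ γ, y ∈ valBox F ι γ := by
  cases nonempty_fintype ι
  exact ⟨Finset.univ.sup fun i => valuation F (y i), fun i =>
    Finset.le_sup (f := fun i => valuation F (y i)) (Finset.mem_univ i)⟩

theorem valuation_dotProduct_le [Fintype ι] {α β : ValueGroupWithZero F} {x y : ι → F}
    (hx : x ∈ valBox F ι α) (hy : y ∈ valBox F ι β) : valuation F (x ⬝ᵥ y) ≤ α * β :=
  (valuation F).map_sum_le fun i _ => by
    rw [map_mul]; exact mul_le_mul' (hx i) (hy i)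

variable [TopologicalSpace F] [IsNonarchimedeanLocalField F]

theorem isOpen_valBox [Finite ι] {γ : ValueGroupWithZero F} (hγ : γ ≠ 0) :
    IsOpen (valBox F ι γ : Set (ι → F)) := by
  apply AddSubgroup.isOpen_of_mem_nhds (g := 0)
  have : ∀ i, ∀ᶠ y : ι → F in 𝓝 0, valuation F (y i) ≤ γ := fun i => by
    have h1 : {x : F | valuation F x ≤ γ} ∈ 𝓝 (0 : F) :=
      (IsValuativeTopology.hasBasis_nhds_zero' F).mem_iff.mpr ⟨γ, hγ, fun x hx => le_of_lt ((show valuation F x < γ from hx))⟩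
    exact (continuous_apply i).continuousAt (x := (0 : ι → F)) h1
  exact eventually_all.mpr this

theorem isCompact_valBox (γ : ValueGroupWithZero F) : IsCompact (valBox F ι γ : Set (ι → F)) := by
  have := isCompact_univ_pi fun _ : ι => IsNonarchimedeanLocalField.isCompact_closedBall F γ
  convert this using 1
  ext y; simp [mem_valBox]

/-- The valuation is nontrivial, so a lower bound of the family can be shrunk by an element of
valuation below one. The strict inequality lets closed boxes fit inside the open balls of the
topology. -/
theorem exists_lt_of_finite [Finite ι] (γ : ι → ValueGroupWithZero F) (hγ : ∀ i, γ i ≠ 0) :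
    ∃ γ₀ : ValueGroupWithZero F, γ₀ ≠ 0 ∧ ∀ i, γ₀ < γ i := by
  obtain ⟨M, hM⟩ := Finite.exists_ge fun i => Units.mk0 (γ i) (hγ i)
  obtain ⟨c, hc, hc1⟩ := Valuation.IsNontrivial.exists_lt_one (v := valuation F)
  refine ⟨valuation F c * M, by simpa using hc, fun i => ?_⟩
  calc valuation F c * M < 1 * M := mul_lt_mul_of_pos_right hc1 (zero_lt_iff.mpr M.ne_zero)
    _ ≤ γ i := by rw [one_mul]; exact Units.val_le_val.mpr (hM i)

theorem exists_valBox_subset [Finite ι] {s : Set (ι → F)} (hs : s ∈ 𝓝 0) :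
    ∃ γ : ValueGroupWithZero F, γ ≠ 0 ∧ (valBox F ι γ : Set (ι → F)) ⊆ s := by
  rw [nhds_pi] at hs
  obtain ⟨I, -, t, ht, hI⟩ := Filter.mem_pi.mp hs
  have h1 : ∀ i, ∃ γ : ValueGroupWithZero F, γ ≠ 0 ∧ {x | valuation F x < γ} ⊆ t i := fun i =>
    (IsValuativeTopology.hasBasis_nhds_zero' F).mem_iff.mp (ht i)
  choose γ hγ hγt using h1
  obtain ⟨γ₀, h0, hlt⟩ := exists_lt_of_finite γ hγ
  exact ⟨γ₀, h0, fun y hy => hI fun i _ => hγt i ((hy i).trans_lt (hlt i))⟩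

end LocalFieldBoxes

/-! ### Scaling of Haar measure by linear maps; symplectic maps preserve it. -/

section Transpose

variable {F : Type*} [Field F] {ι : Type*} [Fintype ι] [DecidableEq ι]

/-- The transpose of an invertible matrix. -/
def glTranspose (g : GL ι F) : GL ι F where
  val := g.1ᵀ
  inv := (g⁻¹).1ᵀ
  val_inv := by rw [← Matrix.transpose_mul, ← Units.val_mul, inv_mul_cancel]; simp
  inv_val := by rw [← Matrix.transpose_mul, ← Units.val_mul, mul_inv_cancel]; simp

theorem glTranspose_mul (g h : GL ι F) :
    glTranspose (g * h) = glTranspose h * glTranspose g := by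
  ext : 1; exact Matrix.transpose_mul _ _

end Transpose

section HaarModulus

open MeasureTheory Filter Topology

variable {F : Type*} [Field F] [TopologicalSpace F] [IsTopologicalRing F]
  {ι : Type*} [Fintype ι] [DecidableEq ι]

/-- The action of an invertible matrix on column vectors, as a continuous additive equivalence. -/
def glEquiv (g : GL ι F) : (ι → F) ≃ₜ+ (ι → F) where
  toFun y := g.1 *ᵥ y
  invFun y := (g⁻¹).1 *ᵥ y
  left_inv y := by
    change _ *ᵥ (_ *ᵥ _) = _
    rw [Matrix.mulVec_mulVec, ← Units.val_mul, inv_mul_cancel]; simp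
  right_inv y := by
    change _ *ᵥ (_ *ᵥ _) = _
    rw [Matrix.mulVec_mulVec, ← Units.val_mul, mul_inv_cancel]; simp
  map_add' := Matrix.mulVec_add _
  continuous_toFun := by fun_prop
  continuous_invFun := by fun_prop

@[simp] theorem glEquiv_apply (g : GL ι F) (y : ι → F) : glEquiv g y = g.1 *ᵥ y := rfl

variable [LocallyCompactSpace F] [MeasurableSpace (ι → F)] [BorelSpace (ι → F)]

/-- The factor by which an invertible matrix scales the Haar measure. -/
noncomputable def glModulus : GL ι F →* NNReal where
  toFun g := addEquivAddHaarChar (glEquiv g)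
  map_one' := by
    have : glEquiv (1 : GL ι F) = ContinuousAddEquiv.refl _ := by ext; simp
    rw [this, addEquivAddHaarChar_refl]
  map_mul' g h := by
    have : glEquiv (g * h) = (glEquiv h).trans (glEquiv g) := by
      ext; simp
    rw [this, addEquivAddHaarChar_trans, mul_comm]

theorem glModulus_pos (g : GL ι F) : 0 < glModulus g := addEquivAddHaarChar_pos _

/-- The modulus takes values in a commutative monoid, so it suffices to treat diagonal matrices,
which are symmetric, and transvections, which are conjugate to their transposes by a coordinate
swap. -/
theorem glModulus_transpose (g : GL ι F) : glModulus (glTranspose g) = glModulus g := by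
  suffices h : ∀ g' : GL ι F, g'.1 = g.1 → glModulus (glTranspose g') = glModulus g' from h g rfl
  refine Matrix.diagonal_transvection_induction_of_det_ne_zero
    (fun M => ∀ g' : GL ι F, g'.1 = M → glModulus (glTranspose g') = glModulus g') g.1
    ((Matrix.isUnit_iff_isUnit_det _).mp g.isUnit).ne_zero ?_ ?_ ?_
  · intro D _ g' hg'
    congr 1; ext : 1
    simp [glTranspose, hg']
  · intro t g' hg'
    let w : GL ι F := ⟨(Equiv.swap t.i t.j).permMatrix F, (Equiv.swap t.i t.j).permMatrix F,
      by rw [← Matrix.permMatrix_mul]; simp, by rw [← Matrix.permMatrix_mul]; simp⟩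
    have h1 : glTranspose g' * w = w * g' := by
      ext : 1
      simp only [glTranspose, w, hg', Matrix.TransvectionStruct.toMatrix, Matrix.transvection,
        Units.val_mul, Equiv.Perm.permMatrix, PEquiv.toMatrix_toPEquiv_mul,
        PEquiv.mul_toMatrix_toPEquiv, Matrix.transpose_add, Matrix.transpose_one,
        Matrix.transpose_single]
      ext a b
      have hs : ∀ x, t.i = Equiv.swap t.i t.j x ↔ t.j = x := fun x => by
        rw [eq_comm, Equiv.swap_apply_eq_iff, Equiv.swap_apply_left, eq_comm]
      simp [Matrix.one_apply, Matrix.single_apply, Equiv.swap_apply_eq_iff, hs]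
    have h2 := congrArg glModulus h1
    rw [map_mul, map_mul, mul_comm] at h2
    exact mul_left_cancel₀ (glModulus_pos w).ne' h2
  · intro A B hA hB ihA ihB g' hg'
    have h1 : g' = GeneralLinearGroup.mkOfDetNeZero A hA * GeneralLinearGroup.mkOfDetNeZero B hB := by
      ext : 1; exact hg'
    rw [h1, glTranspose_mul, map_mul, map_mul,
      ihA (GeneralLinearGroup.mkOfDetNeZero A hA) rfl,
      ihB (GeneralLinearGroup.mkOfDetNeZero B hB) rfl, mul_comm]

/-- Taking moduli in `gᵀ J g = J` shows that the square of the modulus of `g` is one, and the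
modulus is positive. -/
theorem glModulus_eq_one_of_isometry {n : ℕ} [MeasurableSpace (WIdx n → F)]
    [BorelSpace (WIdx n → F)] {g : GL (WIdx n) F}
    (hg : g ∈ isometryGroup (RingHom.id F) n) : glModulus g = 1 := by
  let J : GL (WIdx n) F := ⟨wForm n F, -wForm n F,
    by simp [wForm, Matrix.fromBlocks_multiply, Matrix.fromBlocks_neg],
    by simp [wForm, Matrix.fromBlocks_multiply, Matrix.fromBlocks_neg]⟩
  have h1 : glTranspose g * J * g = J := by
    ext : 1
    have := mem_isometryGroup.mp hg
    have h2 : g.1.map (RingHom.id F) = g.1 := by ext; simp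
    rw [h2] at this
    exact this
  have h2 := congrArg glModulus h1
  rw [map_mul, map_mul, glModulus_transpose] at h2
  have h3 : glModulus g ^ 2 = 1 := by
    apply mul_left_cancel₀ (glModulus_pos J).ne'
    rw [mul_one]; conv_rhs => rw [← h2]
    ring
  exact (pow_eq_one_iff_of_nonneg (glModulus_pos g).le two_ne_zero).mp h3

theorem integral_comp_mulVec_of_isometry {n : ℕ} [MeasurableSpace (WIdx n → F)]
    [BorelSpace (WIdx n → F)] (μ : Measure (WIdx n → F)) [μ.IsAddHaarMeasure] [μ.Regular]
    {g : GL (WIdx n) F} (hg : g ∈ isometryGroup (RingHom.id F) n) (f : (WIdx n → F) → ℂ) :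
    ∫ y, f (g.1 *ᵥ y) ∂μ = ∫ y, f y ∂μ := by
  have h := addEquivAddHaarChar_smul_map μ (glEquiv g)
  have h1 : addEquivAddHaarChar (glEquiv g) = 1 := glModulus_eq_one_of_isometry hg
  rw [h1, one_smul] at h
  conv_rhs => rw [← h]
  exact ((glEquiv g).toHomeomorph.measurableEmbedding.integral_map f).symm

end HaarModulus

/-! ### Symplectic transvections and transitivity on nonzero vectors. -/

section Symplectic

variable {F : Type*} [Field F] {m : ℕ}

/-- The symplectic form of `W_m`. -/
noncomputable def wPair : LinearMap.BilinForm F (WIdx m → F) := Matrix.toBilin' (wForm m F)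

theorem wPair_apply (x y : WIdx m → F) : wPair x y = x ⬝ᵥ wForm m F *ᵥ y :=
  Matrix.toBilin'_apply' _ _ _

theorem wPair_eq_sum (x y : WIdx m → F) :
    wPair x y = ∑ i, (x (Sum.inl i) * y (Sum.inr i) - x (Sum.inr i) * y (Sum.inl i)) := by
  simp [wPair_apply, wForm, dotProduct, Matrix.mulVec, Matrix.one_apply, Finset.sum_sub_distrib,
    ← sub_eq_add_neg]

theorem wPair_self (x : WIdx m → F) : wPair x x = 0 := by
  simp [wPair_eq_sum, mul_comm]

theorem wPair_comm (x y : WIdx m → F) : wPair x y = -wPair y x := by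
  simp [wPair_eq_sum, mul_comm]

theorem mem_isometryGroup_iff_wPair {g : GL (WIdx m) F} :
    g ∈ isometryGroup (RingHom.id F) m ↔ ∀ x y, wPair (g.1 *ᵥ x) (g.1 *ᵥ y) = wPair x y := by
  have h2 : g.1.map (RingHom.id F) = g.1 := by ext; simp
  have h3 : ∀ x y, wPair (g.1 *ᵥ x) (g.1 *ᵥ y) = Matrix.toBilin' (g.1ᵀ * wForm m F * g.1) x y := by
    intro x y
    rw [wPair_apply, Matrix.toBilin'_apply', ← Matrix.mulVec_mulVec, ← Matrix.mulVec_mulVec,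
      Matrix.dotProduct_mulVec x, Matrix.vecMul_transpose]
  rw [mem_isometryGroup, h2]
  simp only [h3]
  rw [wPair, ← (Matrix.toBilin' (n := WIdx m) (R₁ := F)).injective.eq_iff, LinearMap.ext_iff₂]

/-- The symplectic transvection `y ↦ y + t ⟨b, y⟩ b`. -/
noncomputable def wTransvection (t : F) (b : WIdx m → F) : GL (WIdx m) F where
  val := 1 + t • vecMulVec b (b ᵥ* wForm m F)
  inv := 1 + (-t) • vecMulVec b (b ᵥ* wForm m F)
  val_inv := by
    have h : (b ᵥ* wForm m F) ⬝ᵥ b = 0 := by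
      rw [← Matrix.dotProduct_mulVec, ← wPair_apply, wPair_self]
    simp [add_mul, mul_add, Matrix.vecMulVec_mul_vecMulVec, h]
  inv_val := by
    have h : (b ᵥ* wForm m F) ⬝ᵥ b = 0 := by
      rw [← Matrix.dotProduct_mulVec, ← wPair_apply, wPair_self]
    simp [add_mul, mul_add, Matrix.vecMulVec_mul_vecMulVec, h]

theorem wTransvection_mulVec (t : F) (b y : WIdx m → F) :
    (wTransvection t b).1 *ᵥ y = y + (t * wPair b y) • b := by
  simp only [wTransvection, Matrix.add_mulVec, Matrix.one_mulVec, Matrix.smul_mulVec,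
    Matrix.vecMulVec_mulVec, wPair_apply, Matrix.dotProduct_mulVec]
  ext i; simp [mul_comm, mul_left_comm]

theorem wTransvection_inv (t : F) (b : WIdx m → F) :
    (wTransvection t b)⁻¹ = wTransvection (-t) b := by
  apply inv_eq_of_mul_eq_one_right
  ext : 1
  exact (wTransvection t b).val_inv

theorem wTransvection_mem (t : F) (b : WIdx m → F) :
    wTransvection t b ∈ isometryGroup (RingHom.id F) m := by
  rw [mem_isometryGroup_iff_wPair]
  intro x y
  simp only [wTransvection_mulVec, map_add, map_smul, LinearMap.add_apply, LinearMap.smul_apply,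
    smul_eq_mul, wPair_self, wPair_comm x b]
  ring

/-- The form pairs each coordinate only with its partner `k.swap`. The explicit value of `c` is
recorded because its valuation is needed later. -/
theorem exists_wPair_eq {x : WIdx m → F} {k : WIdx m} (hk : x k ≠ 0) (s : F) :
    ∃ c : F, (c = s / x k ∨ c = -(s / x k)) ∧ wPair (Pi.single k.swap c) x = s := by
  rcases k with i | i
  · refine ⟨-(s / x (Sum.inl i)), Or.inr rfl, ?_⟩
    rw [wPair_eq_sum, Finset.sum_eq_single i]
    · simp; field_simp
    · intro j _ hj; simp [hj]
    · simp
  · refine ⟨(s / x (Sum.inr i)), Or.inl rfl, ?_⟩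
    rw [wPair_eq_sum, Finset.sum_eq_single i]
    · simp; field_simp
    · intro j _ hj; simp [hj]
    · simp

theorem exists_wPair_ne_zero {x : WIdx m → F} (hx : x ≠ 0) : ∃ c, wPair c x = 1 := by
  obtain ⟨k, hk⟩ := Function.ne_iff.mp hx
  obtain ⟨c, -, hc⟩ := exists_wPair_eq (x := x) hk 1
  exact ⟨_, hc⟩

/-- If `⟨x, y⟩ ≠ 0`, a transvection along `y - x` carries `x` to `y`. In general one passes through
a vector that pairs nontrivially with both `a` and `a'`. -/
theorem exists_isometry_mulVec_eq {a a' : WIdx m → F} (ha : a ≠ 0) (ha' : a' ≠ 0) :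
    ∃ g ∈ isometryGroup (RingHom.id F) m, g.1 *ᵥ a = a' := by
  have key : ∀ x y : WIdx m → F, wPair x y ≠ 0 →
      ∃ g ∈ isometryGroup (RingHom.id F) m, g.1 *ᵥ x = y := by
    intro x y h
    refine ⟨wTransvection (wPair y x)⁻¹ (y - x), wTransvection_mem _ _, ?_⟩
    have h1 : wPair (y - x) x = wPair y x := by simp [wPair_self]
    rw [wTransvection_mulVec, h1, inv_mul_cancel₀ (by rwa [wPair_comm, neg_ne_zero])]
    simp
  obtain ⟨c₁, h₁⟩ := exists_wPair_ne_zero ha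
  obtain ⟨c₂, h₂⟩ := exists_wPair_ne_zero ha'
  obtain ⟨c, hc, hc'⟩ : ∃ c, wPair c a ≠ 0 ∧ wPair c a' ≠ 0 := by
    by_cases h3 : wPair c₁ a' = 0
    · by_cases h4 : wPair c₂ a = 0
      · exact ⟨c₁ + c₂, by simp [h₁, h4], by simp [h₂, h3]⟩
      · exact ⟨c₂, h4, by simp [h₂]⟩
    · exact ⟨c₁, by simp [h₁], h3⟩
  obtain ⟨g, hg, hga⟩ := key a c (by rwa [wPair_comm, neg_ne_zero])
  obtain ⟨h, hh, hhc⟩ := key c a' hc'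
  refine ⟨h * g, mul_mem hh hg, ?_⟩
  rw [Units.val_mul, ← Matrix.mulVec_mulVec, hga, hhc]

end Symplectic

/-! ### Transvections close to the identity, and invariance of boxes under them. -/

section SmallTransvections

open ValuativeRel MeasureTheory Filter Topology

variable {F : Type*} [Field F] [ValuativeRel F] {m : ℕ}

theorem valuation_wPair_le {α β : ValueGroupWithZero F} {x y : WIdx m → F}
    (hx : x ∈ valBox F (WIdx m) α) (hy : y ∈ valBox F (WIdx m) β) :
    valuation F (wPair x y) ≤ α * β := by
  rw [wPair_eq_sum]
  refine (valuation F).map_sum_le fun i _ => ((valuation F).map_sub _ _).trans (max_le ?_ ?_) <;>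
    rw [map_mul] <;> exact mul_le_mul' (hx _) (hy _)

/-- The transvection with parameters `t`, `b` is congruent to the identity up to `ε`. -/
def IsSmallTransvection (ε : ValueGroupWithZero F) (t : F) (b : WIdx m → F) : Prop :=
  ∀ i j, valuation F (t * b i * b j) ≤ ε

theorem IsSmallTransvection.neg {ε : ValueGroupWithZero F} {t : F} {b : WIdx m → F}
    (h : IsSmallTransvection ε t b) : IsSmallTransvection ε (-t) b := fun i j => by
  simpa only [neg_mul, Valuation.map_neg] using h i j

theorem IsSmallTransvection.mulVec {ε δ : ValueGroupWithZero F} {t : F} {b : WIdx m → F}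
    (h : IsSmallTransvection ε t b) {M : Matrix (WIdx m) (WIdx m) F}
    (hM : ∀ i j, valuation F (M i j) ≤ δ) : IsSmallTransvection (δ * δ * ε) t (M *ᵥ b) := by
  intro i j
  have : t * (M *ᵥ b) i * (M *ᵥ b) j = ∑ k, ∑ l, (M i k * M j l) * (t * b k * b l) := by
    rw [mul_assoc, Matrix.mulVec, Matrix.mulVec, dotProduct, dotProduct, Finset.sum_mul_sum,
      Finset.mul_sum]
    refine Finset.sum_congr rfl fun k _ => ?_
    rw [Finset.mul_sum]
    exact Finset.sum_congr rfl fun l _ => by ring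
  rw [this]
  refine (valuation F).map_sum_le fun k _ => (valuation F).map_sum_le fun l _ => ?_
  rw [map_mul, map_mul]
  exact mul_le_mul' (mul_le_mul' (hM _ _) (hM _ _)) (h k l)

/-- Invariance of a function under all transvections congruent to the identity up to `ε`. -/
def IsSmallInvariant {α : Type*} (ε : ValueGroupWithZero F) (f : (WIdx m → F) → α) : Prop :=
  ∀ t b, IsSmallTransvection ε t b → ∀ y, f ((wTransvection t b).1 *ᵥ y) = f y

theorem IsSmallInvariant.mono {α : Type*} {ε ε' : ValueGroupWithZero F} {f : (WIdx m → F) → α}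
    (hf : IsSmallInvariant ε f) (h : ε' ≤ ε) : IsSmallInvariant ε' f :=
  fun t b htb => hf t b fun i j => (htb i j).trans h

theorem IsSmallInvariant.indicator {ε : ValueGroupWithZero F} {f : (WIdx m → F) → ℂ}
    {K : Set (WIdx m → F)} (hf : IsSmallInvariant ε f) (hK : IsSmallInvariant ε (· ∈ K)) :
    IsSmallInvariant ε (K.indicator f) := by
  classical
  intro t b h y
  have := hK t b h y
  simp only [eq_iff_iff] at this
  simp only [Set.indicator_apply, this, hf t b h y]

/-- Conjugation by `g` turns the transvection along `b` into the one along `g b`. Its size grows at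
most by `δ * δ`, hence stays at most one, and such transvections preserve every standard box. -/
theorem isSmallInvariant_preimage_valBox {ε δ : ValueGroupWithZero F}
    {g : GL (WIdx m) F} (hg : g ∈ isometryGroup (RingHom.id F) m)
    (hgδ : ∀ i j, valuation F (g.1 i j) ≤ δ) (hε : δ * δ * ε ≤ 1) (γ : ValueGroupWithZero F) :
    IsSmallInvariant ε (· ∈ (fun y => g.1 *ᵥ y) ⁻¹' (valBox F (WIdx m) γ : Set (WIdx m → F))) := by
  have key : ∀ t b, IsSmallTransvection ε t b → ∀ y, g.1 *ᵥ y ∈ valBox F (WIdx m) γ →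
      g.1 *ᵥ ((wTransvection t b).1 *ᵥ y) ∈ valBox F (WIdx m) γ := by
    intro t b h y hy
    rw [wTransvection_mulVec, Matrix.mulVec_add, Matrix.mulVec_smul]
    refine add_mem hy fun i => ?_
    rw [← mem_isometryGroup_iff_wPair.mp hg b y]
    have h1 := h.mulVec hgδ
    set b' := g.1 *ᵥ b
    set y' := g.1 *ᵥ y
    have h2 : (t * b' i) • b' ∈ valBox F (WIdx m) (δ * δ * ε) := fun j => h1 i j
    have h3 : ((t * wPair b' y') • b') i = wPair ((t * b' i) • b') y' := by
      simp; ring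
    rw [h3]
    calc _ ≤ (δ * δ * ε) * γ := valuation_wPair_le h2 hy
      _ ≤ 1 * γ := mul_le_mul_left hε γ
      _ = γ := one_mul γ
  intro t b h y
  refine propext ⟨fun hy => ?_, key t b h y⟩
  have h1 := key (-t) b h.neg _ hy
  have h2 : (wTransvection (-t) b).1 *ᵥ ((wTransvection t b).1 *ᵥ y) = y := by
    rw [Matrix.mulVec_mulVec, ← Units.val_mul, ← wTransvection_inv, inv_mul_cancel]; simp
  rw [h2] at h1
  exact h1

end SmallTransvections

/-! ### Additive characters: duality of boxes, orthogonality and exchange of integrals. -/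

section CharacterIntegrals

open ValuativeRel MeasureTheory Filter Topology

/-- There are no small subgroups: as long as the powers stay near one, each squaring multiplies the
distance to one by at least `3 / 2`. -/
theorem Complex.eq_one_of_forall_pow_near_one {z : ℂ} (h : ∀ n : ℕ, ‖z ^ n - 1‖ ≤ 1 / 2) :
    z = 1 := by
  by_contra hz
  have h0 : 0 < ‖z - 1‖ := norm_pos_iff.mpr (sub_ne_zero.mpr hz)
  have key : ∀ k : ℕ, (3 / 2 : ℝ) ^ k * ‖z - 1‖ ≤ ‖z ^ (2 ^ k) - 1‖ := by
    intro k
    induction k with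
    | zero => simp
    | succ k ih =>
      set w := z ^ (2 ^ k)
      have h1 : z ^ (2 ^ (k + 1)) - 1 = (w - 1) * (2 + (w - 1)) := by
        simp only [w, pow_succ, pow_mul]; ring
      have h2 : (3 / 2 : ℝ) ≤ ‖2 + (w - 1)‖ := by
        have := norm_sub_le_norm_add (2 : ℂ) (w - 1)
        have h3 := h (2 ^ k)
        simp only [Complex.norm_ofNat] at this
        linarith
      rw [h1, norm_mul, pow_succ]
      nlinarith [norm_nonneg (w - 1), pow_pos (show (0 : ℝ) < 3 / 2 by norm_num) k]
  obtain ⟨k, hk⟩ := pow_unbounded_of_one_lt (1 / ‖z - 1‖) (show (1 : ℝ) < 3 / 2 by norm_num)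
  have h1 := (key k).trans (h _)
  rw [div_lt_iff₀ h0] at hk
  linarith

variable {F : Type*} [Field F] [ValuativeRel F] {m : ℕ}

/-- A character is nontrivial on a box against any vector outside the dual box. -/
theorem exists_addChar_wPair_ne_one {ψ : AddChar F ℂ} {t₀ : F} (ht : ψ t₀ ≠ 1)
    {γ γ' : ValueGroupWithZero F} (h : valuation F t₀ ≤ γ * γ') {y : WIdx m → F}
    (hy : y ∉ valBox F (WIdx m) γ) : ∃ u ∈ valBox F (WIdx m) γ', ψ (wPair u y) ≠ 1 := by
  simp only [mem_valBox, not_forall, not_le] at hy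
  obtain ⟨k, hk⟩ := hy
  have hk0 : valuation F (y k) ≠ 0 := (lt_of_le_of_lt zero_le hk).ne'
  obtain ⟨c, hc, hcy⟩ := exists_wPair_eq (x := y) (k := k) (by simpa using hk0) t₀
  have hvc : valuation F c = valuation F t₀ / valuation F (y k) := by
    rcases hc with rfl | rfl <;> simp
  refine ⟨_, fun i => ?_, by rwa [hcy]⟩
  by_cases hi : i = k.swap
  · subst hi
    rw [Pi.single_eq_same, hvc, div_le_iff₀ (zero_lt_iff.mpr hk0), mul_comm]
    exact h.trans (mul_le_mul_left hk.le _)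
  · simp [hi]

variable [TopologicalSpace F] [IsNonarchimedeanLocalField F]

/-- A continuous additive character of a local field is trivial near zero. -/
theorem exists_addChar_eq_one {ψ : AddChar F ℂ} (hψ : Continuous ψ) :
    ∃ κ : ValueGroupWithZero F, κ ≠ 0 ∧ ∀ x, valuation F x ≤ κ → ψ x = 1 := by
  have h1 : ∀ᶠ x in 𝓝 (0 : F), ‖ψ x - 1‖ < 1 / 2 := by
    have : Continuous fun x => ‖ψ x - 1‖ := by fun_prop
    exact this.continuousAt.eventually_lt continuousAt_const (by simp)
  obtain ⟨γ, hγ, h2⟩ := (IsValuativeTopology.hasBasis_nhds_zero' F).mem_iff.mp h1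
  obtain ⟨κ, hκ, hκγ⟩ := exists_lt_of_finite (ι := Unit) (fun _ => γ) fun _ => hγ
  refine ⟨κ, hκ, fun x hx => Complex.eq_one_of_forall_pow_near_one fun n => ?_⟩
  have h3 : valuation F (n • x) < γ := by
    refine lt_of_le_of_lt ?_ (hκγ ())
    induction n with
    | zero => simp
    | succ n ih => rw [succ_nsmul]; exact ((valuation F).map_add _ _).trans (max_le ih hx)
  rw [← AddChar.map_nsmul_eq_pow]
  exact le_of_lt (h2 h3)

theorem Continuous.wPair {X : Type*} [TopologicalSpace X] {x y : X → WIdx m → F}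
    (hx : Continuous x) (hy : Continuous y) : Continuous fun p => wPair (x p) (y p) := by
  simp only [wPair_eq_sum]; fun_prop

variable [MeasurableSpace (WIdx m → F)] [BorelSpace (WIdx m → F)]

/-- Translation by `x₀` preserves the integral but multiplies the integrand by `χ x₀ ≠ 1`. -/
theorem integral_eq_zero_of_character (μ : Measure (WIdx m → F)) [μ.IsAddHaarMeasure]
    {A : AddSubgroup (WIdx m → F)} {χ : (WIdx m → F) → ℂ} {x₀ : WIdx m → F} (hx₀ : x₀ ∈ A)
    (hχ : ∀ x, χ (x + x₀) = χ x * χ x₀) (h1 : χ x₀ ≠ 1) :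
    ∫ y, (A : Set (WIdx m → F)).indicator χ y ∂μ = 0 := by
  classical
  have h2 : ∀ y, (A : Set (WIdx m → F)).indicator χ (y + x₀) =
      χ x₀ * (A : Set (WIdx m → F)).indicator χ y := by
    intro y
    simp only [Set.indicator_apply, SetLike.mem_coe, A.add_mem_cancel_right hx₀, hχ]
    split_ifs <;> ring
  have h3 := integral_add_right_eq_self (μ := μ) ((A : Set (WIdx m → F)).indicator χ) x₀
  simp only [h2] at h3
  rw [integral_const_mul] at h3
  have h4 : (χ x₀ - 1) * ∫ y, (A : Set (WIdx m → F)).indicator χ y ∂μ = 0 := by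
    linear_combination h3
  exact (mul_eq_zero.mp h4).resolve_left (sub_ne_zero.mpr h1)

/-- Since `A ×ˢ K` is clopen and compact, the truncated integrand is still continuous and has
compact support, so the exchange theorem for such functions applies. -/
theorem integral_integral_swap_indicator (μ : Measure (WIdx m → F)) [μ.IsAddHaarMeasure]
    {A K : Set (WIdx m → F)} (hA : IsClopen A) (hA' : IsCompact A) (hK : IsClopen K)
    (hK' : IsCompact K) {h : (WIdx m → F) → (WIdx m → F) → ℂ}
    (hh : Continuous fun p : (WIdx m → F) × (WIdx m → F) => h p.1 p.2) :
    ∫ a, A.indicator (fun a => ∫ y, K.indicator (h a) y ∂μ) a ∂μ =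
      ∫ y, K.indicator (fun y => ∫ a, A.indicator (fun a => h a y) a ∂μ) y ∂μ := by
  classical
  have h1 := integral_integral_swap_of_hasCompactSupport (μ := μ) (ν := μ)
    (f := fun a y => (A ×ˢ K).indicator (fun p : (WIdx m → F) × (WIdx m → F) => h p.1 p.2) (a, y))
    (by exact Continuous.indicator (by simp [(hA.prod hK).frontier_eq]) hh)
    (HasCompactSupport.intro (hA'.prod hK') fun p hp => by
      exact Set.indicator_of_notMem hp fun p : (WIdx m → F) × (WIdx m → F) => h p.1 p.2)
  refine Eq.trans ?_ (h1.trans ?_)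
  · refine integral_congr_ae (.of_forall fun a => ?_)
    by_cases ha : a ∈ A <;> simp [Set.indicator_apply, ha]
  · refine integral_congr_ae (.of_forall fun y => ?_)
    by_cases hy : y ∈ K <;> simp [Set.indicator_apply, hy]

end CharacterIntegrals

/-! ### The symplectic Fourier transform of truncated functions near a nonzero point. -/

section FourierTransform

set_option linter.unusedSectionVars false

open ValuativeRel MeasureTheory Filter Topology

variable {F : Type*} [Field F] [ValuativeRel F] [TopologicalSpace F] [IsNonarchimedeanLocalField F]
  {m : ℕ}

/-- Points near `a ≠ 0` are reached from `a` by two small transvections. -/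
theorem exists_smallTransvection_eq {a : WIdx m → F} (ha : a ≠ 0) {ε : ValueGroupWithZero F}
    (hε : ε ≠ 0) : ∃ γ : ValueGroupWithZero F, γ ≠ 0 ∧ ∀ u ∈ valBox F (WIdx m) γ,
      ∃ t b t' b', IsSmallTransvection ε t b ∧ IsSmallTransvection ε t' b' ∧
        a + u = (wTransvection t' b').1 *ᵥ ((wTransvection t b).1 *ᵥ a) := by
  obtain ⟨c, hca⟩ := exists_wPair_ne_zero ha
  obtain ⟨A₀, hA₀⟩ := exists_mem_valBox a
  obtain ⟨C₀, hC₀⟩ := exists_mem_valBox c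
  set A := max A₀ 1
  set C := max C₀ 1
  have hA : a ∈ valBox F (WIdx m) A := valBox_mono (le_max_left _ _) hA₀
  have hC : c ∈ valBox F (WIdx m) C := valBox_mono (le_max_left _ _) hC₀
  have hA1 : 1 ≤ A := le_max_right _ _
  have hC1 : 1 ≤ C := le_max_right _ _
  have hA0 : 0 < A := zero_lt_one.trans_le hA1
  have hC0 : 0 < C := zero_lt_one.trans_le hC1
  obtain ⟨s, hs⟩ := ValuativeRel.valuation_surjective (ε / (C * C))
  set S := valuation F s
  have hS0 : 0 < S := by
    rw [hs]; exact zero_lt_iff.mpr (div_ne_zero hε (mul_pos hC0 hC0).ne')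
  have hSC : S * (C * C) = ε := by rw [hs, div_mul_cancel₀ _ (mul_pos hC0 hC0).ne']
  -- These bounds make `-s` the dominant term of `⟨b, a + s c⟩`, so that this pairing has the
  -- valuation of `s`, and they keep `b` in the box of radius `S * C`. Hence the second
  -- transvection, with parameter the inverse of the pairing, is small too.
  obtain ⟨γ, hγ, hlt⟩ := exists_lt_of_finite (fun i : Bool => if i then S / A else min S C⁻¹) (by
    intro i
    cases i
    · simp only [Bool.false_eq_true, if_false]
      exact (lt_min hS0 (by simpa using hC0)).ne'
    · simpa using ⟨hS0.ne', hA0.ne'⟩)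
  have hγA : γ * A < S := by
    have := hlt true
    simpa [lt_div_iff₀ hA0] using this
  have hγS : γ < S := (hlt false).trans_le (by simp)
  have hγC : γ * C < 1 := by
    have := (hlt false).trans_le (b := min S C⁻¹) (c := C⁻¹) (min_le_right _ _)
    rwa [← one_div, lt_div_iff₀ hC0] at this
  refine ⟨γ, hγ, fun u hu => ?_⟩
  set b := u - s • c with hb
  set a' := a + s • c with ha'
  have hba : wPair b a' = -s + (wPair u a + s * wPair u c) := by
    simp [hb, ha', hca, wPair_self]
    ring
  have h1 : valuation F (wPair u a + s * wPair u c) < S := by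
    refine lt_of_le_of_lt ((valuation F).map_add _ _) (max_lt ?_ ?_)
    · exact (valuation_wPair_le hu hA).trans_lt hγA
    · rw [map_mul]
      calc _ ≤ S * (γ * C) := mul_le_mul_right (valuation_wPair_le hu hC) _
        _ < S * 1 := mul_lt_mul_of_pos_left hγC hS0
        _ = S := mul_one S
  have h2 : valuation F (wPair b a') = S := by
    rw [hba, Valuation.map_add_eq_of_lt_left] <;> rw [Valuation.map_neg]
    exact h1
  have h3 : wPair b a' ≠ 0 := fun h => by rw [h, map_zero] at h2; exact hS0.ne h2
  have hbb : b ∈ valBox F (WIdx m) (S * C) := by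
    refine sub_mem (fun i => (hu i).trans ?_) fun i => ?_
    · exact hγS.le.trans (le_mul_of_one_le_right' hC1)
    · rw [Pi.smul_apply, smul_eq_mul, map_mul]
      exact mul_le_mul_right (hC i) _
  refine ⟨s, c, (wPair b a')⁻¹, b, fun i j => ?_, fun i j => ?_, ?_⟩
  · rw [map_mul, map_mul, mul_assoc, ← hSC]
    exact mul_le_mul_right (mul_le_mul' (hC i) (hC j)) _
  · rw [map_mul, map_mul, map_inv₀, h2, mul_assoc, ← hSC]
    calc S⁻¹ * (valuation F (b i) * valuation F (b j)) ≤ S⁻¹ * ((S * C) * (S * C)) :=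
          mul_le_mul_right (mul_le_mul' (hbb i) (hbb j)) _
      _ = S * (C * C) := by field_simp
  · rw [wTransvection_mulVec, wTransvection_mulVec, hca, mul_one, ← ha', inv_mul_cancel₀ h3,
      one_smul, hb, ha']
    abel

theorem isClopen_valBox {γ : ValueGroupWithZero F} (hγ : γ ≠ 0) :
    IsClopen (valBox F (WIdx m) γ : Set (WIdx m → F)) :=
  ⟨AddSubgroup.isClosed_of_isOpen _ (isOpen_valBox hγ), isOpen_valBox hγ⟩

variable [MeasurableSpace (WIdx m → F)] [BorelSpace (WIdx m → F)]

/-- The Fourier transform with respect to the symplectic form. -/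
noncomputable def wFourier (ψ : AddChar F ℂ) (μ : Measure (WIdx m → F)) (f : (WIdx m → F) → ℂ)
    (a : WIdx m → F) : ℂ := ∫ y, ψ (-wPair a y) * f y ∂μ

/-- An isometry preserves both the pairing in the kernel and the Haar measure. -/
theorem wFourier_comp_isometry (ψ : AddChar F ℂ) (μ : Measure (WIdx m → F)) [μ.IsAddHaarMeasure]
    [μ.Regular] (f : (WIdx m → F) → ℂ) (a : WIdx m → F) {g : GL (WIdx m) F}
    (hg : g ∈ isometryGroup (RingHom.id F) m) :
    wFourier ψ μ f (g.1 *ᵥ a) = wFourier ψ μ (fun y => f (g.1 *ᵥ y)) a := by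
  rw [wFourier, ← integral_comp_mulVec_of_isometry μ hg]
  simp only [mem_isometryGroup_iff_wPair.mp hg]
  rfl

theorem IsSmallInvariant.wFourier_eq (ψ : AddChar F ℂ) (μ : Measure (WIdx m → F))
    [μ.IsAddHaarMeasure] [μ.Regular] {f : (WIdx m → F) → ℂ} {ε : ValueGroupWithZero F}
    (hf : IsSmallInvariant ε f) {t : F} {b : WIdx m → F} (h : IsSmallTransvection ε t b)
    (a : WIdx m → F) : wFourier ψ μ f ((wTransvection t b).1 *ᵥ a) = wFourier ψ μ f a := by
  rw [wFourier_comp_isometry ψ μ f a (wTransvection_mem t b)]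
  simp only [hf t b h]

/-- Away from zero, the Fourier transform of a function which is invariant under small
transvections is locally constant. -/
theorem exists_wFourier_add_eq (ψ : AddChar F ℂ) (μ : Measure (WIdx m → F))
    [μ.IsAddHaarMeasure] [μ.Regular] {a : WIdx m → F} (ha : a ≠ 0) {ε : ValueGroupWithZero F}
    (hε : ε ≠ 0) : ∃ γ : ValueGroupWithZero F, γ ≠ 0 ∧ ∀ f : (WIdx m → F) → ℂ,
      IsSmallInvariant ε f → ∀ u ∈ valBox F (WIdx m) γ,
        wFourier ψ μ f (a + u) = wFourier ψ μ f a := by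
  -- The radius depends only on `a` and `ε`, not on `f`. This uniformity allows the truncation of
  -- `f` to vary afterwards.
  obtain ⟨γ, hγ, h⟩ := exists_smallTransvection_eq ha hε
  refine ⟨γ, hγ, fun f hf u hu => ?_⟩
  obtain ⟨t, b, t', b', h1, h2, h3⟩ := h u hu
  rw [h3, hf.wFourier_eq ψ μ h2, hf.wFourier_eq ψ μ h1]

theorem wFourier_indicator (ψ : AddChar F ℂ) (μ : Measure (WIdx m → F)) (f : (WIdx m → F) → ℂ)
    (K : Set (WIdx m → F)) (a : WIdx m → F) : wFourier ψ μ (K.indicator f) a =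
      ∫ y, K.indicator (fun y => ψ (-wPair a y) * f y) y ∂μ := by
  classical
  refine integral_congr_ae (.of_forall fun y => ?_)
  by_cases hy : y ∈ K <;> simp [hy]

theorem integrable_indicator_addChar_mul {ψ : AddChar F ℂ} (hψ : Continuous ψ)
    (μ : Measure (WIdx m → F)) [μ.IsAddHaarMeasure] {f : (WIdx m → F) → ℂ} (hf : Continuous f)
    {K : Set (WIdx m → F)} (hK' : IsCompact K) (hK : IsClopen K) (a : WIdx m → F) :
    Integrable (K.indicator fun y => ψ (-wPair a y) * f y) μ := by
  rw [integrable_indicator_iff hK.isOpen.measurableSet]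
  refine ContinuousOn.integrableOn_compact' hK' hK.isOpen.measurableSet (Continuous.continuousOn ?_)
  have : Continuous fun y : WIdx m → F => wPair a y :=
    continuous_const.wPair continuous_id
  fun_prop

theorem wFourier_indicator_diff {ψ : AddChar F ℂ} (hψ : Continuous ψ)
    (μ : Measure (WIdx m → F)) [μ.IsAddHaarMeasure] {f : (WIdx m → F) → ℂ} (hf : Continuous f)
    {K L : Set (WIdx m → F)} (hK' : IsCompact K) (hK : IsClopen K) (hL' : IsCompact L)
    (hL : IsClopen L) (hLK : L ⊆ K) (a : WIdx m → F) :
    wFourier ψ μ ((K \ L).indicator f) a =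
      wFourier ψ μ (K.indicator f) a - wFourier ψ μ (L.indicator f) a := by
  simp only [wFourier_indicator]
  rw [← integral_sub (integrable_indicator_addChar_mul hψ μ hf hK' hK a)
    (integrable_indicator_addChar_mul hψ μ hf hL' hL a)]
  refine integral_congr_ae (.of_forall fun y => ?_)
  exact congrFun (Set.indicator_sdiff hLK _) y

theorem integral_indicator_valBox_one_ne_zero (μ : Measure (WIdx m → F)) [μ.IsAddHaarMeasure]
    {K : Set (WIdx m → F)} (hK : IsOpen K) (hK' : IsCompact K) (hne : K.Nonempty) :
    ∫ y, K.indicator (fun _ => (1 : ℂ)) y ∂μ ≠ 0 := by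
  rw [integral_indicator hK.measurableSet, setIntegral_const]
  have : μ.real K ≠ 0 := by
    rw [Measure.real, ENNReal.toReal_ne_zero]
    exact ⟨(hK.measure_pos μ hne).ne', hK'.measure_lt_top.ne⟩
  simpa using this

/-- The Fourier transform at `a` does not see functions supported far away from zero. -/
theorem wFourier_indicator_eq_zero {ψ : AddChar F ℂ} (hψ : Continuous ψ)
    (μ : Measure (WIdx m → F)) [μ.IsAddHaarMeasure] {f : (WIdx m → F) → ℂ} (hf : Continuous f)
    {t₀ : F} (ht₀ : ψ t₀ ≠ 1) {a : WIdx m → F} {γ Γ : ValueGroupWithZero F} (hγ : γ ≠ 0)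
    (hΓ : valuation F t₀ ≤ Γ * γ) {K : Set (WIdx m → F)} (hK' : IsCompact K) (hK : IsClopen K)
    (hKΓ : ∀ y ∈ K, y ∉ valBox F (WIdx m) Γ)
    (hu : ∀ u ∈ valBox F (WIdx m) γ,
      wFourier ψ μ (K.indicator f) (a + u) = wFourier ψ μ (K.indicator f) a) :
    wFourier ψ μ (K.indicator f) a = 0 := by
  classical
  have hc : Continuous fun p : (WIdx m → F) × (WIdx m → F) =>
      ψ (-wPair (a + p.1) p.2) * f p.2 := by
    have : Continuous fun p : (WIdx m → F) × (WIdx m → F) => wPair (a + p.1) p.2 :=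
      (continuous_const.add continuous_fst).wPair continuous_snd
    fun_prop
  -- Average the transform over the box around `a`. By hypothesis the average is the volume of the
  -- box times the value at `a`. After the exchange, each inner integral is that of a nontrivial
  -- character of the box, because `y` lies outside the dual box, so it vanishes.
  have h1 := integral_integral_swap_indicator μ (isClopen_valBox hγ) (isCompact_valBox γ) hK hK'
    (h := fun u y => ψ (-wPair (a + u) y) * f y) hc
  have h2 : ∀ y ∈ K, ∫ u, (valBox F (WIdx m) γ : Set (WIdx m → F)).indicator
      (fun u => ψ (-wPair (a + u) y) * f y) u ∂μ = 0 := by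
    intro y hy
    obtain ⟨u, hu, hne⟩ := exists_addChar_wPair_ne_one ht₀ hΓ (hKΓ y hy)
    have h3 := integral_eq_zero_of_character μ (A := valBox F (WIdx m) γ)
      (χ := fun u => ψ (wPair (-u) y)) (x₀ := -u) (neg_mem hu)
      (fun x => by rw [← AddChar.map_add_eq_mul, ← LinearMap.add_apply, ← map_add]; congr 3; abel)
      (by simpa using hne)
    rw [← mul_zero (ψ (-wPair a y) * f y), ← h3, ← integral_const_mul]
    refine integral_congr_ae (.of_forall fun u => ?_)
    by_cases hu : u ∈ valBox F (WIdx m) γ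
    · simp only [hu, SetLike.mem_coe, Set.indicator_of_mem, map_add, LinearMap.add_apply, neg_add,
        AddChar.map_add_eq_mul, map_neg, LinearMap.neg_apply]
      ring
    · simp [hu]
  have h4 : ∀ y, K.indicator (fun y => ∫ u, (valBox F (WIdx m) γ : Set (WIdx m → F)).indicator
      (fun u => ψ (-wPair (a + u) y) * f y) u ∂μ) y = 0 := by
    intro y
    by_cases hy : y ∈ K
    · rw [Set.indicator_of_mem hy, h2 y hy]
    · rw [Set.indicator_of_notMem hy]
  simp only [h4, integral_zero] at h1
  have h5 : ∀ u, (valBox F (WIdx m) γ : Set (WIdx m → F)).indicator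
      (fun u => ∫ y, K.indicator (fun y => ψ (-wPair (a + u) y) * f y) y ∂μ) u =
      (valBox F (WIdx m) γ : Set (WIdx m → F)).indicator (fun _ => (1 : ℂ)) u *
        wFourier ψ μ (K.indicator f) a := by
    intro u
    by_cases h : u ∈ valBox F (WIdx m) γ
    · rw [Set.indicator_of_mem h, Set.indicator_of_mem h, one_mul, ← hu u h, wFourier_indicator]
    · simp [h]
  simp only [h5] at h1
  rw [integral_mul_const] at h1
  exact (mul_eq_zero.mp h1).resolve_left (integral_indicator_valBox_one_ne_zero μ
    (isClopen_valBox hγ).isOpen (isCompact_valBox γ) ⟨0, zero_mem _⟩)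

end FourierTransform

/-! ### The regularized Fourier transform and Fourier inversion. -/

section FourierSupport

set_option linter.unusedSectionVars false

open ValuativeRel MeasureTheory Filter Topology

variable {F : Type*} [Field F] [ValuativeRel F] [TopologicalSpace F] [IsNonarchimedeanLocalField F]
  {m : ℕ}

theorem isSmallInvariant_valBox {ε : ValueGroupWithZero F} (hε : ε ≤ 1)
    (γ : ValueGroupWithZero F) :
    IsSmallInvariant ε (· ∈ (valBox F (WIdx m) γ : Set (WIdx m → F))) := by
  have := isSmallInvariant_preimage_valBox (one_mem (isometryGroup (RingHom.id F) m)) (δ := 1)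
    (ε := ε) (fun i j => by by_cases h : i = j <;> simp [h]) (by simpa using hε) γ
  simpa using this

theorem IsSmallInvariant.sdiff {ε : ValueGroupWithZero F} {K L : Set (WIdx m → F)}
    (hK : IsSmallInvariant ε (· ∈ K)) (hL : IsSmallInvariant ε (· ∈ L)) :
    IsSmallInvariant ε (· ∈ K \ L) := fun t b h y => by
  have h1 := hK t b h y
  have h2 := hL t b h y
  simp only [eq_iff_iff] at h1 h2
  simp [h1, h2]

theorem isClopen_preimage_valBox (g : GL (WIdx m) F) {γ : ValueGroupWithZero F} (hγ : γ ≠ 0) :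
    IsClopen ((fun y => g.1 *ᵥ y) ⁻¹' (valBox F (WIdx m) γ : Set (WIdx m → F))) :=
  (isClopen_valBox hγ).preimage (glEquiv g).continuous

theorem isCompact_preimage_valBox (g : GL (WIdx m) F) (γ : ValueGroupWithZero F) :
    IsCompact ((fun y => g.1 *ᵥ y) ⁻¹' (valBox F (WIdx m) γ : Set (WIdx m → F))) :=
  ((glEquiv g).toHomeomorph.isCompact_preimage).mpr (isCompact_valBox γ)

variable [MeasurableSpace (WIdx m → F)] [BorelSpace (WIdx m → F)]

theorem exists_matrix_entry_le (M : Matrix (WIdx m) (WIdx m) F) :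
    ∃ δ : ValueGroupWithZero F, δ ≠ 0 ∧ ∀ i j, valuation F (M i j) ≤ δ := by
  obtain ⟨δ, hδ⟩ := exists_mem_valBox fun p : WIdx m × WIdx m => M p.1 p.2
  exact ⟨max δ 1, (zero_lt_one.trans_le (le_max_right _ _)).ne', fun i j =>
    (hδ (i, j)).trans (le_max_left _ _)⟩

/-- The difference of the two truncations is `f` cut off to a set lying outside the box of radius
`Γ'`. That function is invariant under small transvections, so its transform at `a` vanishes by
`wFourier_indicator_eq_zero`. -/
theorem exists_wFourier_preimage_eq {ψ : AddChar F ℂ} (hψ : Continuous ψ)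
    {t₀ : F} (ht₀ : ψ t₀ ≠ 1)
    (μ : Measure (WIdx m → F)) [μ.IsAddHaarMeasure] [μ.Regular] {f : (WIdx m → F) → ℂ}
    (hf : Continuous f) {ε : ValueGroupWithZero F} (hε : ε ≠ 0) (hfε : IsSmallInvariant ε f)
    {a : WIdx m → F} (ha : a ≠ 0) {g : GL (WIdx m) F}
    (hg : g ∈ isometryGroup (RingHom.id F) m) :
    ∃ Γ : ValueGroupWithZero F, Γ ≠ 0 ∧ ∀ Γ' ≥ Γ, ∀ γ ≠ 0,
      (valBox F (WIdx m) Γ' : Set (WIdx m → F)) ⊆ (fun y => g.1 *ᵥ y) ⁻¹' valBox F (WIdx m) γ →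
      wFourier ψ μ (((fun y => g.1 *ᵥ y) ⁻¹' (valBox F (WIdx m) γ : Set (WIdx m → F))).indicator f) a
        = wFourier ψ μ ((valBox F (WIdx m) Γ' : Set (WIdx m → F)).indicator f) a := by
  obtain ⟨δ, hδ, hgδ⟩ := exists_matrix_entry_le g.1
  -- At this level `f`, the standard boxes and their preimages under `g` are all invariant, whatever
  -- the radii of the boxes.
  set ε' := min (min ε 1) (δ * δ)⁻¹
  have hε'0 : ε' ≠ 0 := by
    refine (lt_min (lt_min (zero_lt_iff.mpr hε) zero_lt_one) (zero_lt_iff.mpr ?_)).ne'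
    simpa using hδ
  have hε'ε : ε' ≤ ε := (min_le_left _ _).trans (min_le_left _ _)
  have hε'1 : ε' ≤ 1 := (min_le_left _ _).trans (min_le_right _ _)
  have hε'δ : δ * δ * ε' ≤ 1 := by
    calc δ * δ * ε' ≤ δ * δ * (δ * δ)⁻¹ := mul_le_mul_right (min_le_right _ _) _
      _ = 1 := mul_inv_cancel₀ (mul_ne_zero hδ hδ)
  obtain ⟨γ₀, hγ₀, hloc⟩ := exists_wFourier_add_eq ψ μ ha hε'0
  have ht0 : valuation F t₀ ≠ 0 := by
    rw [Valuation.ne_zero_iff]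
    rintro rfl
    simp at ht₀
  -- This radius is dual to `γ₀`: outside it, `y` pairs with the box of radius `γ₀` to give a
  -- nontrivial character.
  refine ⟨valuation F t₀ / γ₀, div_ne_zero ht0 hγ₀, fun Γ' hΓ' γ hγ hsub => ?_⟩
  have hΓ'0 : Γ' ≠ 0 := ((zero_lt_iff.mpr (div_ne_zero ht0 hγ₀)).trans_le hΓ').ne'
  rw [← sub_eq_zero, ← wFourier_indicator_diff hψ μ hf (isCompact_preimage_valBox g γ)
    (isClopen_preimage_valBox g hγ) (isCompact_valBox Γ') (isClopen_valBox hΓ'0) hsub]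
  refine wFourier_indicator_eq_zero hψ μ hf ht₀ hγ₀ (Γ := Γ') ?_
    ((isCompact_preimage_valBox g γ).diff (isClopen_valBox hΓ'0).isOpen)
    ((isClopen_preimage_valBox g hγ).diff (isClopen_valBox hΓ'0)) (fun y hy => hy.2) ?_
  · rw [ge_iff_le, div_le_iff₀ (zero_lt_iff.mpr hγ₀)] at hΓ'
    exact hΓ'
  · exact hloc _ ((hfε.mono hε'ε).indicator ((isSmallInvariant_preimage_valBox hg hgδ hε'δ γ).sdiff
      (isSmallInvariant_valBox hε'1 Γ')))

/-- The Fourier transform of `f` at `a ≠ 0`, regularized by cutting off `f` by large boxes; it does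
not depend on the symplectic basis used to define the boxes. -/
theorem exists_eventually_wFourier_eq {ψ : AddChar F ℂ} (hψ : Continuous ψ) (hψ1 : ψ ≠ 1)
    (μ : Measure (WIdx m → F)) [μ.IsAddHaarMeasure] [μ.Regular] {f : (WIdx m → F) → ℂ}
    (hf : Continuous f) {ε : ValueGroupWithZero F} (hε : ε ≠ 0) (hfε : IsSmallInvariant ε f)
    {a : WIdx m → F} (ha : a ≠ 0) : ∃ c : ℂ, ∀ g ∈ isometryGroup (RingHom.id F) m,
      ∀ᶠ γ in atTop, wFourier ψ μ
        (((fun y => g.1 *ᵥ y) ⁻¹' (valBox F (WIdx m) γ : Set (WIdx m → F))).indicator f) a = c := by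
  obtain ⟨t₀, ht₀⟩ := AddChar.ne_one_iff.mp hψ1
  obtain ⟨Γ₁, hΓ₁, h₁⟩ := exists_wFourier_preimage_eq hψ ht₀ μ hf hε hfε ha
    (one_mem (isometryGroup (RingHom.id F) m))
  refine ⟨wFourier ψ μ ((valBox F (WIdx m) Γ₁ : Set (WIdx m → F)).indicator f) a, fun g hg => ?_⟩
  obtain ⟨Γ₂, hΓ₂, h₂⟩ := exists_wFourier_preimage_eq hψ ht₀ μ hf hε hfε ha hg
  obtain ⟨δ, hδ, hgδ⟩ := exists_matrix_entry_le g.1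
  set Γ := max Γ₁ Γ₂
  have hΓ0 : Γ ≠ 0 := ((zero_lt_iff.mpr hΓ₁).trans_le (le_max_left _ _)).ne'
  have h3 := h₁ Γ₁ le_rfl Γ hΓ0 (by simpa using valBox_mono (le_max_left Γ₁ Γ₂))
  simp only [Units.val_one, Matrix.one_mulVec, Set.preimage_id'] at h3
  -- The entries of `g` are bounded by `δ`, so from here on the preimage of the box contains the
  -- standard box of radius `Γ`, where both comparisons apply.
  filter_upwards [eventually_ge_atTop (δ * Γ)] with γ hγ
  have hγ0 : γ ≠ 0 := ((zero_lt_iff.mpr (mul_ne_zero hδ hΓ0)).trans_le hγ).ne'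
  rw [h₂ Γ (le_max_right _ _) γ hγ0 ?_, h3]
  intro y hy i
  exact (valuation_dotProduct_le (x := fun j => g.1 i j) (fun j => hgδ i j) hy).trans hγ

/-- Fourier inversion for a locally constant function cut off by a box. -/
theorem integral_wFourier_indicator {ψ : AddChar F ℂ} (hψ : Continuous ψ)
    (μ : Measure (WIdx m → F)) [μ.IsAddHaarMeasure] {f : (WIdx m → F) → ℂ} (hf : Continuous f)
    {γ₁ γ D : ValueGroupWithZero F} (hγ : γ ≠ 0) (hD : D ≠ 0) (hγ₁ : γ₁ ≤ γ)
    (hf₁ : ∀ y, ∀ y' ∈ valBox F (WIdx m) γ₁, f (y + y') = f y)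
    {P : AddSubgroup (WIdx m → F)}
    (hP : ∀ y, y ∈ P ↔ ∀ a ∈ valBox F (WIdx m) D, ψ (wPair a y) = 1)
    (hPγ : P ≤ valBox F (WIdx m) γ₁) {x : WIdx m → F} (hx : x ∈ valBox F (WIdx m) γ) :
    ∫ a, (valBox F (WIdx m) D : Set (WIdx m → F)).indicator (fun a => ψ (wPair a x) *
        wFourier ψ μ ((valBox F (WIdx m) γ : Set (WIdx m → F)).indicator f) a) a ∂μ =
      f x * ((∫ a, (valBox F (WIdx m) D : Set (WIdx m → F)).indicator (fun _ => (1 : ℂ)) a ∂μ) *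
        ∫ y, (P : Set (WIdx m → F)).indicator (fun _ => (1 : ℂ)) y ∂μ) := by
  set B := (valBox F (WIdx m) D : Set (WIdx m → F))
  set K := (valBox F (WIdx m) γ : Set (WIdx m → F))
  have hc : Continuous fun p : (WIdx m → F) × (WIdx m → F) =>
      ψ (wPair p.1 (x - p.2)) * f p.2 := by
    have : Continuous fun p : (WIdx m → F) × (WIdx m → F) => wPair p.1 (x - p.2) :=
      continuous_fst.wPair (continuous_const.sub continuous_snd)
    fun_prop
  -- After the exchange, orthogonality of characters on the box of radius `D` leaves only those `y`
  -- with `x - y ∈ P`. For these `y` lies inside the truncation and `f y = f x`.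
  have h1 := integral_integral_swap_indicator μ (isClopen_valBox hD) (isCompact_valBox D)
    (isClopen_valBox hγ) (isCompact_valBox γ)
    (h := fun a y => ψ (wPair a (x - y)) * f y) hc
  have h2 : ∀ a, ψ (wPair a x) * wFourier ψ μ (K.indicator f) a =
      ∫ y, K.indicator (fun y => ψ (wPair a (x - y)) * f y) y ∂μ := by
    intro a
    rw [wFourier_indicator, ← integral_const_mul]
    refine integral_congr_ae (.of_forall fun y => ?_)
    by_cases hy : y ∈ K
    · simp only [hy, Set.indicator_of_mem, map_sub, sub_eq_add_neg (wPair a x),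
        AddChar.map_add_eq_mul]
      ring
    · simp [hy]
  simp only [h2]
  have hPx : ∀ y, y + -x ∈ P ↔ x - y ∈ P := fun y => by
    rw [← neg_mem_iff, neg_add, neg_neg, add_comm, ← sub_eq_add_neg]
  rw [h1, ← integral_add_right_eq_self (μ := μ)
    ((P : Set (WIdx m → F)).indicator fun _ => (1 : ℂ)) (-x), ← integral_const_mul, ← integral_const_mul]
  refine integral_congr_ae (.of_forall fun y => ?_)
  simp only []
  by_cases hy : x - y ∈ P
  · have hy1 := hPγ hy
    have hyK : y ∈ K := by
      have := sub_mem hx (valBox_mono hγ₁ hy1)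
      rwa [sub_sub_cancel] at this
    have hfy : f y = f x := by rw [← hf₁ y _ hy1]; simp
    rw [Set.indicator_of_mem hyK, Set.indicator_of_mem (by exact (hPx y).mpr hy), mul_one,
      ← integral_const_mul]
    refine integral_congr_ae (.of_forall fun a => ?_)
    by_cases ha : a ∈ valBox F (WIdx m) D
    · simp only [B, SetLike.mem_coe, ha, Set.indicator_of_mem, (hP _).mp hy a ha, hfy]
      ring
    · simp [B, ha]
  · rw [Set.indicator_of_notMem (s := (P : Set (WIdx m → F)))
      (by exact fun h => hy ((hPx y).mp h)), mul_zero, mul_zero]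
    by_cases hyK : y ∈ K
    · rw [Set.indicator_of_mem hyK]
      obtain ⟨u, hu, hne⟩ : ∃ u ∈ valBox F (WIdx m) D, ψ (wPair u (x - y)) ≠ 1 := by
        by_contra! h
        exact hy ((hP _).mpr h)
      have h3 := integral_eq_zero_of_character μ (A := valBox F (WIdx m) D)
        (χ := fun u => ψ (wPair u (x - y))) (x₀ := u) hu
        (fun x => by rw [← AddChar.map_add_eq_mul, ← LinearMap.add_apply, ← map_add]) hne
      rw [← mul_zero (f y), ← h3, ← integral_const_mul]
      refine integral_congr_ae (.of_forall fun a => ?_)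
      by_cases ha : a ∈ B
      · simp [B, ha, mul_comm]
      · simp [B, ha]
    · rw [Set.indicator_of_notMem hyK]

/-- A locally constant function, invariant under small transvections, whose regularized Fourier
transform vanishes away from zero is constant. -/
theorem eq_zero_value_of_eventually_wFourier_eq_zero {ψ : AddChar F ℂ} (hψ : Continuous ψ)
    (hψ1 : ψ ≠ 1) (μ : Measure (WIdx m → F)) [μ.IsAddHaarMeasure] [μ.Regular]
    {f : (WIdx m → F) → ℂ} (hf : Continuous f) {γ₁ : ValueGroupWithZero F} (hγ₁ : γ₁ ≠ 0)
    (hf₁ : ∀ y, ∀ y' ∈ valBox F (WIdx m) γ₁, f (y + y') = f y)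
    {ε : ValueGroupWithZero F} (hε : ε ≠ 0) (hfε : IsSmallInvariant ε f)
    (h0 : ∀ a ≠ 0, ∀ᶠ γ in atTop,
      wFourier ψ μ ((valBox F (WIdx m) γ : Set (WIdx m → F)).indicator f) a = 0)
    (x : WIdx m → F) : f x = f 0 := by
  obtain ⟨t₀, ht₀⟩ := AddChar.ne_one_iff.mp hψ1
  have ht0 : valuation F t₀ ≠ 0 := by
    rw [Valuation.ne_zero_iff]
    rintro rfl
    simp at ht₀
  obtain ⟨κ, hκ, hψκ⟩ := exists_addChar_eq_one hψ
  -- With this radius the annihilator `P` of the frequency box is contained in the box of radius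
  -- `γ₁`, under whose translations `f` is invariant.
  set D := valuation F t₀ / γ₁
  have hD : D ≠ 0 := div_ne_zero ht0 hγ₁
  let P : AddSubgroup (WIdx m → F) :=
    { carrier := {y | ∀ a ∈ valBox F (WIdx m) D, ψ (wPair a y) = 1}
      zero_mem' := fun a _ => by simp
      add_mem' := fun hx hy a ha => by
        rw [map_add, AddChar.map_add_eq_mul, hx a ha, hy a ha, one_mul]
      neg_mem' := fun {y} hy a ha => by
        have := hy (-a) (neg_mem ha)
        rwa [map_neg, LinearMap.neg_apply, ← map_neg] at this }
  have hP : ∀ y, y ∈ P ↔ ∀ a ∈ valBox F (WIdx m) D, ψ (wPair a y) = 1 := fun y => Iff.rfl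
  have hPγ : P ≤ valBox F (WIdx m) γ₁ := by
    intro y hy
    by_contra h
    obtain ⟨u, hu, hne⟩ := exists_addChar_wPair_ne_one ht₀ (γ' := D)
      (by rw [mul_div_cancel₀ _ hγ₁]) h
    exact hne (hy u hu)
  have hPo : IsOpen (P : Set (WIdx m → F)) := by
    refine AddSubgroup.isOpen_mono (H₁ := valBox F (WIdx m) (κ / D)) (fun y hy a ha => ?_)
      (isOpen_valBox (div_ne_zero hκ hD))
    refine hψκ _ ((valuation_wPair_le ha hy).trans ?_)
    rw [mul_div_cancel₀ _ hD]
  have hPc : IsCompact (P : Set (WIdx m → F)) :=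
    (isCompact_valBox γ₁).of_isClosed_subset (AddSubgroup.isClosed_of_isOpen _ hPo) hPγ
  obtain ⟨α₀, hα₀⟩ := exists_mem_valBox x
  set α := max α₀ 1
  have hα : α ≠ 0 := (zero_lt_one.trans_le (le_max_right _ _)).ne'
  have hxα : x ∈ valBox F (WIdx m) α := valBox_mono (le_max_left _ _) hα₀
  -- For frequencies `a` in the box of this radius, `ψ ⟨a, x⟩ = 1`.
  set γ₂ := κ / α
  have hγ₂ : γ₂ ≠ 0 := div_ne_zero hκ hα
  -- Compactness of the frequencies away from zero, with local constancy uniform in the truncation,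
  -- gives one truncation level beyond which all their coefficients vanish.
  have hcov : ∃ Γ : ValueGroupWithZero F, ∀ a ∈ (valBox F (WIdx m) D : Set (WIdx m → F)) \
      valBox F (WIdx m) γ₂, ∀ γ ≥ Γ,
        wFourier ψ μ ((valBox F (WIdx m) γ : Set (WIdx m → F)).indicator f) a = 0 := by
    refine ((isCompact_valBox D).diff (isOpen_valBox hγ₂)).induction_on
      (p := fun s : Set (WIdx m → F) => ∃ Γ : ValueGroupWithZero F, ∀ a ∈ s, ∀ γ ≥ Γ,
        wFourier ψ μ ((valBox F (WIdx m) γ : Set (WIdx m → F)).indicator f) a = 0)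
      ⟨1, by simp⟩ ?_ ?_ ?_
    · rintro s t hst ⟨Γ, h⟩
      exact ⟨Γ, fun a ha => h a (hst ha)⟩
    · rintro s t ⟨Γ, h⟩ ⟨Γ', h'⟩
      refine ⟨max Γ Γ', ?_⟩
      rintro a (ha | ha) γ hγ
      · exact h a ha γ ((le_max_left _ _).trans hγ)
      · exact h' a ha γ ((le_max_right _ _).trans hγ)
    · intro a ha
      have ha0 : a ≠ 0 := by
        rintro rfl
        exact ha.2 (zero_mem _)
      obtain ⟨γ₃, hγ₃, hloc⟩ := exists_wFourier_add_eq ψ μ ha0 (ε := min ε 1)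
        (lt_min (zero_lt_iff.mpr hε) zero_lt_one).ne'
      obtain ⟨Γ, hΓ⟩ := eventually_atTop.mp (h0 a ha0)
      have hnhds : (fun b => b - a) ⁻¹' (valBox F (WIdx m) γ₃ : Set (WIdx m → F)) ∈ 𝓝 a :=
        (continuous_id.sub continuous_const).continuousAt.preimage_mem_nhds (by
          simpa using (isOpen_valBox hγ₃).mem_nhds (zero_mem (valBox F (WIdx m) γ₃)))
      refine ⟨_, mem_nhdsWithin_of_mem_nhds hnhds, Γ, fun b hb γ hγ => ?_⟩
      rw [← add_sub_cancel a b, hloc _ ((hfε.mono (min_le_left _ _)).indicator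
        (isSmallInvariant_valBox (min_le_right _ _) γ)) _ hb, hΓ γ hγ]
  obtain ⟨Γ, hΓ⟩ := hcov
  set γ := max (max Γ α) γ₁
  have hγ : γ ≠ 0 := ((zero_lt_iff.mpr hγ₁).trans_le (le_max_right _ _)).ne'
  have e1 := integral_wFourier_indicator hψ μ hf hγ hD (le_max_right _ _) hf₁ hP hPγ
    (valBox_mono ((le_max_right _ _).trans (le_max_left _ _)) hxα)
  have e2 := integral_wFourier_indicator hψ μ hf hγ hD (le_max_right _ _) hf₁ hP hPγ
    (zero_mem (valBox F (WIdx m) γ))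
  have hvol : (∫ a, (valBox F (WIdx m) D : Set (WIdx m → F)).indicator (fun _ => (1 : ℂ)) a ∂μ) *
        ∫ y, (P : Set (WIdx m → F)).indicator (fun _ => (1 : ℂ)) y ∂μ ≠ 0 :=
    mul_ne_zero (integral_indicator_valBox_one_ne_zero μ (isOpen_valBox hD) (isCompact_valBox D)
      ⟨0, zero_mem _⟩) (integral_indicator_valBox_one_ne_zero μ hPo hPc ⟨0, zero_mem P⟩)
  -- Compare inversion at `x` and at `0`. The integrands agree: near frequency zero the character is
  -- one, and elsewhere the transform vanishes.
  apply mul_right_cancel₀ hvol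
  rw [← e1, ← e2]
  refine integral_congr_ae (.of_forall fun a => ?_)
  by_cases ha : a ∈ valBox F (WIdx m) D
  · rw [Set.indicator_of_mem ha, Set.indicator_of_mem ha]
    by_cases ha' : a ∈ valBox F (WIdx m) γ₂
    · rw [hψκ (wPair a x) ((valuation_wPair_le ha' hxα).trans (by rw [div_mul_cancel₀ _ hα]))]
      simp
    · rw [hΓ a ⟨ha, ha'⟩ γ ((le_max_left _ _).trans (le_max_left _ _))]
      simp
  · rw [Set.indicator_of_notMem ha, Set.indicator_of_notMem ha]

end FourierSupport

/-! ### Equivariance of Fourier coefficients under translations and isometries. -/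

section EquivariantForm

set_option linter.unusedSectionVars false

open ValuativeRel MeasureTheory Filter Topology

variable {F : Type*} [Field F] [ValuativeRel F] [TopologicalSpace F] [IsNonarchimedeanLocalField F]
  {m : ℕ}

theorem continuous_of_add_valBox {γ : ValueGroupWithZero F} (hγ : γ ≠ 0) {f : (WIdx m → F) → ℂ}
    (hf : ∀ y, ∀ y' ∈ valBox F (WIdx m) γ, f (y + y') = f y) : Continuous f := by
  refine continuous_iff_continuousAt.mpr fun x => ?_
  refine (continuousAt_const (y := f x)).congr ?_
  have : (fun b => b - x) ⁻¹' (valBox F (WIdx m) γ : Set (WIdx m → F)) ∈ 𝓝 x :=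
    (continuous_id.sub continuous_const).continuousAt.preimage_mem_nhds (by
      simpa using (isOpen_valBox hγ).mem_nhds (zero_mem (valBox F (WIdx m) γ)))
  filter_upwards [this] with b hb
  rw [← hf x (b - x) hb, add_sub_cancel]

variable [MeasurableSpace (WIdx m → F)] [BorelSpace (WIdx m → F)]

/-- A change of variables moves the isometry from the function onto the truncating set. This is why
the regularization must be insensitive to replacing boxes by their symplectic images. -/
theorem wFourier_indicator_comp_isometry (ψ : AddChar F ℂ) (μ : Measure (WIdx m → F))
    [μ.IsAddHaarMeasure] [μ.Regular] {f f' : (WIdx m → F) → ℂ} (a : WIdx m → F)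
    {g : GL (WIdx m) F} (hg : g ∈ isometryGroup (RingHom.id F) m)
    (hf : ∀ y, f' y = f (g.1 *ᵥ y)) (B : Set (WIdx m → F)) :
    wFourier ψ μ (B.indicator f') a =
      wFourier ψ μ (((fun y => (g⁻¹).1 *ᵥ y) ⁻¹' B).indicator f) (g.1 *ᵥ a) := by
  classical
  rw [wFourier_comp_isometry ψ μ _ a hg]
  congr 1
  ext y
  have h : (g⁻¹).1 *ᵥ (g.1 *ᵥ y) = y := by
    rw [Matrix.mulVec_mulVec, ← Units.val_mul, inv_mul_cancel]; simp
  simp only [Set.indicator_apply, Set.mem_preimage, h, hf]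

theorem wFourier_indicator_add (ψ : AddChar F ℂ) (μ : Measure (WIdx m → F))
    [μ.IsAddHaarMeasure] {f f' : (WIdx m → F) → ℂ} (a : WIdx m → F)
    {B : AddSubgroup (WIdx m → F)} {x : WIdx m → F} (hx : x ∈ B) (hf : ∀ y, f' y = f (y + x)) :
    wFourier ψ μ ((B : Set (WIdx m → F)).indicator f') a =
      ψ (wPair a x) * wFourier ψ μ ((B : Set (WIdx m → F)).indicator f) a := by
  classical
  rw [wFourier, wFourier]
  conv_rhs => rw [← integral_add_right_eq_self (μ := μ) _ x, ← integral_const_mul]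
  refine integral_congr_ae (.of_forall fun y => ?_)
  simp only [Set.indicator_apply, SetLike.mem_coe, B.add_mem_cancel_right hx, hf]
  split_ifs
  · have : ψ (-wPair a y) = ψ (wPair a x) * ψ (-wPair a (y + x)) := by
      rw [← AddChar.map_add_eq_mul, (wPair a).map_add]; congr 1; ring
    rw [this, mul_assoc]
  · simp

theorem wFourier_indicator_add_fun {ψ : AddChar F ℂ} (hψ : Continuous ψ)
    (μ : Measure (WIdx m → F)) [μ.IsAddHaarMeasure] {f f' : (WIdx m → F) → ℂ} (hf : Continuous f)
    (hf' : Continuous f') {K : Set (WIdx m → F)} (hK' : IsCompact K) (hK : IsClopen K)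
    (a : WIdx m → F) : wFourier ψ μ (K.indicator (f + f')) a =
      wFourier ψ μ (K.indicator f) a + wFourier ψ μ (K.indicator f') a := by
  simp only [wFourier_indicator]
  rw [← integral_add (integrable_indicator_addChar_mul hψ μ hf hK' hK a)
    (integrable_indicator_addChar_mul hψ μ hf' hK' hK a)]
  refine integral_congr_ae (.of_forall fun y => ?_)
  by_cases hy : y ∈ K <;> simp [hy, mul_add]

theorem wFourier_indicator_smul (ψ : AddChar F ℂ)
    (μ : Measure (WIdx m → F)) (c : ℂ) (f : (WIdx m → F) → ℂ) (K : Set (WIdx m → F))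
    (a : WIdx m → F) : wFourier ψ μ (K.indicator (c • f)) a =
      c * wFourier ψ μ (K.indicator f) a := by
  simp only [wFourier_indicator]
  rw [← integral_const_mul]
  refine integral_congr_ae (.of_forall fun y => ?_)
  by_cases hy : y ∈ K <;> simp [hy, mul_left_comm]

end EquivariantForm

/-! ### The dichotomy: constant functions or an equivariant form. -/

section EquivariantForm

open ValuativeRel MeasureTheory Filter Topology

variable {F : Type*} [Field F] [ValuativeRel F] [TopologicalSpace F] [IsNonarchimedeanLocalField F]
  {m : ℕ} {V : Type*} [AddCommGroup V] [Module ℂ V]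

/-- A space of uniformly locally constant functions on `F ^ {2m}`, smooth under the symplectic group,
consists of constants or carries a nonzero form which is equivariant for a given nontrivial
character under translations and invariant under the stabilizer of the character. -/
theorem const_or_exists_equivariant_form {ψ : AddChar F ℂ} (hψ : Continuous ψ)
    (hψ1 : ψ ≠ 1) (Φ : V →ₗ[ℂ] (WIdx m → F) → ℂ)
    (h₁ : ∀ v, ∃ γ : ValueGroupWithZero F, γ ≠ 0 ∧
      ∀ y, ∀ y' ∈ valBox F (WIdx m) γ, Φ v (y + y') = Φ v y)
    (h₂ : ∀ v, ∃ ε : ValueGroupWithZero F, ε ≠ 0 ∧ IsSmallInvariant ε (Φ v))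
    (h₃ : ∀ g ∈ isometryGroup (RingHom.id F) m, ∀ v, ∃ v', ∀ y, Φ v' y = Φ v (g.1 *ᵥ y))
    {a : WIdx m → F} (ha : a ≠ 0) :
    (∀ v y, Φ v y = Φ v 0) ∨ ∃ L : V →ₗ[ℂ] ℂ, L ≠ 0 ∧
      (∀ v v' x, (∀ y, Φ v' y = Φ v (y + x)) → L v' = ψ (wPair a x) * L v) ∧
      (∀ v v', ∀ g ∈ isometryGroup (RingHom.id F) m, g.1 *ᵥ a = a →
        (∀ y, Φ v' y = Φ v (g.1 *ᵥ y)) → L v' = L v) := by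
  let : MeasurableSpace (WIdx m → F) := borel _
  have : BorelSpace (WIdx m → F) := ⟨rfl⟩
  obtain ⟨μ, _, _⟩ : ∃ μ : Measure (WIdx m → F), μ.IsAddHaarMeasure ∧ μ.Regular :=
    ⟨Measure.addHaar, inferInstance, inferInstance⟩
  have hcont : ∀ v, Continuous (Φ v) := fun v => by
    obtain ⟨γ, hγ, h⟩ := h₁ v
    exact continuous_of_add_valBox hγ h
  have hreg : ∀ v, ∀ b : WIdx m → F, b ≠ 0 → ∃ c : ℂ, ∀ g ∈ isometryGroup (RingHom.id F) m,
      ∀ᶠ γ in atTop, wFourier ψ μ (((fun y => g.1 *ᵥ y) ⁻¹'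
        (valBox F (WIdx m) γ : Set (WIdx m → F))).indicator (Φ v)) b = c := fun v b hb => by
    obtain ⟨ε, hε, h⟩ := h₂ v
    exact exists_eventually_wFourier_eq hψ hψ1 μ (hcont v) hε h hb
  -- `L v` is the common limit over all symplectic images of the boxes. Linearity and equivariance
  -- are then read off at a single large enough truncation.
  choose L hL using fun v => hreg v a ha
  have hL1 : ∀ v, ∀ᶠ γ in atTop, wFourier ψ μ
      ((valBox F (WIdx m) γ : Set (WIdx m → F)).indicator (Φ v)) a = L v := fun v => by
    simpa using hL v 1 (one_mem _)
  have hlarge : ∀ᶠ γ : ValueGroupWithZero F in atTop, γ ≠ 0 := by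
    filter_upwards [eventually_ge_atTop (1 : ValueGroupWithZero F)] with γ hγ
    exact (zero_lt_one.trans_le hγ).ne'
  let Ll : V →ₗ[ℂ] ℂ :=
    { toFun := L
      map_add' := fun v w => by
        obtain ⟨γ, h0, hv, hw, hvw⟩ :=
          (hlarge.and ((hL1 v).and ((hL1 w).and (hL1 (v + w))))).exists
        rw [← hv, ← hw, ← hvw, map_add, wFourier_indicator_add_fun hψ μ (hcont v) (hcont w)
          (isCompact_valBox γ) (isClopen_valBox h0)]
      map_smul' := fun c v => by
        obtain ⟨γ, hv, hcv⟩ := ((hL1 v).and (hL1 (c • v))).exists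
        rw [← hv, ← hcv, map_smul, wFourier_indicator_smul]
        rfl }
  by_cases hL0 : Ll = 0
  · left
    have hLv : ∀ v, L v = 0 := fun v => LinearMap.congr_fun hL0 v
    have hvan : ∀ v, ∀ b : WIdx m → F, b ≠ 0 → ∀ᶠ γ in atTop, wFourier ψ μ
        ((valBox F (WIdx m) γ : Set (WIdx m → F)).indicator (Φ v)) b = 0 := by
      intro v b hb
      -- The coefficient of `Φ v` at `b` is the coefficient at `a` of the function substituted by
      -- `g`. That function is some `Φ v'`, so the coefficient is zero.
      obtain ⟨g, hg, hgb⟩ := exists_isometry_mulVec_eq ha hb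
      obtain ⟨v', hv'⟩ := h₃ g hg v
      obtain ⟨c, hc⟩ := hreg v b hb
      have hc0 : c = 0 := by
        obtain ⟨γ, h4, h5⟩ := ((hc g⁻¹ (inv_mem hg)).and (hL1 v')).exists
        rw [wFourier_indicator_comp_isometry ψ μ a hg hv', hgb, h4, hLv] at h5
        exact h5
      simpa [hc0] using hc 1 (one_mem _)
    intro v y
    obtain ⟨γ, hγ, h4⟩ := h₁ v
    obtain ⟨ε, hε, h5⟩ := h₂ v
    exact eq_zero_value_of_eventually_wFourier_eq_zero hψ hψ1 μ (hcont v) hγ h4 hε h5 (hvan v) y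
  · right
    refine ⟨Ll, hL0, fun v v' x h => ?_, fun v v' g hg hga h => ?_⟩
    · obtain ⟨α, hα⟩ := exists_mem_valBox x
      obtain ⟨γ, hγ, hv, hv'⟩ := ((eventually_ge_atTop α).and ((hL1 v).and (hL1 v'))).exists
      change L v' = _ * L v
      rw [← hv, ← hv', wFourier_indicator_add ψ μ a (valBox_mono hγ hα) h]
    · obtain ⟨γ, hv, hv'⟩ := ((hL v g⁻¹ (inv_mem hg)).and (hL1 v')).exists
      change L v' = L v
      rw [← hv, ← hv', wFourier_indicator_comp_isometry ψ μ a hg h, hga]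

end EquivariantForm

/-! ### Block matrices and the multiplication of the Heisenberg group. -/

section Heisenberg

variable {R : Type*} [CommRing R] {k : ℕ}

/-- Matrices on `W_{k+1}` fixing `e_{k+1}`, in block form with respect to `W_k`, `e_{k+1}`,
`f_{k+1}`. -/
def klingenBlock (M : Matrix (WIdx k) (WIdx k) R) (c r : WIdx k → R) (z : R) :
    Matrix (WIdx (k + 1)) (WIdx (k + 1)) R :=
  (Matrix.fromBlocks M (Matrix.of fun w => Sum.elim (fun _ => 0) fun _ => c w)
    (Matrix.of (Sum.elim (fun _ => r) fun _ => 0))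
    (Matrix.fromBlocks 1 (Matrix.of fun _ _ => z) 0 1 :
      Matrix (Unit ⊕ Unit) (Unit ⊕ Unit) R)).submatrix (wSplit k) (wSplit k)

theorem klingenBlock_mul (M M' : Matrix (WIdx k) (WIdx k) R) (c r c' r' : WIdx k → R) (z z' : R) :
    klingenBlock M c r z * klingenBlock M' c' r' z' =
      klingenBlock (M * M') (M *ᵥ c' + c) (r ᵥ* M' + r') (r ⬝ᵥ c' + z' + z) := by
  rw [klingenBlock, klingenBlock, Matrix.submatrix_mul_equiv, klingenBlock,
    Matrix.fromBlocks_multiply]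
  congr 2
  · ext i j; simp [Matrix.mul_apply]
  · ext i (j | j) <;> simp [Matrix.mul_apply, Matrix.mulVec, dotProduct]
  · ext (i | i) j <;> simp [Matrix.mul_apply, Matrix.vecMul, dotProduct]
  · ext (i | i) (j | j) <;> simp [Matrix.mul_apply, dotProduct, add_assoc]

theorem klingenBlock_one : klingenBlock (1 : Matrix (WIdx k) (WIdx k) R) 0 0 0 = 1 := by
  rw [klingenBlock, ← Matrix.submatrix_one_equiv (wSplit k)]
  congr 1
  ext (i | i | i) (j | j | j) <;> simp [Matrix.one_apply]

theorem wExtend_eq (M : Matrix (WIdx k) (WIdx k) R) : wExtend k R M = klingenBlock M 0 0 0 := by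
  change (Matrix.fromBlocks M 0 0 1).submatrix (wSplit k) (wSplit k) = _
  rw [klingenBlock]
  congr 2
  · ext i (j | j) <;> simp
  · ext (i | i) j <;> simp
  · ext (i | i) (j | j) <;> simp

/-- The `τ`-sesquilinear form of `W_k ⊗ R`. -/
def hPair (τ : R →+* R) (c c' : WIdx k → R) : R := (τ ∘ c) ⬝ᵥ wForm k R *ᵥ c'

theorem hPair_eq_sum (τ : R →+* R) (c c' : WIdx k → R) :
    hPair τ c c' = ∑ i, (τ (c (Sum.inl i)) * c' (Sum.inr i) - τ (c (Sum.inr i)) * c' (Sum.inl i)) := by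
  simp [hPair, wForm, dotProduct, Matrix.mulVec, Matrix.one_apply, Finset.sum_sub_distrib,
    ← sub_eq_add_neg]

theorem hPair_mulVec {τ : R →+* R} {g : GL (WIdx k) R} (hg : g ∈ isometryGroup τ k)
    (c c' : WIdx k → R) : hPair τ (g.1 *ᵥ c) (g.1 *ᵥ c') = hPair τ c c' := by
  have h1 : τ ∘ (g.1 *ᵥ c) = g.1.map τ *ᵥ (τ ∘ c) := by
    ext i; simp [Matrix.mulVec, dotProduct]
  rw [hPair, h1, hPair]
  conv_rhs => rw [← mem_isometryGroup.mp hg]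
  rw [← Matrix.mulVec_mulVec, ← Matrix.mulVec_mulVec, Matrix.dotProduct_mulVec (τ ∘ c),
    Matrix.vecMul_transpose]

/-- The elements of the Heisenberg group of `W_k ⊗ R`. -/
def heis (τ : R →+* R) (c : WIdx k → R) (z : R) : GL (WIdx (k + 1)) R where
  val := klingenBlock 1 c ((τ ∘ c) ᵥ* wForm k R) z
  inv := klingenBlock 1 (-c) ((τ ∘ (-c)) ᵥ* wForm k R) (hPair τ c c - z)
  val_inv := by
    have h : τ ∘ (-c) = -(τ ∘ c) := by ext; simp
    rw [klingenBlock_mul, ← klingenBlock_one]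
    simp only [h, Matrix.neg_vecMul, hPair, Matrix.dotProduct_mulVec, Matrix.one_mulVec,
      Matrix.vecMul_one, Matrix.mul_one, neg_add_cancel, add_neg_cancel, dotProduct_neg]
    congr 1
    ring
  inv_val := by
    have h : τ ∘ (-c) = -(τ ∘ c) := by ext; simp
    rw [klingenBlock_mul, ← klingenBlock_one]
    simp [h, Matrix.neg_vecMul, hPair, Matrix.dotProduct_mulVec]

theorem heis_mul (τ : R →+* R) (c c' : WIdx k → R) (z z' : R) :
    heis τ c z * heis τ c' z' = heis τ (c + c') (z + z' + hPair τ c c') := by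
  have h : τ ∘ (c + c') = τ ∘ c + τ ∘ c' := by ext; simp
  ext : 1
  rw [Units.val_mul, heis, heis, heis]
  simp only [klingenBlock_mul, h, Matrix.add_vecMul, hPair, Matrix.dotProduct_mulVec]
  congr 1
  · simp
  · simp [add_comm]
  · simp
  · ring

theorem heis_zero (τ : R →+* R) : heis (k := k) τ 0 0 = 1 := by
  ext : 1
  have : τ ∘ (0 : WIdx k → R) = 0 := by ext; simp
  rw [heis, Units.val_one, ← klingenBlock_one]
  simp [this]

/-- The Levi factor acts linearly on the vector parameter and fixes `z`; the row entries match
because `g` preserves the form. -/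
theorem units_map_wExtend_mul_heis {τ : R →+* R} {g : GL (WIdx k) R} (hg : g ∈ isometryGroup τ k)
    (c : WIdx k → R) (z : R) :
    Units.map (wExtend k R) g * heis τ c z =
      heis τ (g.1 *ᵥ c) z * Units.map (wExtend k R) g := by
  have h1 : τ ∘ (g.1 *ᵥ c) = g.1.map τ *ᵥ (τ ∘ c) := by
    ext i; simp [Matrix.mulVec, dotProduct]
  ext : 1
  rw [Units.val_mul, Units.val_mul, Units.coe_map, heis, heis]
  change wExtend k R g.1 * _ = _ * wExtend k R g.1
  rw [wExtend_eq, klingenBlock_mul, klingenBlock_mul, h1]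
  congr 1
  · simp
  · simp
  · conv_lhs => rw [← mem_isometryGroup.mp hg]
    simp [← Matrix.vecMul_vecMul, Matrix.vecMul_transpose]
  · simp

/-- All other blocks of the Gram identity hold automatically. -/
theorem klingenBlock_isometry_iff {τ : R →+* R} {c r : WIdx k → R} {z : R} :
    ((klingenBlock 1 c r z).map τ)ᵀ * wForm (k + 1) R * klingenBlock 1 c r z = wForm (k + 1) R ↔
      (∀ w, (wForm k R *ᵥ c) w + τ (r w) = 0) ∧ (∀ w, ((τ ∘ c) ᵥ* wForm k R) w - r w = 0) ∧
        hPair τ c c - z + τ z = 0 := by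
  rw [wForm_succ, klingenBlock, ← Matrix.submatrix_map, Matrix.transpose_submatrix,
    Matrix.submatrix_mul_equiv, Matrix.submatrix_mul_equiv, Matrix.fromBlocks_map,
    Matrix.fromBlocks_transpose, Matrix.fromBlocks_multiply, Matrix.fromBlocks_multiply]
  constructor
  · intro h
    have h' : ∀ i j, _ := fun i j => congrFun (congrFun h ((wSplit k).symm i)) ((wSplit k).symm j)
    simp only [Matrix.submatrix_apply, Equiv.apply_symm_apply] at h'
    refine ⟨fun w => ?_, fun w => ?_, ?_⟩
    · have := h' (Sum.inl w) (Sum.inr (Sum.inr ()))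
      simpa [Matrix.mul_apply, Matrix.mulVec, dotProduct, Matrix.map_one] using this
    · have := h' (Sum.inr (Sum.inr ())) (Sum.inl w)
      simpa [Matrix.mul_apply, Matrix.vecMul, dotProduct, Matrix.map_one, ← sub_eq_add_neg] using this
    · have := h' (Sum.inr (Sum.inr ())) (Sum.inr (Sum.inr ()))
      rw [hPair, Matrix.dotProduct_mulVec]
      simpa [Matrix.mul_apply, Matrix.vecMul, dotProduct, Matrix.map_one, sub_eq_add_neg, add_assoc]
        using this
  · rintro ⟨h1, h2, h3⟩
    congr 1
    rw [hPair, Matrix.dotProduct_mulVec] at h3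
    ext (i | i | i) (j | j | j)
    · simp [Matrix.mul_apply, Matrix.map_one]
    · simp [Matrix.mul_apply, Matrix.map_one]
    · simpa [Matrix.mul_apply, Matrix.mulVec, dotProduct, Matrix.map_one] using h1 i
    · simp [Matrix.mul_apply, Matrix.map_one]
    · simp [Matrix.mul_apply, Matrix.map_one]
    · simp [Matrix.mul_apply, Matrix.map_one]
    · simpa [Matrix.mul_apply, Matrix.vecMul, dotProduct, Matrix.map_one, ← sub_eq_add_neg] using h2 j
    · simp [Matrix.mul_apply, Matrix.map_one]
    · simpa [Matrix.mul_apply, Matrix.vecMul, dotProduct, Matrix.map_one, sub_eq_add_neg, add_assoc]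
        using h3

end Heisenberg

/-! ### The unipotent radical of the Klingen mirabolic as a Heisenberg group. -/

section KlingenRadical

variable {R : Type*} [CommRing R] {k : ℕ}

theorem wSplit_symm_e : (wSplit k).symm (Sum.inr (Sum.inl ())) = Sum.inl (Fin.last k) := by
  rw [Equiv.symm_apply_eq]; simp [wSplit]

theorem wSplit_symm_f : (wSplit k).symm (Sum.inr (Sum.inr ())) = Sum.inr (Fin.last k) := by
  rw [Equiv.symm_apply_eq]; simp [wSplit]

theorem klingenBlock_apply_symm (M : Matrix (WIdx k) (WIdx k) R) (c r : WIdx k → R) (z : R)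
    (i j : WIdx k ⊕ (Unit ⊕ Unit)) :
    klingenBlock M c r z ((wSplit k).symm i) ((wSplit k).symm j) =
      Matrix.fromBlocks M (Matrix.of fun w => Sum.elim (fun _ => 0) fun _ => c w)
        (Matrix.of (Sum.elim (fun _ => r) fun _ => 0))
        (Matrix.fromBlocks 1 (Matrix.of fun _ _ => z) 0 1 :
          Matrix (Unit ⊕ Unit) (Unit ⊕ Unit) R) i j := by
  simp [klingenBlock]

theorem klingenBlock_mulVec_single (M : Matrix (WIdx k) (WIdx k) R) (c r : WIdx k → R) (z : R) :
    klingenBlock M c r z *ᵥ Pi.single (Sum.inl (Fin.last k)) 1 =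
      Pi.single (Sum.inl (Fin.last k)) 1 := by
  rw [Matrix.mulVec_single_one, ← wSplit_symm_e]
  ext a
  obtain ⟨s, rfl⟩ := (wSplit k).symm.surjective a
  rw [Matrix.col_apply, klingenBlock_apply_symm, Pi.single_apply]
  rcases s with s | s | s <;> simp

theorem map_vecMul_wForm {τ : R →+* R} (hτ : ∀ x, τ (τ x) = x) (c : WIdx k → R) (w : WIdx k) :
    τ (((τ ∘ c) ᵥ* wForm k R) w) = -(wForm k R *ᵥ c) w := by
  rcases w with w | w <;>
    simp [wForm, Matrix.vecMul, Matrix.mulVec, dotProduct, Matrix.one_apply, hτ]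

theorem heis_mem_klingenRadical {τ : R →+* R} (hτ : ∀ x, τ (τ x) = x) {c : WIdx k → R} {z : R}
    (h : hPair τ c c = z - τ z) : heis τ c z ∈ klingenRadical τ k := by
  refine ⟨⟨?_, klingenBlock_mulVec_single _ _ _ _⟩, fun a b ha hb => ?_⟩
  · rw [mem_isometryGroup]
    refine klingenBlock_isometry_iff.mpr ⟨fun w => ?_, fun w => sub_self _, ?_⟩
    · rw [map_vecMul_wForm hτ]; ring
    · rw [h]; ring
  · obtain ⟨s, rfl⟩ := (wSplit k).symm.surjective a
    obtain ⟨t, rfl⟩ := (wSplit k).symm.surjective b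
    change klingenBlock _ _ _ _ _ _ = _
    rw [klingenBlock_apply_symm]
    rcases s with s | s | s
    · rcases t with t | t | t
      · simp [Matrix.one_apply]
      · simp
      · exact absurd wSplit_symm_f hb
    · exact absurd wSplit_symm_e ha
    · rcases t with t | t | t
      · simp
      · simp
      · exact absurd wSplit_symm_f hb

theorem klingenMirabolic_apply_f {τ : R →+* R} {g : GL (WIdx (k + 1)) R}
    (hg : g ∈ klingenMirabolic τ k) : g.1 (Sum.inr (Fin.last k)) (Sum.inr (Fin.last k)) = 1 := by
  have h := congrFun (congrFun (mem_isometryGroup.mp hg.1) (Sum.inl (Fin.last k)))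
    (Sum.inr (Fin.last k))
  have h1 : ∀ a, g.1 a (Sum.inl (Fin.last k)) = _ := klingenMirabolic_col hg
  simpa [Matrix.mul_apply, wForm, h1, Matrix.one_apply, apply_ite τ] using h

/-- The Gram identity determines the first row from the last column, so only the column and the
corner entry remain as parameters. -/
theorem exists_eq_heis {τ : R →+* R} {u : GL (WIdx (k + 1)) R} (hu : u ∈ klingenRadical τ k) :
    ∃ c z, u = heis τ c z ∧ hPair τ c c = z - τ z := by
  obtain ⟨hu, hu'⟩ := hu
  set c : WIdx k → R := fun w => u.1 ((wSplit k).symm (Sum.inl w)) (Sum.inr (Fin.last k))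
  set r : WIdx k → R := fun w => u.1 (Sum.inl (Fin.last k)) ((wSplit k).symm (Sum.inl w))
  set z := u.1 (Sum.inl (Fin.last k)) (Sum.inr (Fin.last k))
  have hne : ∀ w : WIdx k, (wSplit k).symm (Sum.inl w) ≠ Sum.inl (Fin.last k) := fun w => by
    rw [← wSplit_symm_e]; simp
  have hnf : ∀ w : WIdx k, (wSplit k).symm (Sum.inl w) ≠ Sum.inr (Fin.last k) := fun w => by
    rw [← wSplit_symm_f]; simp
  have h1 : u.1 = klingenBlock 1 c r z := by
    ext a b
    obtain ⟨s, rfl⟩ := (wSplit k).symm.surjective a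
    obtain ⟨t, rfl⟩ := (wSplit k).symm.surjective b
    rw [klingenBlock_apply_symm]
    rcases t with t | t | t
    · rcases s with s | s | s
      · rw [hu' _ _ (hne s) (hnf t)]; simp [Matrix.one_apply]
      · rw [wSplit_symm_e]; simp [r]
      · rw [wSplit_symm_f, hu' _ _ (by simp) (hnf t), Matrix.one_apply_ne (hnf t).symm]; simp
    · rw [wSplit_symm_e, klingenMirabolic_col hu, ← wSplit_symm_e]
      rcases s with s | s | s <;> simp
    · rw [wSplit_symm_f]
      rcases s with s | s | s
      · simp [c]
      · rw [wSplit_symm_e]; simp [z]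
      · rw [wSplit_symm_f, klingenMirabolic_apply_f hu]; simp
  have h2 := mem_isometryGroup.mp hu.1
  rw [h1] at h2
  obtain ⟨-, h3, h4⟩ := klingenBlock_isometry_iff.mp h2
  have h5 : r = (τ ∘ c) ᵥ* wForm k R := funext fun w => (sub_eq_zero.mp (h3 w)).symm
  refine ⟨c, z, ?_, by linear_combination h4⟩
  ext : 1
  rw [h1, h5]
  rfl

theorem klingenSum_heis {E F : Type*} [Field F] [Field E] [Algebra F E] (σ : E ≃ₐ[F] E) {m : ℕ}
    (c : WIdx (m + 1) → E) (z : E) : klingenSum (heis (σ : E →+* E) c z).1 =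
      c (Sum.inr (Fin.last m)) - σ (c (Sum.inr (Fin.last m))) := by
  simp [klingenSum, heis, klingenBlock, wSplit, wForm, Matrix.vecMul, dotProduct, Matrix.one_apply]
  ring

theorem map_heis {S : Type*} [CommRing S] (f : R →+* S) {τ : R →+* R} {τ' : S →+* S}
    (hf : ∀ x, f (τ x) = τ' (f x)) (c : WIdx k → R) (z : R) :
    GeneralLinearGroup.map f (heis τ c z) = heis τ' (f ∘ c) (f z) := by
  ext a b
  obtain ⟨s, rfl⟩ := (wSplit k).symm.surjective a
  obtain ⟨t, rfl⟩ := (wSplit k).symm.surjective b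
  change f (klingenBlock _ _ _ _ _ _) = klingenBlock _ _ _ _ _ _
  rw [klingenBlock_apply_symm, klingenBlock_apply_symm]
  rcases s with s | s | s <;> rcases t with t | t | t <;> simp [Matrix.one_apply, apply_ite f]
  rcases t with t | t <;>
    simp [wForm, Matrix.vecMul, dotProduct, Matrix.one_apply, hf]

end KlingenRadical

/-! ### Coordinates on `E = F ⊕ δ F`. -/

section QuadraticExtension

variable {F E : Type*} [Field F] [Field E] [Algebra F E]

theorem conj_conj_of_sqrt {σ : E ≃ₐ[F] E} (hσ : σ ≠ 1) {d : F} {δ : E}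
    (hd : δ ^ 2 = algebraMap F E d) (hδ : IntermediateField.adjoin F {δ} = ⊤) (x : E) :
    σ (σ x) = x := by
  have : σ * σ = 1 := eq_one_of_adjoin_eq_top (y := δ)
    (by rw [AlgEquiv.mul_apply, conj_sqrt hσ hd hδ, map_neg, conj_sqrt hσ hd hδ, neg_neg]) hδ
  exact DFunLike.congr_fun this x

theorem sqrt_ne_zero {σ : E ≃ₐ[F] E} (hσ : σ ≠ 1) {δ : E}
    (hδ : IntermediateField.adjoin F {δ} = ⊤) : δ ≠ 0 := by
  rintro rfl
  exact hσ (eq_one_of_adjoin_eq_top (map_zero σ) hδ)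

theorem two_ne_zero_of_sqrt {σ : E ≃ₐ[F] E} (hσ : σ ≠ 1) {d : F} {δ : E}
    (hd : δ ^ 2 = algebraMap F E d) (hδ : IntermediateField.adjoin F {δ} = ⊤) : (2 : E) ≠ 0 := by
  intro h
  refine hσ (eq_one_of_adjoin_eq_top (y := δ) ?_ hδ)
  rw [conj_sqrt hσ hd hδ]
  linear_combination (-δ) * h

/-- These are the eigenspaces of `σ`. The elements `(e + σ e) / 2` and `(e - σ e) / (2 δ)` are fixed
by `σ`; divided by `δ` they have trace zero, so `algebraMap_invFun_mul` places them in `F`. -/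
theorem exists_eq_add_sqrt_mul (h2 : Module.finrank F E = 2) {σ : E ≃ₐ[F] E} (hσ : σ ≠ 1) {d : F}
    {δ : E} (hd : δ ^ 2 = algebraMap F E d) (hδ : IntermediateField.adjoin F {δ} = ⊤) (e : E) :
    ∃ x y : F, e = algebraMap F E x + δ * algebraMap F E y := by
  have hδ0 := sqrt_ne_zero hσ hδ
  have h20 := two_ne_zero_of_sqrt hσ hd hδ
  have hσδ := conj_sqrt hσ hd hδ
  have hσσ := conj_conj_of_sqrt hσ hd hδ
  have h1 := algebraMap_invFun_mul h2 hσ hd hδ (e := δ⁻¹ * ((e + σ e) / 2)) (by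
    simp only [map_mul, map_inv₀, map_div₀, map_add, hσσ, hσδ, map_ofNat, inv_neg]
    ring)
  have h3 := algebraMap_invFun_mul h2 hσ hd hδ (e := δ⁻¹ * ((e - σ e) / (2 * δ))) (by
    simp only [map_mul, map_inv₀, map_div₀, map_sub, hσσ, hσδ, map_ofNat, inv_neg]
    field_simp
    ring)
  refine ⟨_, _, Eq.symm ((congrArg₂ (fun a b => a + δ * b) h1 h3).trans ?_)⟩
  field_simp
  ring

/-- The vector `x + δ y` of `W_k ⊗ E`. -/
def sqrtVec {k : ℕ} (δ : E) (x y : WIdx k → F) : WIdx k → E :=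
  fun i => algebraMap F E (x i) + δ * algebraMap F E (y i)

theorem hPair_sqrtVec {σ : E ≃ₐ[F] E} {δ : E} (hσδ : σ δ = -δ) {k : ℕ}
    (x y x' y' : WIdx k → F) : hPair (σ : E →+* E) (sqrtVec δ x y) (sqrtVec δ x' y') =
      algebraMap F E (wPair x x') + δ * algebraMap F E (wPair x y') -
        δ * algebraMap F E (wPair y x') - δ ^ 2 * algebraMap F E (wPair y y') := by
  simp only [hPair_eq_sum, wPair_eq_sum, map_sum, Finset.mul_sum, ← Finset.sum_add_distrib,
    ← Finset.sum_sub_distrib]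
  refine Finset.sum_congr rfl fun i _ => ?_
  simp only [sqrtVec, RingHom.coe_coe, map_add, map_mul, AlgEquiv.commutes, hσδ, map_sub]
  ring

end QuadraticExtension

/-! ### Factoring the Heisenberg group into rational and skew elements. -/

section SkewHeisenberg

variable {F E : Type*} [Field F] [Field E] [Algebra F E] {σ : E ≃ₐ[F] E} {δ : E} {k : ℕ}

/-- The elements `w ↦ w + ⋯` of the Heisenberg group attached to the vectors `δ y`. -/
def skewHeis (hσσ : ∀ x, σ (σ x) = x) (hσδ : σ δ = -δ) (y : WIdx k → F) : klingenP σ k :=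
  ⟨heis (σ : E →+* E) (sqrtVec δ 0 y) 0,
    (heis_mem_klingenRadical hσσ (by simp [hPair_sqrtVec hσδ, wPair_self])).1⟩

/-- The `F`-rational elements of the Heisenberg group. -/
def ratHeis (hσσ : ∀ x, σ (σ x) = x) (hσδ : σ δ = -δ) (x : WIdx k → F) (z : F) : klingenP σ k :=
  ⟨heis (σ : E →+* E) (sqrtVec δ x 0) (algebraMap F E z),
    (heis_mem_klingenRadical hσσ (by simp [hPair_sqrtVec hσδ, wPair_self])).1⟩

variable (hσσ : ∀ x, σ (σ x) = x) (hσδ : σ δ = -δ)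

theorem sqrtVec_add (x y x' y' : WIdx k → F) :
    sqrtVec δ x y + sqrtVec δ x' y' = sqrtVec δ (x + x') (y + y') := by
  ext i; simp [sqrtVec]; ring

theorem ratHeis_mem (x : WIdx k → F) (z : F) :
    ratHeis hσσ hσδ x z ∈ (klingenQ F E k).subgroupOf (klingenP σ k) := by
  refine ⟨heis (RingHom.id F) x z, (heis_mem_klingenRadical (fun _ => rfl) ?_).1, ?_⟩
  · rw [hPair_eq_sum]; simp [mul_comm]
  · rw [map_heis (algebraMap F E) (τ' := (σ : E →+* E)) (fun x => by simp)]
    have : algebraMap F E ∘ x = sqrtVec δ x 0 := by ext i; simp [sqrtVec]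
    rw [this]
    rfl

theorem ratHeis_mul_skewHeis (x y : WIdx k → F) (z : F) :
    (ratHeis hσσ hσδ x z * skewHeis hσσ hσδ y).1 = heis (σ : E →+* E) (sqrtVec δ x y)
      (algebraMap F E z + δ * algebraMap F E (wPair x y)) := by
  rw [Subgroup.coe_mul, ratHeis, skewHeis, heis_mul, sqrtVec_add, hPair_sqrtVec hσδ]
  simp

/-- The two orders differ by the central terms `δ ⟨x, y⟩` and `-δ ⟨y, x⟩`, which coincide since the
form is alternating. -/
theorem skewHeis_mul_ratHeis (x y : WIdx k → F) (z : F) :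
    skewHeis hσσ hσδ y * ratHeis hσσ hσδ x z = ratHeis hσσ hσδ x z * skewHeis hσσ hσδ y := by
  ext1
  rw [ratHeis_mul_skewHeis, Subgroup.coe_mul, ratHeis, skewHeis, heis_mul, sqrtVec_add,
    hPair_sqrtVec hσδ, wPair_comm y x]
  simp

/-- The central term is `-δ ^ 2 ⟨y, y'⟩`, which is rational since `δ ^ 2 = d`. An invariant form
therefore sees the skew elements as an additive group. -/
theorem skewHeis_mul_skewHeis {d : F} (hd : δ ^ 2 = algebraMap F E d) (y y' : WIdx k → F) :
    skewHeis hσσ hσδ y * skewHeis hσσ hσδ y' =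
      ratHeis hσσ hσδ 0 (-(d * wPair y y')) * skewHeis hσσ hσδ (y + y') := by
  ext1
  rw [ratHeis_mul_skewHeis, Subgroup.coe_mul, skewHeis, skewHeis, heis_mul, sqrtVec_add,
    hPair_sqrtVec hσδ, hd]
  simp

theorem skewHeis_zero : skewHeis hσσ hσδ (0 : WIdx k → F) = 1 := by
  ext1
  have : sqrtVec δ (0 : WIdx k → F) 0 = 0 := by ext i; simp [sqrtVec]
  change heis _ (sqrtVec δ 0 0) 0 = 1
  rw [this, heis_zero]

/-- Writing `c = x + δ y`, the isometry condition forces the `δ`-part of `z` to be `⟨x, y⟩`, exactly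
the central term of the product. Only the rational part of `z` is free. -/
theorem exists_eq_ratHeis_mul_skewHeis (h2 : Module.finrank F E = 2) (hσ : σ ≠ 1) {d : F}
    (hd : δ ^ 2 = algebraMap F E d) (hδ : IntermediateField.adjoin F {δ} = ⊤)
    {u : klingenP σ k} (hu : u.1 ∈ klingenRadical (σ : E →+* E) k) :
    ∃ x y z, u = ratHeis hσσ hσδ x z * skewHeis hσσ hσδ y := by
  obtain ⟨c, z, hcz, hz⟩ := exists_eq_heis hu
  choose x y hxy using fun i => exists_eq_add_sqrt_mul h2 hσ hd hδ (c i)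
  have hc : c = sqrtVec δ x y := funext hxy
  obtain ⟨z₁, z₂, hz₁₂⟩ := exists_eq_add_sqrt_mul h2 hσ hd hδ z
  refine ⟨x, y, z₁, Subtype.ext ?_⟩
  rw [ratHeis_mul_skewHeis, hcz, hc]
  congr 1
  rw [hc, hPair_sqrtVec hσδ, wPair_self, wPair_self, wPair_comm y x, hz₁₂] at hz
  simp only [map_zero, map_neg, RingHom.coe_coe, map_add, map_mul, AlgEquiv.commutes, hσδ] at hz
  have h20 := two_ne_zero_of_sqrt hσ hd hδ
  rw [hz₁₂]
  refine mul_left_cancel₀ h20 ?_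
  linear_combination -hz

theorem klingenSum_ratHeis_mul_skewHeis {m : ℕ} (x y : WIdx (m + 1) → F) (z : F) :
    klingenSum (ratHeis hσσ hσδ x z * skewHeis hσσ hσδ y).1.1 =
      2 * δ * algebraMap F E (y (Sum.inr (Fin.last m))) := by
  rw [ratHeis_mul_skewHeis, klingenSum_heis]
  simp [sqrtVec, hσδ]
  ring

/-- The embedding of `Sp(W_k)` into the Klingen mirabolic subgroup for `W_{k+1} ⊗ E`. -/
def ratLevi (σ : E ≃ₐ[F] E) (k : ℕ) : isometryGroup (RingHom.id F) k →* klingenP σ k :=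
  (leviEmbedding (σ : E →+* E) k).comp
    (((GeneralLinearGroup.map (algebraMap F E)).comp (isometryGroup (RingHom.id F) k).subtype).codRestrict
      (unitaryW σ k) fun g => symplecticW_le_unitaryW σ k ⟨g.1, g.2, rfl⟩)

theorem ratLevi_val (g : isometryGroup (RingHom.id F) k) : (ratLevi σ k g).1 =
    Units.map (wExtend k E) (GeneralLinearGroup.map (algebraMap F E) g.1) := rfl

theorem ratLevi_mem (g : isometryGroup (RingHom.id F) k) :
    ratLevi σ k g ∈ (klingenQ F E k).subgroupOf (klingenP σ k) := by
  refine ⟨(leviEmbedding (RingHom.id F) k g).1, (leviEmbedding (RingHom.id F) k g).2, ?_⟩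
  ext : 1
  change (wExtend k F g.1.1).map (algebraMap F E) = wExtend k E (g.1.1.map (algebraMap F E))
  simp only [wExtend, MonoidHom.coe_mk, OneHom.coe_mk]
  rw [← Matrix.submatrix_map, Matrix.fromBlocks_map]
  simp [Matrix.map_one]

theorem map_mulVec_sqrtVec (g : GL (WIdx k) F) (y : WIdx k → F) :
    (GeneralLinearGroup.map (algebraMap F E) g).1 *ᵥ sqrtVec δ 0 y =
      sqrtVec δ 0 (g.1 *ᵥ y) := by
  ext i
  change (g.1.map (algebraMap F E) *ᵥ _) i = _
  simp [Matrix.mulVec, dotProduct, sqrtVec, mul_left_comm, mul_add, Finset.mul_sum]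

theorem ratLevi_mul_skewHeis (g : isometryGroup (RingHom.id F) k) (y : WIdx k → F) :
    ratLevi σ k g * skewHeis hσσ hσδ y = skewHeis hσσ hσδ (g.1.1 *ᵥ y) * ratLevi σ k g := by
  ext1
  rw [Subgroup.coe_mul, Subgroup.coe_mul, ratLevi_val, skewHeis, skewHeis,
    units_map_wExtend_mul_heis (symplecticW_le_unitaryW σ k ⟨g.1, g.2, rfl⟩),
    map_mulVec_sqrtVec]

end SkewHeisenberg

/-! ### Continuity of the embeddings, and transvections near the identity. -/

section Smoothness

open ValuativeRel Filter Topology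

variable {F E : Type*} [Field F] [ValuativeRel F] [TopologicalSpace F]
  [IsNonarchimedeanLocalField F] [Field E] [Algebra F E] [TopologicalSpace E] [IsModuleTopology F E]
  {σ : E ≃ₐ[F] E} {δ : E} {k : ℕ}

theorem Continuous.klingenBlock {R X : Type*} [CommRing R] [TopologicalSpace R] [TopologicalSpace X]
    {M : X → Matrix (WIdx k) (WIdx k) R} {c r : X → WIdx k → R} {z : X → R} (hM : Continuous M)
    (hc : Continuous c) (hr : Continuous r) (hz : Continuous z) :
    Continuous fun p => klingenBlock (M p) (c p) (r p) (z p) := by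
  refine continuous_matrix fun i j => ?_
  obtain ⟨s, rfl⟩ := (wSplit k).symm.surjective i
  obtain ⟨t, rfl⟩ := (wSplit k).symm.surjective j
  simp only [klingenBlock_apply_symm]
  rcases s with s | s | s <;> rcases t with t | t | t <;> simp <;> fun_prop

theorem continuous_skewHeis [FiniteDimensional F E] (hσσ : ∀ x, σ (σ x) = x) (hσδ : σ δ = -δ) :
    Continuous (skewHeis hσσ hσδ : (WIdx k → F) → klingenP σ k) := by
  have : IsTopologicalRing E := IsModuleTopology.isTopologicalRing F E
  have hσ : Continuous σ := IsModuleTopology.continuous_of_linearMap σ.toLinearMap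
  have ha : Continuous (algebraMap F E) :=
    IsModuleTopology.continuous_of_linearMap (Algebra.linearMap F E)
  have hv : Continuous fun y : WIdx k → F => sqrtVec δ 0 y := by
    refine continuous_pi fun i => ?_
    simp only [sqrtVec]
    fun_prop
  have hτ : Continuous fun y : WIdx k → F => (σ : E →+* E) ∘ sqrtVec δ 0 y :=
    continuous_pi fun i => hσ.comp ((continuous_apply i).comp hv)
  have hτ' : Continuous fun y : WIdx k → F => (σ : E →+* E) ∘ (-sqrtVec δ 0 y) :=
    continuous_pi fun i => hσ.comp ((continuous_apply i).comp hv).neg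
  refine Continuous.subtype_mk (Units.continuous_iff.mpr ⟨?_, ?_⟩) _
  · exact Continuous.klingenBlock continuous_const hv (hτ.matrix_vecMul continuous_const)
      continuous_const
  · refine Continuous.klingenBlock continuous_const hv.neg (hτ'.matrix_vecMul continuous_const)
      (Continuous.sub ?_ continuous_const)
    exact hτ.dotProduct (continuous_const.matrix_mulVec hv)

theorem continuous_wExtend {R : Type*} [CommRing R] [TopologicalSpace R] :
    Continuous (wExtend k R) := by
  simp only [funext wExtend_eq]
  exact Continuous.klingenBlock continuous_id continuous_const continuous_const continuous_const

theorem continuous_leviEmbedding {R : Type*} [CommRing R] [TopologicalSpace R] (τ : R →+* R) :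
    Continuous (leviEmbedding τ k) :=
  Continuous.subtype_mk ((Continuous.units_map (wExtend k R) continuous_wExtend).comp
    continuous_subtype_val) _

theorem continuous_mirabolicEmbedding {R : Type*} [CommRing R] [TopologicalSpace R] (τ : R →+* R) :
    Continuous (mirabolicEmbedding τ k) :=
  (continuous_leviEmbedding τ).comp (Continuous.subtype_mk continuous_subtype_val _)

/-- Smallness bounds the products `t * b i * b j`, not `t` and `b` separately. The family is
therefore parametrized by the matrices `X = t b (b J)`. These square to zero, so `1 + X` and its
inverse `1 - X` both depend continuously on `X`. -/
theorem exists_smallTransvection_mem [FiniteDimensional F E] {S : Set (klingenP σ k)}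
    (hS : S ∈ 𝓝 1) : ∃ ε : ValueGroupWithZero F, ε ≠ 0 ∧ ∀ t b, IsSmallTransvection ε t b →
      ratLevi σ k ⟨wTransvection t b, wTransvection_mem t b⟩ ∈ S := by
  have : IsTopologicalRing E := IsModuleTopology.isTopologicalRing F E
  have ha : Continuous (algebraMap F E) :=
    IsModuleTopology.continuous_of_linearMap (Algebra.linearMap F E)
  let Z := {X : (WIdx k × WIdx k) → F // ∃ (t : F) (b : WIdx k → F), Matrix.of (Function.curry X) =
    t • vecMulVec b (b ᵥ* wForm k F)}
  have hX : Continuous fun X : Z => Matrix.of (Function.curry X.1) :=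
    continuous_matrix fun i j => (continuous_apply (i, j)).comp continuous_subtype_val
  have hZ : ∀ X : Z, Matrix.of (Function.curry X.1) * Matrix.of (Function.curry X.1) = 0 := by
    rintro ⟨X, t, b, h⟩
    have hb : (b ᵥ* wForm k F) ⬝ᵥ b = 0 := by
      rw [← Matrix.dotProduct_mulVec, ← wPair_apply, wPair_self]
    simp only [h]
    simp [Matrix.vecMulVec_mul_vecMulVec, hb]
  let T : Z → GL (WIdx k) F := fun X => ⟨1 + Matrix.of (Function.curry X.1),
    1 - Matrix.of (Function.curry X.1),
    by have h := hZ X; simp [mul_sub, add_mul, h], by have h := hZ X; simp [sub_mul, mul_add, h]⟩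
  have hT : ∀ (X : Z) t b, Matrix.of (Function.curry X.1) = t • vecMulVec b (b ᵥ* wForm k F) →
      T X = wTransvection t b := by
    intro X t b h
    ext : 1
    change 1 + _ = 1 + _
    rw [h]
  have hTm : ∀ X, T X ∈ isometryGroup (RingHom.id F) k := by
    intro X
    obtain ⟨t, b, h⟩ := X.2
    rw [hT X t b h]
    exact wTransvection_mem t b
  have hTc : Continuous T := Units.continuous_iff.mpr
    ⟨continuous_const.add hX, continuous_const.sub hX⟩
  have hc : Continuous fun X : Z => ratLevi σ k ⟨T X, hTm X⟩ := by
    refine (continuous_leviEmbedding (σ : E →+* E)).comp (Continuous.subtype_mk ?_ _)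
    have hmap : Continuous fun M : Matrix (WIdx k) (WIdx k) F => M.map (algebraMap F E) :=
      continuous_id.matrix_map ha
    exact (Continuous.units_map
      ((algebraMap F E).mapMatrix (m := WIdx k)).toMonoidHom hmap).comp hTc
  let z : Z := ⟨0, 0, 0, by ext; simp⟩
  have hz : ratLevi σ k ⟨T z, hTm z⟩ = 1 := by
    rw [← map_one (ratLevi σ k)]
    congr 1
    ext : 2
    change 1 + _ = (1 : Matrix _ _ F)
    ext; simp [z]
  have h1 : (fun X : Z => ratLevi σ k ⟨T X, hTm X⟩) ⁻¹' S ∈ 𝓝 z :=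
    hc.continuousAt.preimage_mem_nhds (by rw [hz]; exact hS)
  rw [nhds_subtype_eq_comap, mem_comap] at h1
  obtain ⟨U, hU, hUS⟩ := h1
  obtain ⟨ε, hε, hεU⟩ := exists_valBox_subset hU
  refine ⟨ε, hε, fun t b htb => ?_⟩
  let X : Z := ⟨fun p => (t • vecMulVec b (b ᵥ* wForm k F)) p.1 p.2, t, b, rfl⟩
  have h2 : X ∈ (fun X : Z => ratLevi σ k ⟨T X, hTm X⟩) ⁻¹' S := by
    refine hUS (hεU fun p => ?_)
    have h3 : ∀ j, (b ᵥ* wForm k F) j = b j.swap ∨ (b ᵥ* wForm k F) j = -b j.swap := by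
      rintro (j | j) <;> simp [wForm, Matrix.vecMul, dotProduct, Matrix.one_apply]
    have h4 := htb p.1 p.2.swap
    rcases h3 p.2 with h | h <;> simpa [X, Matrix.vecMulVec_apply, h, mul_assoc] using h4
  have h5 : (⟨T X, hTm X⟩ : isometryGroup (RingHom.id F) k) =
      ⟨wTransvection t b, wTransvection_mem t b⟩ := Subtype.ext (hT X t b rfl)
  rw [← h5]
  exact h2

end Smoothness

/-! ### Smooth representations, characters and twisted Jacquet modules. -/

section JacquetModules

open Filter Topology

variable {G H V : Type*} [Group G] [Group H] [AddCommGroup V] [Module ℂ V]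

theorem isSmoothRep_of_mem_nhds [TopologicalSpace G] [IsTopologicalGroup G]
    {π : Representation ℂ G V} (h : ∀ v, {g : G | π g v = v} ∈ 𝓝 1) : IsSmoothRep π := by
  intro v
  let S : Subgroup G :=
    { carrier := {g | π g v = v}
      one_mem' := by simp
      mul_mem' := fun {a b} ha hb => by
        simp only [Set.mem_ofPred_eq] at ha hb ⊢
        rw [map_mul, Module.End.mul_apply, hb, ha]
      inv_mem' := fun {a} ha => by
        simp only [Set.mem_ofPred_eq] at ha ⊢
        conv_lhs => rw [← ha]
        simp }
  exact S.isOpen_of_mem_nhds (h v)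

theorem IsSmoothRep.comp [TopologicalSpace G] [TopologicalSpace H] {π : Representation ℂ G V}
    (hπ : IsSmoothRep π) {φ : H →* G} (hφ : Continuous φ) :
    IsSmoothRep (MonoidHom.comp π φ : Representation ℂ H V) :=
  fun v => (hπ v).preimage hφ

/-- Evaluating at a vector where `L` does not vanish makes `c` multiplicative, so no direct check on
`c` is needed. -/
theorem exists_character_of_form {π : Representation ℂ G V} {N : Subgroup G} {c : N → ℂ}
    {L : V →ₗ[ℂ] ℂ} (hL : L ≠ 0) (h : ∀ (u : N) v, L (π u.1 v) = c u * L v) :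
    ∃ μ : N →* ℂˣ, ∀ u, (μ u : ℂ) = c u := by
  obtain ⟨v, hv⟩ : ∃ v, L v ≠ 0 := by
    by_contra! h0
    exact hL (LinearMap.ext h0)
  let χ : N →* ℂ :=
    { toFun := c
      map_one' := by
        have := h 1 v
        rw [Subgroup.coe_one, map_one, Module.End.one_apply] at this
        exact mul_right_cancel₀ hv (by rw [← this, one_mul])
      map_mul' := fun a b => by
        have := h (a * b) v
        rw [Subgroup.coe_mul, map_mul, Module.End.mul_apply, h, h, ← mul_assoc] at this
        exact (mul_right_cancel₀ hv this).symm }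
  exact ⟨χ.toHomUnits, fun u => rfl⟩

theorem exists_rep_twistedJacquet (π : Representation ℂ G V) (N : Subgroup G) (μ : N →* ℂˣ)
    (φ : H →* G) (hφ : ∀ h (u : N), ∃ u' : N, φ h * u = u' * φ h ∧ μ u' = μ u) :
    ∃ ρ : Representation ℂ H (TwistedJacquet π N μ),
      ∀ h v, ρ h (Submodule.Quotient.mk v) = Submodule.Quotient.mk (π (φ h) v) := by
  have hle : ∀ h, twistedSpan π N μ ≤ (twistedSpan π N μ).comap (π (φ h)) := by
    intro h
    refine Submodule.span_le.mpr ?_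
    rintro _ ⟨u, v, rfl⟩
    obtain ⟨u', h1, h2⟩ := hφ h u
    refine Submodule.subset_span ⟨u', π (φ h) v, ?_⟩
    rw [map_sub, map_smul, ← Module.End.mul_apply, ← map_mul, h1, map_mul, Module.End.mul_apply, h2]
  refine ⟨{ toFun := fun h => Submodule.mapQ _ _ (π (φ h)) (hle h), map_one' := ?_, map_mul' := ?_ },
    fun h v => rfl⟩
  · ext v; simp
  · intro a b; ext v; simp

theorem twistedSpan_le_ker {π : Representation ℂ G V} {N : Subgroup G} {μ : N →* ℂˣ}
    {L : V →ₗ[ℂ] ℂ} (h : ∀ (u : N) v, L (π u.1 v) = (μ u : ℂ) * L v) :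
    twistedSpan π N μ ≤ LinearMap.ker L := by
  refine Submodule.span_le.mpr ?_
  rintro _ ⟨u, v, rfl⟩
  simp [h]

theorem nontrivial_twistedJacquet {π : Representation ℂ G V} {N : Subgroup G} {μ : N →* ℂˣ}
    {L : V →ₗ[ℂ] ℂ} (hL : L ≠ 0) (h : ∀ (u : N) v, L (π u.1 v) = (μ u : ℂ) * L v) :
    Nontrivial (TwistedJacquet π N μ) := by
  rw [Submodule.Quotient.nontrivial_iff]
  intro htop
  apply hL
  rw [← LinearMap.ker_eq_top, ← top_le_iff, ← htop]
  exact twistedSpan_le_ker h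

end JacquetModules

/-! ### From an invariant form to one equivariant under the Klingen radical. -/

section KlingenStep

open ValuativeRel Filter Topology

variable {F E : Type*} [Field F] [Field E] [Algebra F E] {σ : E ≃ₐ[F] E} {m : ℕ}

theorem hPair_single {R : Type*} [CommRing R] (τ : R →+* R) (c : WIdx (m + 1) → R) :
    hPair τ (Pi.single (Sum.inl (Fin.last m)) 1) c = c (Sum.inr (Fin.last m)) := by
  rw [hPair_eq_sum, Finset.sum_eq_single (Fin.last m)]
  · simp
  · intro j _ hj; simp [hj]
  · simp

/-- The sum depends only on the coordinate of `c` given by its pairing with the vector that `h`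
fixes, and `h` preserves the pairing. -/
theorem mirabolicEmbedding_mul_radical (hσσ : ∀ x, σ (σ x) = x) (h : klingenP σ m)
    {u : klingenP σ (m + 1)} (hu : u.1 ∈ klingenRadical (σ : E →+* E) (m + 1)) :
    ∃ u' : klingenP σ (m + 1), u'.1 ∈ klingenRadical (σ : E →+* E) (m + 1) ∧
      mirabolicEmbedding (σ : E →+* E) m h * u = u' * mirabolicEmbedding (σ : E →+* E) m h ∧
      klingenSum u'.1.1 = klingenSum u.1.1 := by
  obtain ⟨c, z, hcz, hz⟩ := exists_eq_heis hu
  have hm : heis (σ : E →+* E) (h.1.1 *ᵥ c) z ∈ klingenRadical (σ : E →+* E) (m + 1) :=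
    heis_mem_klingenRadical hσσ (by rw [hPair_mulVec h.2.1, hz])
  refine ⟨⟨_, hm.1⟩, hm, ?_, ?_⟩
  · ext1
    rw [Subgroup.coe_mul, Subgroup.coe_mul, hcz]
    exact units_map_wExtend_mul_heis h.2.1 c z
  · have h1 : (h.1.1 *ᵥ c) (Sum.inr (Fin.last m)) = c (Sum.inr (Fin.last m)) := by
      rw [← hPair_single (σ : E →+* E) (h.1.1 *ᵥ c), ← hPair_single (σ : E →+* E) c,
        ← hPair_mulVec h.2.1 _ c, h.2.2]
    rw [hcz, klingenSum_heis, klingenSum_heis, h1]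

variable [ValuativeRel F] [TopologicalSpace F] [IsNonarchimedeanLocalField F] [TopologicalSpace E]
  [IsModuleTopology F E]

/-- A form on a distinguished representation of the Klingen mirabolic subgroup which is equivariant
under the radical and invariant under the smaller rational mirabolic subgroup. -/
theorem exists_radical_equivariant_form (hE : Module.finrank F E = 2) (hσ : σ ≠ 1) {d : F} {δ : E}
    (hd : δ ^ 2 = algebraMap F E d) (hδ : IntermediateField.adjoin F {δ} = ⊤)
    {ψ : AddChar F ℂ} (hψ : Continuous ψ) (hψ1 : ψ ≠ 1) {V : Type*} [AddCommGroup V] [Module ℂ V]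
    {π : Representation ℂ (klingenP σ (m + 1)) V} (hπ : IsSmoothRep π)
    (hdist : IsDistinguishedBy π ((klingenQ F E (m + 1)).subgroupOf (klingenP σ (m + 1)))) :
    ∃ L : V →ₗ[ℂ] ℂ, L ≠ 0 ∧
      ((∀ u : klingenP σ (m + 1), u.1 ∈ klingenRadical (σ : E →+* E) (m + 1) → ∀ v,
          L (π u v) = psiD ψ δ (klingenSum u.1.1) * L v) ∨
        (∀ u : klingenP σ (m + 1), u.1 ∈ klingenRadical (σ : E →+* E) (m + 1) → ∀ v,
          L (π u v) = L v)) ∧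
      ∀ h ∈ (klingenQ F E m).subgroupOf (klingenP σ m), ∀ v,
        L (π (mirabolicEmbedding (σ : E →+* E) m h) v) = L v := by
  obtain ⟨ℓ, hℓ, hℓQ⟩ := hdist
  have : FiniteDimensional F E := Module.finite_of_finrank_pos (by omega)
  have hσδ := conj_sqrt hσ hd hδ
  have hσσ := conj_conj_of_sqrt hσ hd hδ
  have h20 := two_ne_zero_of_sqrt hσ hd hδ
  have hδ0 := sqrt_ne_zero hσ hδ
  have hd0 : d ≠ 0 := by
    rintro rfl
    rw [map_zero] at hd
    exact hδ0 (pow_eq_zero_iff two_ne_zero |>.mp hd)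
  have h2F : (2 : F) ≠ 0 := fun h => h20 (by rw [← map_ofNat (algebraMap F E) 2, h, map_zero])
  set N := fun y : WIdx (m + 1) → F => skewHeis hσσ hσδ y
  have hNc : Continuous N := continuous_skewHeis hσσ hσδ
  have hN0 : N 0 = 1 := skewHeis_zero hσσ hσδ
  have hadd : ∀ y x v, ℓ (π (N y) (π (N x) v)) = ℓ (π (N (y + x)) v) := by
    intro y x v
    rw [← Module.End.mul_apply, ← map_mul, skewHeis_mul_skewHeis hσσ hσδ hd, map_mul,
      Module.End.mul_apply, hℓQ _ (ratHeis_mem hσσ hσδ _ _)]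
  have hlevi : ∀ g y v, ℓ (π (N (g.1.1 *ᵥ y)) (π (ratLevi σ (m + 1) g) v)) = ℓ (π (N y) v) := by
    intro g y v
    rw [← Module.End.mul_apply, ← map_mul, ← ratLevi_mul_skewHeis, map_mul,
      Module.End.mul_apply, hℓQ _ (ratLevi_mem g)]
  have hlevi' : ∀ g y v, ℓ (π (N y) (π (ratLevi σ (m + 1) g⁻¹) v)) =
      ℓ (π (N (g.1.1 *ᵥ y)) v) := by
    intro g y v
    rw [← hlevi g y, ← Module.End.mul_apply (π (ratLevi σ (m + 1) g)), ← map_mul, ← map_mul,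
      mul_inv_cancel, map_one, map_one, Module.End.one_apply]
  -- The rational factor commutes past the skew elements and is absorbed by `ℓ`, so every element of
  -- the radical acts by a translation.
  have hrad : ∀ u : klingenP σ (m + 1), u.1 ∈ klingenRadical (σ : E →+* E) (m + 1) →
      ∃ x : WIdx (m + 1) → F, (∀ v y, ℓ (π (N y) (π u v)) = ℓ (π (N (y + x)) v)) ∧
        klingenSum u.1.1 = 2 * δ * algebraMap F E (x (Sum.inr (Fin.last m))) := by
    intro u hu
    obtain ⟨x, y, z, rfl⟩ := exists_eq_ratHeis_mul_skewHeis hσσ hσδ hE hσ hd hδ hu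
    refine ⟨y, fun v y' => ?_, klingenSum_ratHeis_mul_skewHeis hσσ hσδ x y z⟩
    rw [← hadd, map_mul, Module.End.mul_apply, ← Module.End.mul_apply (π (N y')), ← map_mul,
      skewHeis_mul_ratHeis, map_mul, Module.End.mul_apply, hℓQ _ (ratHeis_mem hσσ hσδ _ _)]
  let Φ : V →ₗ[ℂ] (WIdx (m + 1) → F) → ℂ := LinearMap.pi fun y => ℓ.comp (π (N y))
  have hΦ : ∀ v y, Φ v y = ℓ (π (N y) v) := fun v y => rfl
  have hstab : ∀ v, {g | π g v = v} ∈ 𝓝 (1 : klingenP σ (m + 1)) := fun v =>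
    (hπ v).mem_nhds (by simp)
  have h₁ : ∀ v, ∃ γ : ValueGroupWithZero F, γ ≠ 0 ∧
      ∀ y, ∀ y' ∈ valBox F (WIdx (m + 1)) γ, Φ v (y + y') = Φ v y := by
    intro v
    have h1 : N ⁻¹' {g | π g v = v} ∈ 𝓝 0 :=
      hNc.continuousAt.preimage_mem_nhds (by rw [hN0]; exact hstab v)
    obtain ⟨γ, hγ, hsub⟩ := exists_valBox_subset h1
    refine ⟨γ, hγ, fun y y' hy' => ?_⟩
    have h2 : π (N y') v = v := hsub hy'
    rw [hΦ, ← hadd, h2, hΦ]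
  have h₂ : ∀ v, ∃ ε : ValueGroupWithZero F, ε ≠ 0 ∧ IsSmallInvariant ε (Φ v) := by
    intro v
    obtain ⟨ε, hε, hsub⟩ := exists_smallTransvection_mem (hstab v)
    refine ⟨ε, hε, fun t b htb y => ?_⟩
    have h2 : π (ratLevi σ (m + 1) ⟨wTransvection t b, wTransvection_mem t b⟩) v = v := hsub t b htb
    have h3 := hlevi ⟨wTransvection t b, wTransvection_mem t b⟩ y v
    rw [h2] at h3
    exact h3
  have h₃ : ∀ g ∈ isometryGroup (RingHom.id F) (m + 1), ∀ v, ∃ v', ∀ y,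
      Φ v' y = Φ v (g.1 *ᵥ y) :=
    fun g hg v => ⟨π (ratLevi σ (m + 1) ⟨g, hg⟩⁻¹) v, fun y => hlevi' ⟨g, hg⟩ y v⟩
  -- The factor `2 d` makes `⟨a, x⟩` equal to `δ` times the Klingen sum `2 δ x_f`, where `x_f` is
  -- the last `f`-coordinate, since `δ ^ 2 = d`.
  have ha : (Pi.single (Sum.inl (Fin.last m)) (2 * d) : WIdx (m + 1) → F) ≠ 0 := by
    simpa using ⟨h2F, hd0⟩
  have hQ : ∀ h ∈ (klingenQ F E m).subgroupOf (klingenP σ m),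
      ∃ g : isometryGroup (RingHom.id F) (m + 1),
        mirabolicEmbedding (σ : E →+* E) m h = ratLevi σ (m + 1) g ∧
        g.1.1 *ᵥ Pi.single (Sum.inl (Fin.last m)) 1 = Pi.single (Sum.inl (Fin.last m)) 1 := by
    rintro h ⟨g, hg, hgh⟩
    refine ⟨⟨g, hg.1⟩, ?_, hg.2⟩
    ext1
    rw [ratLevi_val, hgh]
    rfl
  rcases const_or_exists_equivariant_form hψ hψ1 Φ h₁ h₂ h₃ ha with
    hconst | ⟨L, hL, hLN, hLQ⟩
  · refine ⟨ℓ, hℓ, Or.inr fun u hu v => ?_, fun h hh v => ?_⟩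
    · obtain ⟨x, hx, -⟩ := hrad u hu
      have h1 := hx v 0
      rw [← hΦ v, hconst, hΦ, hN0] at h1
      simpa using h1
    · obtain ⟨g, hg, -⟩ := hQ h hh
      rw [hg, hℓQ _ (ratLevi_mem g)]
  · refine ⟨L, hL, Or.inl fun u hu v => ?_, fun h hh v => ?_⟩
    · obtain ⟨x, hx, hsum⟩ := hrad u hu
      rw [hLN v (π u v) x (fun y => hx v y), hsum, psiD]
      congr 2
      have h1 : wPair (Pi.single (Sum.inl (Fin.last m)) (2 * d)) x =
          2 * d * x (Sum.inr (Fin.last m)) := by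
        rw [wPair_eq_sum, Finset.sum_eq_single (Fin.last m)]
        · simp
        · intro j _ hj; simp [hj]
        · simp
      have h2 : δ * (2 * δ * algebraMap F E (x (Sum.inr (Fin.last m)))) =
          algebraMap F E (2 * d * x (Sum.inr (Fin.last m))) := by
        rw [map_mul, map_mul, ← hd, map_ofNat]; ring
      rw [h1, h2, Function.leftInverse_invFun (algebraMap F E).injective]
    · obtain ⟨g, hg, hge⟩ := hQ h hh
      have hga : g.1.1 *ᵥ (Pi.single (Sum.inl (Fin.last m)) (2 * d)) =
          Pi.single (Sum.inl (Fin.last m)) (2 * d) := by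
        have : (Pi.single (Sum.inl (Fin.last m)) (2 * d) : WIdx (m + 1) → F) =
            (2 * d) • Pi.single (Sum.inl (Fin.last m)) 1 := by
          rw [← Pi.single_smul, smul_eq_mul, mul_one]
        rw [this, Matrix.mulVec_smul, hge]
      rw [hg]
      refine (hLQ (π (ratLevi σ (m + 1) g) v) v g.1 g.2 hga fun y => ?_).symm
      exact (hlevi g y v).symm

end KlingenStep

/-! ### Descent to the twisted Jacquet module. -/

section Descent

open ValuativeRel Filter Topology

variable {F E : Type*} [Field F] [ValuativeRel F] [TopologicalSpace F]
  [IsNonarchimedeanLocalField F] [Field E] [Algebra F E] [TopologicalSpace E] [IsModuleTopology F E]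
  {σ : E ≃ₐ[F] E}

/-- The equivariant form factors through the quotient. The smaller mirabolic acts there because
conjugation by it preserves the Klingen sum, hence the character. -/
theorem exists_distinguished_twistedJacquet (hE : Module.finrank F E = 2) (hσ : σ ≠ 1)
    {d : F} {δ : E} (hd : δ ^ 2 = algebraMap F E d)
    (hδ : IntermediateField.adjoin F {δ} = ⊤) {ψ : AddChar F ℂ} (hψ : Continuous ψ) (hψ1 : ψ ≠ 1)
    {m : ℕ} {V : Type*} [AddCommGroup V] [Module ℂ V]
    (π : Representation ℂ (klingenP σ (m + 1)) V) (hπ : IsSmoothRep π)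
    (hdist : IsDistinguishedBy π ((klingenQ F E (m + 1)).subgroupOf (klingenP σ (m + 1)))) :
    ∃ μ : (klingenRadical (σ : E →+* E) (m + 1)).subgroupOf (klingenP σ (m + 1)) →* ℂˣ,
      ((∀ u, (μ u : ℂ) = psiD ψ δ (klingenSum u.1.1.1)) ∨ μ = 1) ∧
      ∃ ρ : Representation ℂ (klingenP σ m) (TwistedJacquet π _ μ),
        (∀ h v, ρ h (Submodule.Quotient.mk v) =
          Submodule.Quotient.mk (π (mirabolicEmbedding (σ : E →+* E) m h) v)) ∧
        IsSmoothRep ρ ∧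
        IsDistinguishedBy ρ ((klingenQ F E m).subgroupOf (klingenP σ m)) := by
  have : FiniteDimensional F E := Module.finite_of_finrank_pos (by omega)
  have : IsTopologicalRing E := IsModuleTopology.isTopologicalRing F E
  obtain ⟨L, hL, hN, hLQ⟩ := exists_radical_equivariant_form hE hσ hd hδ hψ hψ1 hπ hdist
  have hσσ := conj_conj_of_sqrt hσ hd hδ
  obtain ⟨μ, hμ, hμL, hμc⟩ :
      ∃ μ : (klingenRadical (σ : E →+* E) (m + 1)).subgroupOf (klingenP σ (m + 1)) →* ℂˣ,
        ((∀ u, (μ u : ℂ) = psiD ψ δ (klingenSum u.1.1.1)) ∨ μ = 1) ∧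
        (∀ u v, L (π u.1 v) = (μ u : ℂ) * L v) ∧
        (∀ u u', klingenSum u'.1.1.1 = klingenSum u.1.1.1 → μ u' = μ u) := by
    rcases hN with h | h
    · obtain ⟨μ, hμ⟩ := exists_character_of_form (π := π)
        (N := (klingenRadical (σ : E →+* E) (m + 1)).subgroupOf (klingenP σ (m + 1)))
        (c := fun u => psiD ψ δ (klingenSum u.1.1.1)) hL fun u v => h u.1 u.2 v
      refine ⟨μ, Or.inl hμ, fun u v => ?_, fun u u' huu' => ?_⟩
      · rw [hμ, h u.1 u.2]
      · ext1; rw [hμ, hμ, huu']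
    · exact ⟨1, Or.inr rfl, fun u v => by simp [h u.1 u.2], fun _ _ _ => rfl⟩
  obtain ⟨ρ, hρ⟩ := exists_rep_twistedJacquet π _ μ (mirabolicEmbedding (σ : E →+* E) m) (by
    intro h u
    obtain ⟨u', hu', h1, h2⟩ := mirabolicEmbedding_mul_radical hσσ h u.2
    exact ⟨⟨u', hu'⟩, h1, hμc _ _ h2⟩)
  refine ⟨μ, hμ, ρ, hρ, isSmoothRep_of_mem_nhds fun x => ?_, ?_⟩
  · obtain ⟨v, rfl⟩ := Submodule.Quotient.mk_surjective _ x
    have h1 := (hπ.comp (continuous_mirabolicEmbedding (σ : E →+* E)) v).mem_nhds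
      (x := (1 : klingenP σ m)) (by simp)
    filter_upwards [h1] with h hh
    rw [hρ]
    exact congrArg _ hh
  · refine ⟨Submodule.liftQ _ L (twistedSpan_le_ker hμL), fun h0 => hL ?_, fun h hh x => ?_⟩
    · ext v
      exact LinearMap.congr_fun h0 (Submodule.Quotient.mk v)
    · obtain ⟨v, rfl⟩ := Submodule.Quotient.mk_surjective _ x
      rw [hρ]
      exact hLQ h hh v

end Descent

/-! ### Continuity of characters, and transport to conjugate subgroups. -/

section Continuity

open Filter Topology

/-- A character through which a subgroup acts on some nonzero value of a form on a smooth
representation is continuous. -/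
theorem continuous_character_of_form {G V : Type*} [Group G] [TopologicalSpace G]
    [IsTopologicalGroup G] [AddCommGroup V] [Module ℂ V] {π : Representation ℂ G V}
    (hπ : IsSmoothRep π) {N : Subgroup G} {θ : N →* ℂˣ} {L : V →ₗ[ℂ] ℂ} (hL : L ≠ 0)
    (h : ∀ (u : N) v, L (π u.1 v) = (θ u : ℂ) * L v) : Continuous θ := by
  obtain ⟨v, hv⟩ : ∃ v, L v ≠ 0 := by
    by_contra! h0
    exact hL (LinearMap.ext h0)
  refine continuous_of_continuousAt_one θ (ContinuousAt.congr (f := fun _ => 1) continuousAt_const ?_)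
  have h1 : (fun u : N => u.1) ⁻¹' {g | π g v = v} ∈ 𝓝 1 :=
    continuous_subtype_val.continuousAt.preimage_mem_nhds ((hπ v).mem_nhds (by simp))
  filter_upwards [h1] with u hu
  have h2 := h u v
  rw [show π u.1 v = v from hu] at h2
  ext
  exact (mul_right_cancel₀ hv (by rw [← h2, Units.val_one, one_mul])).symm

theorem exists_nontrivial_twistedJacquet_of_conj {G V : Type*} [Group G] [TopologicalSpace G]
    [IsTopologicalGroup G] [AddCommGroup V] [Module ℂ V] {π : Representation ℂ G V}
    (hπ : IsSmoothRep π) {N : Subgroup G} {c : G → ℂ} {ℓ : V →ₗ[ℂ] ℂ} (hℓ : ℓ ≠ 0)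
    (h : ∀ u ∈ N, ∀ v, ℓ (π u v) = c u * ℓ v) (g : G) :
    ∃ θ : N.map (MulAut.conj g).toMonoidHom →* ℂˣ,
      Continuous θ ∧ Nontrivial (TwistedJacquet π (N.map (MulAut.conj g).toMonoidHom) θ) := by
  have hL : ℓ ∘ₗ π g⁻¹ ≠ 0 := fun h0 => hℓ <| by
    ext v
    simpa using LinearMap.congr_fun h0 (π g v)
  have hform : ∀ u ∈ N.map (MulAut.conj g).toMonoidHom, ∀ v,
      (ℓ ∘ₗ π g⁻¹) (π u v) = c (g⁻¹ * u * g) * (ℓ ∘ₗ π g⁻¹) v := by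
    rintro _ ⟨u, hu, rfl⟩ v
    have h1 : g⁻¹ * (MulAut.conj g).toMonoidHom u = u * g⁻¹ := by
      simp [mul_assoc]
    rw [h1, LinearMap.comp_apply, LinearMap.comp_apply, ← Module.End.mul_apply, ← map_mul, h1,
      map_mul, Module.End.mul_apply, inv_mul_cancel_right]
    exact h u hu _
  obtain ⟨θ, hθ⟩ := exists_character_of_form hL fun u v => hform u.1 u.2 v
  have h2 : ∀ (u : N.map (MulAut.conj g).toMonoidHom) v,
      (ℓ ∘ₗ π g⁻¹) (π u.1 v) = (θ u : ℂ) * (ℓ ∘ₗ π g⁻¹) v := fun u v => by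
    rw [hform u.1 u.2, hθ]
  exact ⟨θ, continuous_character_of_form hπ hL h2, nontrivial_twistedJacquet hL h2⟩

end Continuity

/-! ### Decomposing upper unipotent matrices along the Klingen radical. -/

section UpperUnipotent

open Filter Topology

variable {F E : Type*} [Field F] [Field E] [Algebra F E] {σ : E ≃ₐ[F] E} {δ : E}

theorem psiD_zero (ψ : AddChar F ℂ) : psiD ψ δ 0 = 1 := by
  have h : Function.invFun (algebraMap F E) 0 = 0 := by
    rw [← map_zero (algebraMap F E), Function.leftInverse_invFun (algebraMap F E).injective]
  rw [psiD, mul_zero, h, AddChar.map_zero_eq_one]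

/-- Trace zero guarantees that the arguments of `Function.invFun` lie in the image of `F`, where it
is a genuine inverse. -/
theorem psiD_add (h2 : Module.finrank F E = 2) (hσ : σ ≠ 1) {d : F}
    (hd : δ ^ 2 = algebraMap F E d) (hδ : IntermediateField.adjoin F {δ} = ⊤)
    (ψ : AddChar F ℂ) {e e' : E} (he : σ e = -e) (he' : σ e' = -e') :
    psiD ψ δ (e + e') = psiD ψ δ e * psiD ψ δ e' := by
  rw [psiD, psiD, psiD, ← AddChar.map_add_eq_mul]
  congr 1
  apply (algebraMap F E).injective
  rw [map_add, algebraMap_invFun_mul h2 hσ hd hδ he, algebraMap_invFun_mul h2 hσ hd hδ he',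
    algebraMap_invFun_mul h2 hσ hd hδ (by rw [map_add, he, he']; ring), mul_add]

theorem conj_klingenSum (hσσ : ∀ x, σ (σ x) = x) {m : ℕ} {u : GL (WIdx (m + 2)) E}
    (hu : u ∈ klingenRadical (σ : E →+* E) (m + 1)) : σ (klingenSum u.1) = -klingenSum u.1 := by
  obtain ⟨c, z, rfl, -⟩ := exists_eq_heis hu
  rw [klingenSum_heis, map_sub, hσσ]
  ring

theorem upperUnipotent_one_le_klingenRadical {R : Type*} [CommRing R] (τ : R →+* R) :
    upperUnipotent τ 1 ≤ klingenRadical τ 0 := by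
  intro u hu
  refine ⟨upperUnipotent_le_klingenMirabolic τ 0 hu, fun a b ha hb => hu.2 a b ?_⟩
  rcases a with a | a
  · exact absurd (congrArg Sum.inl (Fin.eq_zero a)) ha
  · rcases b with b | b
    · simp [wPos]
    · exact absurd (congrArg Sum.inr (Fin.eq_zero b)) hb

theorem wPos_wSplit_symm {k : ℕ} (w : WIdx k) : wPos ((wSplit k).symm (Sum.inl w)) = wPos w := by
  rcases w with w | w
  · rw [(Equiv.symm_apply_eq _).mpr (wSplit_values k w).1.symm]; simp [wPos]
  · rw [(Equiv.symm_apply_eq _).mpr (wSplit_values k w).2.1.symm]; simp [wPos]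

/-- Since `J ^ 2 = -1`, the Gram identity exhibits `-J (τ M)ᵀ J` as an inverse of `M`. -/
theorem exists_isometry_of_eq {R : Type*} [CommRing R] {τ : R →+* R} {k : ℕ}
    {M : Matrix (WIdx k) (WIdx k) R} (h : (M.map τ)ᵀ * wForm k R * M = wForm k R) :
    ∃ g : isometryGroup τ k, g.1.1 = M := by
  have h1 : (-(wForm k R * (M.map τ)ᵀ * wForm k R)) * M = 1 := by
    rw [Matrix.neg_mul, Matrix.mul_assoc (wForm k R), Matrix.mul_assoc (wForm k R), h]
    simp [wForm, Matrix.fromBlocks_multiply, Matrix.fromBlocks_neg, Matrix.fromBlocks_one]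
  exact ⟨⟨⟨M, _, mul_eq_one_comm.mp h1, h1⟩, h⟩, rfl⟩

theorem isometry_of_klingenBlock {R : Type*} [CommRing R] {τ : R →+* R} {k : ℕ}
    {M : Matrix (WIdx k) (WIdx k) R} {c r : WIdx k → R} {z : R}
    (h : ((klingenBlock M c r z).map τ)ᵀ * wForm (k + 1) R * klingenBlock M c r z =
      wForm (k + 1) R) : (M.map τ)ᵀ * wForm k R * M = wForm k R := by
  rw [wForm_succ, klingenBlock, ← Matrix.submatrix_map, Matrix.transpose_submatrix,
    Matrix.submatrix_mul_equiv, Matrix.submatrix_mul_equiv, Matrix.fromBlocks_map,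
    Matrix.fromBlocks_transpose, Matrix.fromBlocks_multiply, Matrix.fromBlocks_multiply] at h
  ext i j
  have := congrFun (congrFun h ((wSplit k).symm (Sum.inl i))) ((wSplit k).symm (Sum.inl j))
  simpa [Matrix.mul_apply] using this

theorem klingenBlock_one_apply {R : Type*} [CommRing R] {k : ℕ} (c r : WIdx k → R) (z : R)
    {a b : WIdx (k + 1)} (ha : a ≠ Sum.inl (Fin.last k)) (hb : b ≠ Sum.inr (Fin.last k)) :
    klingenBlock 1 c r z a b = (1 : Matrix (WIdx (k + 1)) (WIdx (k + 1)) R) a b := by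
  obtain ⟨s, rfl⟩ := (wSplit k).symm.surjective a
  obtain ⟨t, rfl⟩ := (wSplit k).symm.surjective b
  rw [klingenBlock_apply_symm]
  rcases s with s | s | s
  · rcases t with t | t | t
    · simp [Matrix.one_apply]
    · simp
    · exact absurd wSplit_symm_f hb
  · exact absurd wSplit_symm_e ha
  · rcases t with t | t | t
    · simp
    · simp
    · exact absurd wSplit_symm_f hb

theorem exists_eq_klingenBlock_of_upperUnipotent {R : Type*} [CommRing R] {τ : R →+* R} {k : ℕ}
    {u : GL (WIdx (k + 1)) R} (hu : u ∈ upperUnipotent τ (k + 1)) :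
    ∃ M c r z, u.1 = klingenBlock M c r z := by
  have hf : ∀ s, u.1 (Sum.inr (Fin.last k)) s =
      (1 : Matrix (WIdx (k + 1)) (WIdx (k + 1)) R) (Sum.inr (Fin.last k)) s := fun s =>
    hu.2 _ _ (by rcases s with s | s <;> simp [wPos] <;> omega)
  refine ⟨Matrix.of fun i j => u.1 ((wSplit k).symm (Sum.inl i)) ((wSplit k).symm (Sum.inl j)),
    fun w => u.1 ((wSplit k).symm (Sum.inl w)) (Sum.inr (Fin.last k)),
    fun w => u.1 (Sum.inl (Fin.last k)) ((wSplit k).symm (Sum.inl w)),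
    u.1 (Sum.inl (Fin.last k)) (Sum.inr (Fin.last k)), ?_⟩
  ext a b
  obtain ⟨s, rfl⟩ := (wSplit k).symm.surjective a
  obtain ⟨t, rfl⟩ := (wSplit k).symm.surjective b
  rw [klingenBlock_apply_symm]
  rcases t with t | t | t
  · rcases s with s | s | s
    · simp
    · rw [wSplit_symm_e]; simp
    · rw [wSplit_symm_f, hf, ← wSplit_symm_f]; simp
  · rw [wSplit_symm_e, klingenMirabolic_col (upperUnipotent_le_klingenMirabolic τ k hu),
      ← wSplit_symm_e]
    rcases s with s | s | s <;> simp
  · rw [wSplit_symm_f]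
    rcases s with s | s | s
    · simp
    · rw [wSplit_symm_e]; simp
    · rw [wSplit_symm_f, hf]; simp

theorem klingenSum_klingenBlock {m : ℕ} (M : Matrix (WIdx (m + 1)) (WIdx (m + 1)) E)
    (c r : WIdx (m + 1) → E) (z : E) : klingenSum (klingenBlock M c r z) =
      r (Sum.inl (Fin.last m)) + c (Sum.inr (Fin.last m)) := by
  simp [klingenSum, klingenBlock, wSplit]

theorem superdiagSum_klingenBlock {m : ℕ} (ε : Fin (m + 1) → E)
    (M : Matrix (WIdx (m + 1)) (WIdx (m + 1)) E) (c r : WIdx (m + 1) → E) (z : E) :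
    superdiagSum ε (klingenBlock M c r z) = superdiagSum (fun j => ε j.castSucc) M +
      ε (Fin.last m) * klingenSum (klingenBlock M c r z) := by
  rw [superdiagSum, Fin.sum_univ_castSucc]
  congr 1
  refine Finset.sum_congr rfl fun j _ => ?_
  have h : j.castSucc.succ = j.succ.castSucc := rfl
  simp only [klingenBlock, Matrix.submatrix_apply, h, (wSplit_values (m + 1) _).1,
    (wSplit_values (m + 1) _).2.1, Matrix.fromBlocks_apply₁₁]

/-- An upper triangular unipotent matrix is the product of an element of the Klingen radical and an
upper triangular unipotent matrix of smaller size. -/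
theorem exists_radical_mul_unipotent {m : ℕ} {u : klingenP σ (m + 1)}
    (hu : u.1 ∈ upperUnipotent (σ : E →+* E) (m + 2)) :
    ∃ (n : klingenP σ (m + 1)) (u' : klingenP σ m),
      n.1 ∈ klingenRadical (σ : E →+* E) (m + 1) ∧
      u'.1 ∈ upperUnipotent (σ : E →+* E) (m + 1) ∧
      u = n * mirabolicEmbedding (σ : E →+* E) m u' ∧
      klingenSum u.1.1 = klingenSum n.1.1 ∧
      ∀ ε : Fin (m + 1) → E, superdiagSum ε u.1.1 =
        superdiagSum (fun j => ε j.castSucc) u'.1.1 + ε (Fin.last m) * klingenSum u.1.1 := by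
  obtain ⟨M, c, r, z, hM⟩ := exists_eq_klingenBlock_of_upperUnipotent hu
  have h1 := mem_isometryGroup.mp hu.1
  rw [hM] at h1
  obtain ⟨g, hg⟩ := exists_isometry_of_eq (isometry_of_klingenBlock h1)
  have hgu : g.1 ∈ upperUnipotent (σ : E →+* E) (m + 1) := by
    refine ⟨g.2, fun a b hab => ?_⟩
    have h2 := hu.2 ((wSplit (m + 1)).symm (Sum.inl a)) ((wSplit (m + 1)).symm (Sum.inl b))
      (by rwa [wPos_wSplit_symm, wPos_wSplit_symm])
    rw [hM, klingenBlock_apply_symm] at h2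
    rw [hg]
    simpa [Matrix.one_apply] using h2
  let u' : klingenP σ m := ⟨g.1, upperUnipotent_le_klingenMirabolic _ _ hgu⟩
  have hM' : M * (u'⁻¹).1.1 = 1 := by
    rw [← hg]
    exact congrArg Units.val (mul_inv_cancel g.1)
  have hn : (u * (mirabolicEmbedding (σ : E →+* E) m u')⁻¹).1.1 =
      klingenBlock 1 c (r ᵥ* (u'⁻¹).1.1) z := by
    rw [← map_inv, Subgroup.coe_mul, Units.val_mul, hM]
    change _ * wExtend (m + 1) E (u'⁻¹).1.1 = _
    rw [wExtend_eq, klingenBlock_mul, hM']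
    simp
  refine ⟨u * (mirabolicEmbedding (σ : E →+* E) m u')⁻¹, u', ⟨Subtype.prop _, fun a b ha hb => ?_⟩,
    hgu, by simp, ?_, fun ε => ?_⟩
  · rw [hn, klingenBlock_one_apply _ _ _ ha hb]
  -- The inverse of `u'` fixes the corresponding basis vector, so its column there is trivial and
  -- this row entry is unchanged.
  · have h3 : (r ᵥ* (u'⁻¹).1.1) (Sum.inl (Fin.last m)) = r (Sum.inl (Fin.last m)) := by
      have h4 := klingenMirabolic_col (u'⁻¹).2
      generalize (u'⁻¹).1.1 = X at h4 ⊢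
      rw [Matrix.vecMul, dotProduct]
      simp only [h4, Matrix.one_apply, mul_ite, mul_one, mul_zero, Finset.sum_ite_eq',
        Finset.mem_univ, if_true]
    rw [hn, hM, klingenSum_klingenBlock, klingenSum_klingenBlock, h3]
  · rw [hM, superdiagSum_klingenBlock]
    change _ = superdiagSum _ g.1.1 + _
    rw [hg]

end UpperUnipotent

/-! ### Induction on the rank, and the unitary group. -/

section UnipotentForms

open ValuativeRel Filter Topology

variable {F E : Type*} [Field F] [ValuativeRel F] [TopologicalSpace F]
  [IsNonarchimedeanLocalField F] [Field E] [Algebra F E] [TopologicalSpace E] [IsModuleTopology F E]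
  {σ : E ≃ₐ[F] E}

theorem exists_unipotent_equivariant_form (hE : Module.finrank F E = 2) (hσ : σ ≠ 1)
    {d : F} {δ : E} (hd : δ ^ 2 = algebraMap F E d)
    (hδ : IntermediateField.adjoin F {δ} = ⊤) {ψ : AddChar F ℂ} (hψ : Continuous ψ) (hψ1 : ψ ≠ 1)
    (n : ℕ) {V : Type*} [AddCommGroup V] [Module ℂ V]
    (π : Representation ℂ (klingenP σ n) V) (hπ : IsSmoothRep π)
    (hdist : IsDistinguishedBy π ((klingenQ F E n).subgroupOf (klingenP σ n))) :
    ∃ ε : Fin n → E, (∀ j, ε j = 0 ∨ ε j = 1) ∧ ∃ ℓ : V →ₗ[ℂ] ℂ, ℓ ≠ 0 ∧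
      ∀ u : klingenP σ n, u.1 ∈ upperUnipotent (σ : E →+* E) (n + 1) → ∀ v,
        ℓ (π u v) = psiD ψ δ (superdiagSum ε u.1.1) * ℓ v := by
  have hσσ := conj_conj_of_sqrt hσ hd hδ
  induction n generalizing V with
  | zero =>
    obtain ⟨ℓ, hℓ, hℓQ⟩ := hdist
    refine ⟨0, fun j => Or.inl rfl, ℓ, hℓ, fun u hu v => ?_⟩
    have h0 : superdiagSum (0 : Fin 0 → E) u.1.1 = 0 := by simp [superdiagSum]
    obtain ⟨x, y, z, rfl⟩ := exists_eq_ratHeis_mul_skewHeis hσσ (conj_sqrt hσ hd hδ) hE hσ hd hδ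
      (upperUnipotent_one_le_klingenRadical _ hu)
    -- In the lowest rank the space `W_0` is zero, so the skew factor is trivial and the unipotent
    -- group is rational.
    rw [h0, psiD_zero, one_mul, Subsingleton.elim y 0, skewHeis_zero, mul_one,
      hℓQ _ (ratHeis_mem hσσ (conj_sqrt hσ hd hδ) _ _)]
  | succ m ih =>
    obtain ⟨μ, hμ, ρ, hρ, hρs, hρd⟩ :=
      exists_distinguished_twistedJacquet hE hσ hd hδ hψ hψ1 π hπ hdist
    obtain ⟨ε, hε, ℓ, hℓ, hℓu⟩ := ih ρ hρs hρd
    obtain ⟨t, ht, hμt⟩ : ∃ t : E, (t = 0 ∨ t = 1) ∧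
        ∀ u, (μ u : ℂ) = psiD ψ δ (t * klingenSum u.1.1.1) := by
      rcases hμ with h | rfl
      · exact ⟨1, Or.inr rfl, fun u => by rw [h, one_mul]⟩
      · exact ⟨0, Or.inl rfl, fun u => by rw [zero_mul, psiD_zero]; rfl⟩
    -- The last coefficient belongs to the outermost superdiagonal entries, those seen by the
    -- Klingen radical. The form is pulled back from the Jacquet module.
    refine ⟨Fin.snoc ε t, fun j => ?_, ℓ ∘ₗ (twistedSpan π _ μ).mkQ, fun h0 => hℓ ?_,
      fun u hu v => ?_⟩
    · refine Fin.lastCases ?_ (fun i => ?_) j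
      · simpa using ht
      · simpa using hε i
    · ext v
      exact LinearMap.congr_fun h0 v
    · obtain ⟨w, u', hw, hu', rfl, hsum, hsuper⟩ := exists_radical_mul_unipotent hu
      have h1 : ∀ v', (Submodule.Quotient.mk (π w v') : TwistedJacquet π _ μ) =
          (μ ⟨w, hw⟩ : ℂ) • Submodule.Quotient.mk v' := fun v' => by
        rw [← Submodule.Quotient.mk_smul, Submodule.Quotient.eq]
        exact Submodule.subset_span ⟨⟨w, hw⟩, v', rfl⟩
      have h2 : (fun j : Fin m => (Fin.snoc ε t : Fin (m + 1) → E) j.castSucc) = ε := by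
        ext j; simp
      have h3 : σ (t * klingenSum w.1.1) = -(t * klingenSum w.1.1) := by
        rcases ht with rfl | rfl
        · simp
        · rw [one_mul, conj_klingenSum hσσ hw]
      rw [hsuper, h2, Fin.snoc_last, hsum,
        psiD_add hE hσ hd hδ ψ (conj_superdiagSum hσ hd hδ hε hu') h3, ← hμt ⟨w, hw⟩]
      rw [map_mul, Module.End.mul_apply, LinearMap.comp_apply, Submodule.mkQ_apply, h1, map_smul,
        ← hρ, hℓu u' hu', smul_eq_mul, LinearMap.comp_apply, Submodule.mkQ_apply]
      ring

/-- Restricted to the mirabolic, the representation is still smooth and distinguished, and the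
mirabolic contains the standard unipotent radical. The resulting form is carried to any conjugate
radical. -/
theorem exists_nontrivial_twistedJacquet (hE : Module.finrank F E = 2) (hσ : σ ≠ 1)
    {d : F} {δ : E} (hd : δ ^ 2 = algebraMap F E d)
    (hδ : IntermediateField.adjoin F {δ} = ⊤) {ψ : AddChar F ℂ} (hψ : Continuous ψ) (hψ1 : ψ ≠ 1)
    {n : ℕ} {V : Type*} [AddCommGroup V] [Module ℂ V]
    (π : Representation ℂ (unitaryW σ (n + 1)) V) (hπ : IsSmoothRep π)
    (hdist : IsDistinguishedBy π ((symplecticW F E (n + 1)).subgroupOf (unitaryW σ (n + 1))))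
    {U : Subgroup (unitaryW σ (n + 1))} (hU : IsMinimalParabolicRadical σ U) :
    ∃ θ : U →* ℂˣ, Continuous θ ∧ Nontrivial (TwistedJacquet π U θ) := by
  have : FiniteDimensional F E := Module.finite_of_finrank_pos (by omega)
  have : IsTopologicalRing E := IsModuleTopology.isTopologicalRing F E
  obtain ⟨ℓ₀, hℓ₀, hℓ₀Q⟩ := hdist
  set ι := Subgroup.inclusion (klingenMirabolic_le (σ : E →+* E) n)
  have hι : Continuous ι := continuous_subtype_val.subtype_mk _
  obtain ⟨ε, -, ℓ, hℓ, hℓu⟩ := exists_unipotent_equivariant_form hE hσ hd hδ hψ hψ1 n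
    (MonoidHom.comp π ι) (hπ.comp hι) ⟨ℓ₀, hℓ₀, by
      rintro h ⟨g, hg, hgh⟩ v
      exact hℓ₀Q (ι h) ⟨g, hg.1, hgh⟩ v⟩
  obtain ⟨g, rfl⟩ := hU
  exact exists_nontrivial_twistedJacquet_of_conj hπ (c := fun u => psiD ψ δ (superdiagSum ε u.1.1))
    hℓ (fun u hu v => hℓu ⟨u.1, upperUnipotent_le_klingenMirabolic _ _ hu⟩ hu v) g

end UnipotentForms
theorem mainTheorem7
    {F E : Type*} [Field F] [ValuativeRel F] [TopologicalSpace F] [IsNonarchimedeanLocalField F]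
    [Field E] [Algebra F E] [TopologicalSpace E] [IsModuleTopology F E]
    (hE : Module.finrank F E = 2) (σ : E ≃ₐ[F] E) (hσ : σ ≠ 1)
    (d : F) (δ : E) (hd : δ ^ 2 = algebraMap F E d)
    (hδ : IntermediateField.adjoin F {δ} = ⊤)
    (ψ : AddChar F ℂ) (hψ : Continuous ψ) (hψ1 : ψ ≠ 1)
    (n : ℕ) {V : Type*} [AddCommGroup V] [Module ℂ V] :
    -- the passage from `W_{n+2}` to `W_{n+1}`
    (∀ π : Representation ℂ (klingenP σ (n + 1)) V, IsSmoothRep π →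
      IsDistinguishedBy π ((klingenQ F E (n + 1)).subgroupOf (klingenP σ (n + 1))) →
      ∃ μ : (klingenRadical (σ : E →+* E) (n + 1)).subgroupOf (klingenP σ (n + 1)) →* ℂˣ,
        ((∀ u, (μ u : ℂ) = psiD ψ δ (klingenSum u.1.1.1)) ∨ μ = 1) ∧
        ∃ ρ : Representation ℂ (klingenP σ n) (TwistedJacquet π _ μ),
          (∀ h v, ρ h (Submodule.Quotient.mk v) =
            Submodule.Quotient.mk (π (mirabolicEmbedding (σ : E →+* E) n h) v)) ∧
          IsSmoothRep ρ ∧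
          IsDistinguishedBy ρ ((klingenQ F E n).subgroupOf (klingenP σ n))) ∧
    -- the linear form for the upper triangular unipotent group of `U(W_{n+1} ⊗ E)`
    (∀ π : Representation ℂ (klingenP σ n) V, IsSmoothRep π →
      IsDistinguishedBy π ((klingenQ F E n).subgroupOf (klingenP σ n)) →
      ∃ ε : Fin n → E, (∀ j, ε j = 0 ∨ ε j = 1) ∧
        ∃ μ : (upperUnipotent (σ : E →+* E) (n + 1)).subgroupOf (klingenP σ n) →* ℂˣ,
          (∀ u, (μ u : ℂ) = psiD ψ δ (superdiagSum ε u.1.1.1)) ∧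
          ∃ ℓ : V →ₗ[ℂ] ℂ, ℓ ≠ 0 ∧
            ∀ (u : (upperUnipotent (σ : E →+* E) (n + 1)).subgroupOf (klingenP σ n)) (v : V),
              ℓ (π u.1 v) = (μ u : ℂ) * ℓ v) ∧
    -- representations of `U(n+1, n+1)(F)` distinguished by the symplectic group
    (∀ π : Representation ℂ (unitaryW σ (n + 1)) V, IsSmoothRep π →
      IsDistinguishedBy π ((symplecticW F E (n + 1)).subgroupOf (unitaryW σ (n + 1))) →
      ∀ U : Subgroup (unitaryW σ (n + 1)), IsMinimalParabolicRadical σ U →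
        ∃ θ : U →* ℂˣ, Continuous θ ∧ Nontrivial (TwistedJacquet π U θ)) := by
  refine ⟨fun π hπ hdist => exists_distinguished_twistedJacquet hE hσ hd hδ hψ hψ1 π hπ hdist,
    fun π hπ hdist => ?_,
    fun π hπ hdist U hU =>
      exists_nontrivial_twistedJacquet hE hσ hd hδ hψ hψ1 π hπ hdist hU⟩
  obtain ⟨ε, hε, ℓ, hℓ, hℓu⟩ :=
    exists_unipotent_equivariant_form hE hσ hd hδ hψ hψ1 n π hπ hdist
  obtain ⟨μ, hμ⟩ := exists_character_of_form (π := π)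
    (N := (upperUnipotent (σ : E →+* E) (n + 1)).subgroupOf (klingenP σ n))
    (c := fun u => psiD ψ δ (superdiagSum ε u.1.1.1)) hℓ fun u v => hℓu u.1 u.2 v
  exact ⟨ε, hε, μ, hμ, ℓ, hℓ, fun u v => by rw [hμ]; exact hℓu u.1 u.2 v⟩
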